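/- Let $n\ge 1$, let $\mathcal M_n$ be the set of complex $n\times n$ matrices, and let $\Omega_n=\{B\in\mathcal M_n : r(B)<1\}$ be the spectral ball, where $r(B)$ is the spectral radius of $B$. Let $\mathbb D\subset\mathbb C$ be the open unit disc. For $A,B\in\Omega_n$ let $$l_{\Omega_n}(A,B)=\inf\{|\alpha| : \alpha\in\mathbb D\text{ and there is a holomorphic }\varphi:\mathbb D\to\Omega_n\text{ with }\varphi(0)=A,\ \varphi(\alpha)=B\}$$ be the Lempert function of $\Omega_n$. A matrix $A\in\mathcal M_n$ is called cyclic if there is $v\in\mathbb C^n$ such that $v,Av,\dots,A^{n-1}v$ span $\mathbb C^n$. Let $A\in\Omega_n$. Then the function $l_{\Omega_n}(A,\cdot):\Omega_n\to[0,1)$ is continuous on $\Omega_n$ if and only if either $A$ is a scalar matrix (that is, $A=\lambda I_n$ for some $\lambda\in\mathbb C$), or $n=2$, $A$ is cyclic and the two eigenvalues of $A$ (counted with algebraic multiplicity) are equal. -/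

import Mathlib

/-- The open unit disc in `ℂ`. -/
def unitDiscSet : Set ℂ := Metric.ball 0 1

/-- The (multiplicative) Lempert function of a subset `D` of a complex topological vector space:
the infimum of `|α|` over `α` in the unit disc such that some holomorphic map `φ` from the unit
disc to `D` satisfies `φ 0 = z` and `φ α = w`. -/
noncomputable def lempertFunction {E : Type*} [AddCommGroup E] [Module ℂ E] [TopologicalSpace E]
    (D : Set E) (z w : E) : ℝ :=
  sInf {t : ℝ | ∃ (α : ℂ) (φ : ℂ → E), α ∈ unitDiscSet ∧ DifferentiableOn ℂ φ unitDiscSet ∧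
    Set.MapsTo φ unitDiscSet D ∧ φ 0 = z ∧ φ α = w ∧ t = ‖α‖}

/-- The spectral ball: complex `n × n` matrices of spectral radius less than `1`. -/
def spectralBall (n : ℕ) : Set (Matrix (Fin n) (Fin n) ℂ) :=
  {A | spectralRadius ℂ A < 1}

/-- A matrix is scalar if it is a multiple of the identity matrix. -/
def IsScalarMatrix {n : ℕ} (A : Matrix (Fin n) (Fin n) ℂ) : Prop :=
  ∃ c : ℂ, A = c • (1 : Matrix (Fin n) (Fin n) ℂ)

/-- A matrix is cyclic if `v, A v, …, A ^ (n - 1) v` span `ℂⁿ` for some vector `v`. -/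
def IsCyclicMatrix {n : ℕ} (A : Matrix (Fin n) (Fin n) ℂ) : Prop :=
  ∃ v : Fin n → ℂ, Submodule.span ℂ (Set.range fun k : Fin n => (A ^ (k : ℕ)).mulVec v) = ⊤

/-! Write l for the Lempert function. Two symmetries drive everything. The disc automorphism
`discAut a`, applied to matrices as `matAut a`, preserves the spectral ball and l, so eigenvalues
can be moved. And if a disc joins A to B at time α ≠ 0, another joins A to any conjugate S B S⁻¹ at
the same time (`Reach.conj_right`): conjugate it by a holomorphic family P(z) of invertible matrices
with P(0) = 1 and P(α) = S. Hence, if l(A, ·) is continuous, l(A, D) ≤ |α| for every limit D of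
conjugates of B in the ball (`lempert_le_of_simLim`). The negative results find a B reached too
quickly for some such degeneration D.

For A = 0, a Schwarz lemma for the spectral radius shows that l(0, ·) is the spectral radius, which
is continuous; automorphisms carry this to all scalar A.

If A has two distinct eigenvalues, automorphisms arrange that one eigenvalue λ strictly dominates
all others in modulus and is no more frequent than some other eigenvalue. A linear pencil then joins
A to a nilpotent N in time less than |λ|. As N degenerates to 0, continuity would give l(A, 0) <
|λ|, whereas l(A, 0) = l(0, A) ≥ |λ| (`not_continuousOn_lempert_of_count_le`).

If A has a single eigenvalue and is not scalar, it may be taken nilpotent and nonzero. For n = m + 1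
≥ 3, compare a small multiple b of a companion matrix with eigenvalues 1 (m times) and -m with b
times the diagonal matrix of the same spectrum. Explicit discs reach the former quickly. For the
latter, bφ-type determinants, det(b - φ) or det((b/α)z - φ), vanish to order m at the endpoint,
which bounds the time from below. The orders of magnitude agree, so constants decide. The discs
differ according to whether A^m is zero.

For n = 2 and A nilpotent and nonzero, a non-scalar matrix is determined up to conjugacy by trace
and determinant. Discs may therefore be perturbed through these two functions alone
(`Reach.perturb`), which gives continuity at non-scalar matrices. At a scalar matrix, l(A, ·) is
squeezed between half the modulus of the trace and the spectral radius. -/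

open Matrix Polynomial Filter Topology

/-! ### Eigenvalue bounds and their semicontinuity -/

section SpectralBounds
variable {ι κ : Type*} [Fintype ι] [DecidableEq ι] [Fintype κ] [DecidableEq κ]

/-- All eigenvalues have modulus less than `t`. -/
def SpecLT (t : ℝ) (A : Matrix ι ι ℂ) : Prop := ∀ x : ℂ, A.charpoly.IsRoot x → ‖x‖ < t

/-- All eigenvalues have modulus at most `t`. -/
def SpecLE (t : ℝ) (A : Matrix ι ι ℂ) : Prop := ∀ x : ℂ, A.charpoly.IsRoot x → ‖x‖ ≤ t

theorem SpecLT.le {t : ℝ} {A : Matrix ι ι ℂ} (h : SpecLT t A) : SpecLE t A := fun x hx => (h x hx).le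

theorem SpecLE.lt {s t : ℝ} {A : Matrix ι ι ℂ} (h : SpecLE s A) (hst : s < t) : SpecLT t A :=
  fun x hx => (h x hx).trans_lt hst

theorem SpecLT.of_charpoly_eq {t : ℝ} {A : Matrix ι ι ℂ} {B : Matrix κ κ ℂ} (h : SpecLT t A)
    (hAB : A.charpoly = B.charpoly) : SpecLT t B := fun x hx => h x (hAB ▸ hx)

theorem isRoot_charpoly_iff_exists_mulVec {A : Matrix ι ι ℂ} {x : ℂ} :
    A.charpoly.IsRoot x ↔ ∃ v : ι → ℂ, v ≠ 0 ∧ A *ᵥ v = x • v := by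
  rw [IsRoot, eval_charpoly, ← exists_mulVec_eq_zero_iff]
  refine exists_congr fun v => and_congr_right fun _ => ?_
  rw [sub_mulVec, sub_eq_zero, eq_comm]
  simp [scalar_apply, ← smul_one_eq_diagonal, smul_mulVec]

theorem mem_spectralBall_iff {n : ℕ} {A : Matrix (Fin n) (Fin n) ℂ} :
    A ∈ spectralBall n ↔ SpecLT 1 A := by
  constructor
  · intro h x hx
    have hx' : x ∈ spectrum ℂ A := mem_spectrum_iff_isRoot_charpoly.2 hx
    have : (‖x‖₊ : ENNReal) ≤ spectralRadius ℂ A := by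
      unfold spectralRadius
      exact le_iSup₂ (f := fun k (_ : k ∈ spectrum ℂ A) => (‖k‖₊ : ENNReal)) x hx'
    have := this.trans_lt h
    exact_mod_cast this
  · intro h
    have hle : spectralRadius ℂ A ≤
        ((A.charpoly.roots.toFinset.sup fun x => ‖x‖₊ : NNReal) : ENNReal) := by
      refine iSup₂_le fun x hx => ?_
      have hx' : x ∈ A.charpoly.roots.toFinset := by
        rw [Multiset.mem_toFinset, mem_roots A.charpoly_monic.ne_zero]
        exact mem_spectrum_iff_isRoot_charpoly.1 hx
      exact_mod_cast Finset.le_sup (f := fun x : ℂ => ‖x‖₊) hx'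
    refine hle.trans_lt ?_
    rw [← ENNReal.coe_one, ENNReal.coe_lt_coe, Finset.sup_lt_iff (by simp)]
    intro x hx
    rw [Multiset.mem_toFinset, mem_roots A.charpoly_monic.ne_zero] at hx
    exact_mod_cast h x hx

/-- The eigenvalue equation is read in the row where the eigenvector is largest. The crude bound
keeps the eigenvalues of nearby matrices in one compact set. -/
theorem norm_root_charpoly_le {A : Matrix ι ι ℂ} {x : ℂ} (hx : A.charpoly.IsRoot x) :
    ‖x‖ ≤ ∑ i, ∑ j, ‖A i j‖ := by
  obtain ⟨v, hv, h⟩ := isRoot_charpoly_iff_exists_mulVec.1 hx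
  obtain ⟨k, hk⟩ := Function.ne_iff.1 hv
  obtain ⟨i, -, hi⟩ := Finset.exists_max_image Finset.univ (fun i => ‖v i‖) ⟨k, Finset.mem_univ k⟩
  have hpos : 0 < ‖v i‖ := (norm_pos_iff.2 hk).trans_le (hi k (Finset.mem_univ k))
  have h1 : ‖x‖ * ‖v i‖ ≤ (∑ j, ‖A i j‖) * ‖v i‖ := by
    have h2 := congrFun h i
    rw [← norm_mul]
    calc ‖x * v i‖ = ‖∑ j, A i j * v j‖ := by
          rw [← smul_eq_mul, ← Pi.smul_apply, ← h2]; rfl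
      _ ≤ ∑ j, ‖A i j * v j‖ := norm_sum_le _ _
      _ ≤ ∑ j, ‖A i j‖ * ‖v i‖ := Finset.sum_le_sum fun j _ => by
          rw [norm_mul]; exact mul_le_mul_of_nonneg_left (hi j (Finset.mem_univ j)) (norm_nonneg _)
      _ = _ := by rw [Finset.sum_mul]
  refine (le_of_mul_le_mul_right h1 hpos).trans ?_
  exact Finset.single_le_sum (f := fun i => ∑ j, ‖A i j‖)
    (fun i _ => Finset.sum_nonneg fun j _ => norm_nonneg _) (Finset.mem_univ i)

theorem continuous_eval_charpoly :
    Continuous fun p : Matrix ι ι ℂ × ℂ => p.1.charpoly.eval p.2 := by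
  simp_rw [eval_charpoly, scalar_apply]
  refine Continuous.matrix_det (Continuous.sub ?_ continuous_fst)
  exact Continuous.matrix_diagonal (continuous_pi fun _ => continuous_snd)

theorem card_roots_charpoly (A : Matrix ι ι ℂ) : A.charpoly.roots.card = Fintype.card ι := by
  rw [← (IsAlgClosed.splits A.charpoly).natDegree_eq_card_roots, charpoly_natDegree_eq_dim]

theorem exists_charpoly_eq_prod (A : Matrix ι ι ℂ) :
    ∃ d : ι → ℂ, A.charpoly = ∏ i, (X - C (d i)) := by
  obtain ⟨l, hl⟩ := Quotient.exists_rep A.charpoly.roots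
  have hlen : l.length = Fintype.card ι := by
    rw [← card_roots_charpoly A, ← hl]; rfl
  let e : ι ≃ Fin l.length := (Fintype.equivFin ι).trans (finCongr hlen.symm)
  refine ⟨fun i => l.get (e i), ?_⟩
  conv_lhs => rw [(IsAlgClosed.splits A.charpoly).eq_prod_roots_of_monic A.charpoly_monic, ← hl]
  rw [Equiv.prod_comp e (fun j => (X - C (l.get j)))]
  rw [← List.prod_ofFn]
  change ((l : Multiset ℂ).map _).prod = _
  rw [Multiset.map_coe, Multiset.prod_coe]
  congr 1
  conv_lhs => rw [← List.ofFn_get l]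
  rw [List.map_ofFn]; rfl

/-- Each linear factor has modulus at least `‖x‖ - t`. This quantitative lower bound passes to
limits, so no continuity of individual eigenvalues is needed. -/
theorem le_norm_eval_charpoly {A : Matrix ι ι ℂ} {t : ℝ} (h : SpecLE t A) {x : ℂ} (hx : t ≤ ‖x‖) :
    (‖x‖ - t) ^ Fintype.card ι ≤ ‖A.charpoly.eval x‖ := by
  obtain ⟨d, hd⟩ := exists_charpoly_eq_prod A
  have hroot : ∀ i, ‖d i‖ ≤ t := fun i => h _ (by
    rw [hd, IsRoot, eval_prod]; exact Finset.prod_eq_zero (Finset.mem_univ i) (by simp))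
  rw [hd, eval_prod, norm_prod, ← Finset.card_univ, ← Finset.prod_const]
  refine Finset.prod_le_prod (fun i _ => sub_nonneg.2 hx) fun i _ => ?_
  have := norm_sub_norm_le x (d i)
  simp only [eval_sub, eval_X, eval_C]
  linarith [hroot i]

theorem isClosed_specLE (t : ℝ) : IsClosed {A : Matrix ι ι ℂ | SpecLE t A} := by
  refine isClosed_iff_clusterPt.2 fun A hA x hx => ?_
  by_contra! hlt
  have hpos : 0 < (‖x‖ - t) ^ Fintype.card ι := pow_pos (sub_pos.2 hlt) _
  have hcont : Continuous fun B : Matrix ι ι ℂ => ‖B.charpoly.eval x‖ :=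
    (continuous_eval_charpoly.comp (continuous_id.prodMk continuous_const)).norm
  have hcl : IsClosed {B : Matrix ι ι ℂ | (‖x‖ - t) ^ Fintype.card ι ≤ ‖B.charpoly.eval x‖} :=
    isClosed_le continuous_const hcont
  have hsub : {B : Matrix ι ι ℂ | SpecLE t B} ⊆
      {B : Matrix ι ι ℂ | (‖x‖ - t) ^ Fintype.card ι ≤ ‖B.charpoly.eval x‖} :=
    fun B hB => le_norm_eval_charpoly hB hlt.le
  have := hcl.closure_subset_iff.2 hsub (mem_closure_iff_clusterPt.2 hA)
  rw [Set.mem_ofPred_eq, show A.charpoly.eval x = 0 from hx, norm_zero] at this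
  linarith

/-- Near `A`, an eigenvalue violating the bound would lie in a fixed compact annulus, and
non-vanishing of the characteristic polynomial on a compact set is an open condition. -/
theorem isOpen_specLT (t : ℝ) : IsOpen {A : Matrix ι ι ℂ | SpecLT t A} := by
  rw [isOpen_iff_mem_nhds]
  intro A hA
  set M : ℝ := (∑ i, ∑ j, ‖A i j‖) + 1
  have hbound : ∀ᶠ B : Matrix ι ι ℂ in 𝓝 A, ∑ i, ∑ j, ‖B i j‖ < M := by
    have : Continuous fun B : Matrix ι ι ℂ => ∑ i, ∑ j, ‖B i j‖ :=
      continuous_finsetSum _ fun i _ => continuous_finsetSum _ fun j _ =>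
        (continuous_id.matrix_elem i j).norm
    exact this.continuousAt.eventually (gt_mem_nhds (lt_add_one _))
  have hK : IsCompact {x : ℂ | t ≤ ‖x‖ ∧ ‖x‖ ≤ M} := by
    refine (isCompact_closedBall (0 : ℂ) M).of_isClosed_subset ?_ fun x hx => by simpa using hx.2
    exact (isClosed_le continuous_const continuous_norm).inter
      (isClosed_le continuous_norm continuous_const)
  have hne : ∀ᶠ B : Matrix ι ι ℂ in 𝓝 A, ∀ x ∈ {x : ℂ | t ≤ ‖x‖ ∧ ‖x‖ ≤ M},
      B.charpoly.eval x ≠ 0 := by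
    refine hK.eventually_forall_of_forall_eventually fun x hx => ?_
    refine ContinuousAt.eventually_ne (g := fun p : Matrix ι ι ℂ × ℂ => p.1.charpoly.eval p.2)
      continuous_eval_charpoly.continuousAt fun h0 => ?_
    exact absurd (hA x h0) (not_lt.2 hx.1)
  filter_upwards [hbound, hne] with B h1 h2 x hx
  by_contra! hlt
  exact h2 x ⟨hlt, (norm_root_charpoly_le hx).trans h1.le⟩ hx

theorem isRoot_charpoly_smul {A : Matrix ι ι ℂ} {c y : ℂ} (hc : c ≠ 0)
    (h : (c • A).charpoly.IsRoot y) : A.charpoly.IsRoot (c⁻¹ * y) := by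
  obtain ⟨v, hv, h⟩ := isRoot_charpoly_iff_exists_mulVec.1 h
  refine isRoot_charpoly_iff_exists_mulVec.2 ⟨v, hv, ?_⟩
  rw [mul_smul, ← h, smul_mulVec, smul_smul, inv_mul_cancel₀ hc, one_smul]

theorem isRoot_charpoly_zero {y : ℂ} (h : (0 : Matrix ι ι ℂ).charpoly.IsRoot y) : y = 0 := by
  obtain ⟨v, hv, h⟩ := isRoot_charpoly_iff_exists_mulVec.1 h
  rw [zero_mulVec, eq_comm, smul_eq_zero] at h
  exact h.resolve_right hv

theorem SpecLT.smul {A : Matrix ι ι ℂ} {t s : ℝ} {c : ℂ} (h : SpecLT t A) (hs : 0 < s)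
    (hc : ‖c‖ * t ≤ s) : SpecLT s (c • A) := by
  intro y hy
  rcases eq_or_ne c 0 with rfl | h0
  · rw [zero_smul] at hy; simpa [isRoot_charpoly_zero hy] using hs
  · have := h _ (isRoot_charpoly_smul h0 hy)
    have hpos := norm_pos_iff.2 h0
    rw [norm_mul, norm_inv, inv_mul_lt_iff₀ hpos] at this
    exact this.trans_le hc

theorem SpecLE.smul {A : Matrix ι ι ℂ} {t s : ℝ} {c : ℂ} (h : SpecLE t A) (hs : 0 ≤ s)
    (hc : ‖c‖ * t ≤ s) : SpecLE s (c • A) := by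
  intro y hy
  rcases eq_or_ne c 0 with rfl | h0
  · rw [zero_smul] at hy; simpa [isRoot_charpoly_zero hy] using hs
  · have := h _ (isRoot_charpoly_smul h0 hy)
    have hpos := norm_pos_iff.2 h0
    rw [norm_mul, norm_inv, inv_mul_le_iff₀ hpos] at this
    exact this.trans hc

theorem specLT_zero {t : ℝ} (ht : 0 < t) : SpecLT t (0 : Matrix ι ι ℂ) := fun x hx => by
  simpa [isRoot_charpoly_zero hx] using ht

end SpectralBounds

/-! ### Entrywise holomorphic matrix functions -/

section Holomorphic
variable {ι κ μ : Type*}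

/-- Entrywise holomorphy of a matrix valued function. -/
def HolOn (F : ℂ → Matrix ι κ ℂ) (U : Set ℂ) : Prop :=
  ∀ i j, DifferentiableOn ℂ (fun z => F z i j) U

theorem differentiableOn_matrix_iff {n : ℕ} {F : ℂ → Matrix (Fin n) (Fin n) ℂ} {U : Set ℂ} :
    DifferentiableOn ℂ F U ↔ HolOn F U := by
  have h1 : DifferentiableOn ℂ F U ↔
      ∀ i, DifferentiableOn ℂ (fun z => (F z i : Fin n → ℂ)) U :=
    differentiableOn_pi (E := ℂ) (F' := fun _ : Fin n => Fin n → ℂ) (Φ := F)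
  rw [h1]
  exact forall_congr' fun i => differentiableOn_pi

theorem HolOn.mono {F : ℂ → Matrix ι κ ℂ} {U V : Set ℂ} (h : HolOn F V) (hUV : U ⊆ V) :
    HolOn F U := fun i j => (h i j).mono hUV

theorem holOn_const (A : Matrix ι κ ℂ) (U : Set ℂ) : HolOn (fun _ => A) U :=
  fun _ _ => differentiableOn_const _

theorem HolOn.add {F G : ℂ → Matrix ι κ ℂ} {U : Set ℂ} (hF : HolOn F U) (hG : HolOn G U) :
    HolOn (fun z => F z + G z) U := fun i j => (hF i j).add (hG i j)

theorem HolOn.sub {F G : ℂ → Matrix ι κ ℂ} {U : Set ℂ} (hF : HolOn F U) (hG : HolOn G U) :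
    HolOn (fun z => F z - G z) U := fun i j => (hF i j).sub (hG i j)

theorem HolOn.smul {f : ℂ → ℂ} {G : ℂ → Matrix ι κ ℂ} {U : Set ℂ} (hf : DifferentiableOn ℂ f U)
    (hG : HolOn G U) : HolOn (fun z => f z • G z) U := fun i j => hf.mul (hG i j)

theorem HolOn.mul [Fintype κ] {F : ℂ → Matrix ι κ ℂ} {G : ℂ → Matrix κ μ ℂ} {U : Set ℂ}
    (hF : HolOn F U) (hG : HolOn G U) : HolOn (fun z => F z * G z) U := fun i j => by
  simp only [Matrix.mul_apply]
  exact DifferentiableOn.fun_sum fun k _ => (hF i k).mul (hG k j)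

theorem HolOn.comp {F : ℂ → Matrix ι κ ℂ} {g : ℂ → ℂ} {U V : Set ℂ} (hF : HolOn F U)
    (hg : DifferentiableOn ℂ g V) (hVU : Set.MapsTo g V U) : HolOn (fun z => F (g z)) V :=
  fun i j => (hF i j).comp hg hVU

theorem HolOn.continuousOn {F : ℂ → Matrix ι κ ℂ} {U : Set ℂ} (hF : HolOn F U) :
    ContinuousOn F U :=
  continuousOn_pi.2 fun i => continuousOn_pi.2 fun j => (hF i j).continuousOn

theorem HolOn.det [Fintype ι] [DecidableEq ι] {F : ℂ → Matrix ι ι ℂ} {U : Set ℂ}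
    (hF : HolOn F U) : DifferentiableOn ℂ (fun z => (F z).det) U := by
  simp only [Matrix.det_apply]
  refine DifferentiableOn.fun_sum fun σ _ => ?_
  refine DifferentiableOn.const_smul ?_ _
  exact DifferentiableOn.fun_finsetProd fun i _ => hF _ _

end Holomorphic

/-! ### Maximum principle for the spectral radius -/

section MaximumPrinciple
variable {ι : Type*} [Fintype ι] [DecidableEq ι]

theorem differentiableOn_eval_charpoly {F : ℂ → Matrix ι ι ℂ} {U : Set ℂ} (hF : HolOn F U) (x : ℂ) :
    DifferentiableOn ℂ (fun z => (F z).charpoly.eval x) U := by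
  simp only [eval_charpoly]
  exact ((holOn_const _ U).sub hF).det

/-- Take an eigenvalue `x` of some `F w` of largest modulus over the closed disc. If `‖x‖ > t`, the
ordinary maximum principle applied to 1 / det(τx - F) bounds det(τx - F w) away from 0 uniformly in
τ > 1, and τ → 1 contradicts det(x - F w) = 0. -/
theorem specLE_of_circle {F : ℂ → Matrix ι ι ℂ} {R s t : ℝ} (hF : HolOn F (Metric.ball 0 R))
    (hs0 : 0 < s) (hs : s < R) (hcirc : ∀ z : ℂ, ‖z‖ = s → SpecLE t (F z)) {z : ℂ}
    (hz : ‖z‖ ≤ s) : SpecLE t (F z) := by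
  classical
  intro x₀ hx₀
  by_contra! hlt
  have hsub : Metric.closedBall (0 : ℂ) s ⊆ Metric.ball 0 R := Metric.closedBall_subset_ball hs
  have hFc : ContinuousOn F (Metric.closedBall 0 s) := hF.continuousOn.mono hsub
  have hcomp := isCompact_closedBall (0 : ℂ) s
  obtain ⟨M, hM⟩ : ∃ M, ∀ z ∈ Metric.closedBall (0 : ℂ) s, ∑ i, ∑ j, ‖F z i j‖ ≤ M := by
    have : ContinuousOn (fun z => ∑ i, ∑ j, ‖F z i j‖) (Metric.closedBall (0 : ℂ) s) :=
      continuousOn_finsetSum _ fun i _ => continuousOn_finsetSum _ fun j _ =>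
        ((hF i j).continuousOn.mono hsub).norm
    obtain ⟨M, hM⟩ := hcomp.bddAbove_image this
    exact ⟨M, fun z hz => hM ⟨z, hz, rfl⟩⟩
  set S : Set (ℂ × ℂ) := (Metric.closedBall (0 : ℂ) s ×ˢ Metric.closedBall (0 : ℂ) M) ∩
    (fun p : ℂ × ℂ => (F p.1).charpoly.eval p.2) ⁻¹' {0} with hS
  have hScomp : IsCompact S := by
    refine (hcomp.prod (isCompact_closedBall (0 : ℂ) M)).of_isClosed_subset ?_ Set.inter_subset_left
    refine ContinuousOn.preimage_isClosed_of_isClosed ?_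
      (Metric.isClosed_closedBall.prod Metric.isClosed_closedBall) isClosed_singleton
    refine continuous_eval_charpoly.comp_continuousOn
      (f := fun p : ℂ × ℂ => (F p.1, p.2)) (ContinuousOn.prodMk ?_ continuousOn_snd)
    exact hFc.comp continuousOn_fst fun p hp => hp.1
  have hmem : ∀ {w x : ℂ}, ‖w‖ ≤ s → (F w).charpoly.IsRoot x → (w, x) ∈ S := fun {w x} hw hx =>
    ⟨⟨by simpa using hw, by
      simpa using (norm_root_charpoly_le hx).trans (hM w (by simpa using hw))⟩, hx⟩
  obtain ⟨⟨w, x⟩, hwx, hmax⟩ := hScomp.exists_isMaxOn ⟨_, hmem hz hx₀⟩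
    (f := fun p : ℂ × ℂ => ‖p.2‖) continuous_snd.norm.continuousOn
  have hwx1 : ‖w‖ ≤ s := by simpa using hwx.1.1
  have hroot : (F w).charpoly.eval x = 0 := hwx.2
  have hxt : t < ‖x‖ := hlt.trans_le (hmax (hmem hz hx₀))
  have hle : ∀ {u : ℂ}, ‖u‖ ≤ s → SpecLE ‖x‖ (F u) := fun hu y hy => hmax (hmem hu hy)
  -- lower bound at w for slightly larger multiples of x
  have ht0 : 0 ≤ t := by
    have h1 : ‖(s : ℂ)‖ = s := by simp [abs_of_pos hs0]
    obtain ⟨d, hd⟩ := exists_charpoly_eq_prod (F s)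
    have hι : Nonempty ι := by
      by_contra hne
      rw [not_nonempty_iff] at hne
      rw [IsRoot, charpoly_isEmpty] at hx₀
      simp at hx₀
    obtain ⟨i⟩ := hι
    refine (norm_nonneg (d i)).trans (hcirc s h1 _ ?_)
    rw [hd, IsRoot, eval_prod]; exact Finset.prod_eq_zero (Finset.mem_univ i) (by simp)
  -- The factor τ > 1 moves the point beyond every eigenvalue over the closed disc, so the
  -- reciprocal has no pole.
  have key : ∀ τ : ℝ, 1 < τ → (‖x‖ - t) ^ Fintype.card ι ≤ ‖(F w).charpoly.eval (τ * x)‖ := by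
    intro τ hτ
    have hx0 : 0 < ‖x‖ := ht0.trans_lt hxt
    have hτx : ‖x‖ < ‖(τ : ℂ) * x‖ := by
      rw [norm_mul, Complex.norm_real, Real.norm_eq_abs, abs_of_pos (by linarith)]
      nlinarith
    have hne : ∀ u ∈ Metric.closedBall (0 : ℂ) s, (F u).charpoly.eval (τ * x) ≠ 0 := by
      intro u hu h0
      have := hle (u := u) (by simpa using hu) _ h0
      linarith
    set g : ℂ → ℂ := fun u => ((F u).charpoly.eval (τ * x))⁻¹
    have hd : DiffContOnCl ℂ g (Metric.ball 0 s) := by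
      refine DifferentiableOn.diffContOnCl ?_
      rw [closure_ball _ hs0.ne']
      exact ((differentiableOn_eval_charpoly hF _).mono hsub).inv hne
    have hpos : 0 < (‖x‖ - t) ^ Fintype.card ι := pow_pos (sub_pos.2 hxt) _
    have hb := Complex.norm_le_of_forall_mem_frontier_norm_le Metric.isBounded_ball hd
      (C := ((‖x‖ - t) ^ Fintype.card ι)⁻¹) (fun u hu => ?_) (z := w)
      (by rw [closure_ball _ hs0.ne']; simpa using hwx1)
    · simp only [g, norm_inv] at hb
      exact (inv_le_inv₀ (norm_pos_iff.2 (hne w (by simpa using hwx1))) hpos).1 hb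
    · rw [frontier_ball _ hs0.ne'] at hu
      have hu' : ‖u‖ = s := by simpa using hu
      simp only [g, norm_inv]
      refine inv_anti₀ hpos ?_
      refine le_trans ?_ (le_norm_eval_charpoly (hcirc u hu') (hxt.le.trans hτx.le))
      exact pow_le_pow_left₀ (sub_pos.2 hxt).le (by linarith) _
  have hcont : Tendsto (fun τ : ℝ => ‖(F w).charpoly.eval (τ * x)‖) (𝓝[>] 1)
      (𝓝 ‖(F w).charpoly.eval ((1 : ℝ) * x)‖) := by
    refine Tendsto.mono_left ?_ nhdsWithin_le_nhds
    refine Continuous.tendsto (f := fun τ : ℝ => ‖(F w).charpoly.eval (τ * x)‖) ?_ 1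
    exact ((F w).charpoly.continuous.comp (by fun_prop)).norm
  have := ge_of_tendsto hcont (eventually_mem_nhdsWithin.mono fun τ hτ => key τ hτ)
  rw [Complex.ofReal_one, one_mul, hroot, norm_zero] at this
  exact absurd this (not_le.2 (pow_pos (sub_pos.2 hxt) _))

/-- The open sets `SpecLT s` with `s < t` form a directed cover of the compact image, so a single
`s` suffices. -/
theorem exists_specLE_of_isCompact {α : Type*} [TopologicalSpace α] {F : α → Matrix ι ι ℂ}
    {K : Set α} (hK : IsCompact K) (hF : ContinuousOn F K) {t : ℝ} (ht : 0 < t)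
    (h : ∀ z ∈ K, SpecLT t (F z)) : ∃ s, 0 ≤ s ∧ s < t ∧ ∀ z ∈ K, SpecLE s (F z) := by
  have himg := hK.image_of_continuousOn hF
  have hcover : F '' K ⊆ ⋃ s : Set.Iio t, {A | SpecLT s.1 A} := by
    rintro _ ⟨z, hz, rfl⟩
    have hfin : (F z).charpoly.roots.toFinset.sup (fun x => ‖x‖₊) < t.toNNReal := by
      rw [Finset.sup_lt_iff (by simpa using ht)]
      intro x hx
      rw [Multiset.mem_toFinset, mem_roots (F z).charpoly_monic.ne_zero] at hx
      exact Real.lt_toNNReal_iff_coe_lt.2 (h z hz x hx)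
    set m := (F z).charpoly.roots.toFinset.sup (fun x => ‖x‖₊)
    have hm : (m : ℝ) < t := Real.lt_toNNReal_iff_coe_lt.1 hfin
    refine Set.mem_iUnion.2 ⟨⟨(m + t) / 2, by simp only [Set.mem_Iio]; linarith⟩, fun x hx => ?_⟩
    have h2 : ‖x‖₊ ≤ m := Finset.le_sup (f := fun x : ℂ => ‖x‖₊) (by
      rwa [Multiset.mem_toFinset, mem_roots (F z).charpoly_monic.ne_zero])
    have h3 : ‖x‖ ≤ m := h2
    simp only
    linarith
  have : Nonempty (Set.Iio t) := ⟨⟨t - 1, by simp⟩⟩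
  obtain ⟨⟨s, hs⟩, hsub⟩ := himg.elim_directed_cover _ (fun s : Set.Iio t => isOpen_specLT s.1) hcover
    (fun a b => ⟨max a b, fun A hA x hx => (hA x hx).trans_le (by
      exact_mod_cast le_max_left a b), fun A hA x hx => (hA x hx).trans_le (by
      exact_mod_cast le_max_right a b)⟩)
  refine ⟨max 0 s, le_max_left _ _, max_lt ht hs, fun z hz x hx => ?_⟩
  exact (hsub ⟨z, hz, rfl⟩ x hx).le.trans (le_max_right _ _)

theorem specLT_of_circle {F : ℂ → Matrix ι ι ℂ} {R s t : ℝ} (hF : HolOn F (Metric.ball 0 R))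
    (hs0 : 0 < s) (hs : s < R) (ht : 0 < t) (hcirc : ∀ z : ℂ, ‖z‖ = s → SpecLT t (F z)) {z : ℂ}
    (hz : ‖z‖ ≤ s) : SpecLT t (F z) := by
  obtain ⟨s', -, hs', h⟩ := exists_specLE_of_isCompact (isCompact_sphere (0 : ℂ) s)
    (hF.continuousOn.mono (Metric.sphere_subset_closedBall.trans
      (Metric.closedBall_subset_ball hs))) ht fun z hz => hcirc z (by simpa using hz)
  exact (specLE_of_circle hF hs0 hs (fun z hz => h z (by simpa using hz)) hz).lt hs'

end MaximumPrinciple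

/-! ### Disc automorphisms acting on matrices -/

section Moebius

/-- The automorphism `z ↦ (z - a) / (1 - conj a * z)` of the unit disc. -/
noncomputable def discAut (a z : ℂ) : ℂ := (z - a) / (1 - starRingEnd ℂ a * z)

theorem one_sub_conj_mul_ne_zero {a z : ℂ} (ha : ‖a‖ < 1) (hz : ‖z‖ ≤ 1) :
    1 - starRingEnd ℂ a * z ≠ 0 := by
  intro h
  have h1 : ‖starRingEnd ℂ a * z‖ = 1 := by rw [← sub_eq_zero.1 h, norm_one]
  rw [norm_mul, RCLike.norm_conj] at h1
  nlinarith [norm_nonneg a, norm_nonneg z]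

theorem normSq_discAut_identity (a z : ℂ) :
    ‖1 - starRingEnd ℂ a * z‖ ^ 2 - ‖z - a‖ ^ 2 = (1 - ‖a‖ ^ 2) * (1 - ‖z‖ ^ 2) := by
  simp only [← Complex.normSq_eq_norm_sq, Complex.normSq_apply]
  simp
  ring

theorem norm_discAut_lt_one {a z : ℂ} (ha : ‖a‖ < 1) (hz : ‖z‖ < 1) : ‖discAut a z‖ < 1 := by
  have h0 := one_sub_conj_mul_ne_zero ha hz.le
  rw [discAut, norm_div, div_lt_one (norm_pos_iff.2 h0)]
  refine lt_of_pow_lt_pow_left₀ 2 (norm_nonneg _) ?_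
  have h1 := normSq_discAut_identity a z
  have h2 : 0 < (1 - ‖a‖ ^ 2) * (1 - ‖z‖ ^ 2) :=
    mul_pos (by nlinarith [norm_nonneg a]) (by nlinarith [norm_nonneg z])
  linarith

theorem differentiableOn_discAut {a : ℂ} (ha : ‖a‖ < 1) :
    DifferentiableOn ℂ (discAut a) (Metric.ball 0 1) := by
  unfold discAut
  refine DifferentiableOn.div (by fun_prop) (by fun_prop) fun z hz => ?_
  exact one_sub_conj_mul_ne_zero ha (by simpa using (mem_ball_zero_iff.1 hz).le)

variable {ι : Type*} [Fintype ι] [DecidableEq ι]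

theorem det_smul_one_sub_smul {B : Matrix ι ι ℂ} {d : ι → ℂ}
    (hd : B.charpoly = ∏ i, (X - C (d i))) (a b : ℂ) :
    (a • (1 : Matrix ι ι ℂ) - b • B).det = ∏ i, (a - b * d i) := by
  rcases eq_or_ne b 0 with rfl | hb
  · simp
  · have h := eval_charpoly B (a / b)
    rw [hd, eval_prod] at h
    have h1 : a • (1 : Matrix ι ι ℂ) - b • B = b • (scalar ι (a / b) - B) := by
      rw [smul_sub, scalar_apply, ← smul_one_eq_diagonal, smul_smul, mul_div_cancel₀ _ hb]
    rw [h1, det_smul, ← h, ← Finset.card_univ, ← Finset.prod_const, ← Finset.prod_mul_distrib]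
    refine Finset.prod_congr rfl fun i _ => ?_
    simp only [eval_sub, eval_X, eval_C]
    field_simp

theorem isRoot_of_charpoly_eq_prod {B : Matrix ι ι ℂ} {d : ι → ℂ}
    (hd : B.charpoly = ∏ i, (X - C (d i))) (i : ι) : B.charpoly.IsRoot (d i) := by
  rw [hd, IsRoot, eval_prod]; exact Finset.prod_eq_zero (Finset.mem_univ i) (by simp)

theorem exists_eq_of_isRoot {B : Matrix ι ι ℂ} {d : ι → ℂ}
    (hd : B.charpoly = ∏ i, (X - C (d i))) {x : ℂ} (hx : B.charpoly.IsRoot x) : ∃ i, x = d i := by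
  rw [hd, IsRoot, eval_prod, Finset.prod_eq_zero_iff] at hx
  obtain ⟨i, -, hi⟩ := hx
  exact ⟨i, by simpa [sub_eq_zero] using hi⟩

theorem det_one_sub_smul_ne_zero {B : Matrix ι ι ℂ} (hB : SpecLT 1 B) {c : ℂ} (hc : ‖c‖ ≤ 1) :
    ((1 : Matrix ι ι ℂ) - c • B).det ≠ 0 := by
  obtain ⟨d, hd⟩ := exists_charpoly_eq_prod B
  have := det_smul_one_sub_smul hd 1 c
  rw [one_smul] at this
  rw [this, Finset.prod_ne_zero_iff]
  intro i _ h
  have h1 := hB _ (isRoot_of_charpoly_eq_prod hd i)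
  have h2 : ‖c * d i‖ = 1 := by rw [← sub_eq_zero.1 h, norm_one]
  rw [norm_mul] at h2
  nlinarith [norm_nonneg c, norm_nonneg (d i)]

/-- The automorphism of the spectral ball induced by `discAut a`. -/
noncomputable def matAut (a : ℂ) (B : Matrix ι ι ℂ) : Matrix ι ι ℂ :=
  (B - a • 1) * (1 - starRingEnd ℂ a • B)⁻¹

theorem charpoly_matAut {a : ℂ} (ha : ‖a‖ < 1) {B : Matrix ι ι ℂ} (hB : SpecLT 1 B) {d : ι → ℂ}
    (hd : B.charpoly = ∏ i, (X - C (d i))) :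
    (matAut a B).charpoly = ∏ i, (X - C (discAut a (d i))) := by
  refine Polynomial.funext fun x => ?_
  have hD := det_one_sub_smul_ne_zero hB (c := starRingEnd ℂ a) (by rw [RCLike.norm_conj]; exact ha.le)
  have hDu := isUnit_iff_ne_zero.2 hD
  have hdetD := det_smul_one_sub_smul hd 1 (starRingEnd ℂ a)
  rw [one_smul] at hdetD
  -- Clearing the denominator leaves a matrix affine in `B`, whose determinant factors over the
  -- eigenvalues.
  have h1 : (scalar ι x - matAut a B) * (1 - starRingEnd ℂ a • B) =
      (x + a) • (1 : Matrix ι ι ℂ) - (1 + x * starRingEnd ℂ a) • B := by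
    rw [sub_mul, matAut, nonsing_inv_mul_cancel_right _ _ hDu, scalar_apply, ← smul_one_eq_diagonal,
      smul_mul_assoc, one_mul, smul_sub, smul_smul]
    module
  have h2 := congrArg Matrix.det h1
  rw [det_mul, det_smul_one_sub_smul hd, hdetD] at h2
  rw [hdetD] at hD
  rw [eval_charpoly, eval_prod, ← mul_left_inj' hD, h2, ← Finset.prod_mul_distrib]
  refine Finset.prod_congr rfl fun i _ => ?_
  have h3 := one_sub_conj_mul_ne_zero ha (hB _ (isRoot_of_charpoly_eq_prod hd i)).le
  simp only [eval_sub, eval_X, eval_C, discAut]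
  field_simp
  ring

theorem SpecLT.matAut {a : ℂ} (ha : ‖a‖ < 1) {B : Matrix ι ι ℂ} (hB : SpecLT 1 B) :
    SpecLT 1 (matAut a B) := by
  obtain ⟨d, hd⟩ := exists_charpoly_eq_prod B
  intro x hx
  obtain ⟨i, rfl⟩ := exists_eq_of_isRoot (charpoly_matAut ha hB hd) hx
  exact norm_discAut_lt_one ha (hB _ (isRoot_of_charpoly_eq_prod hd i))

theorem matAut_neg_matAut {a : ℂ} (ha : ‖a‖ < 1) {B : Matrix ι ι ℂ} (hB : SpecLT 1 B) :
    _root_.matAut (-a) (_root_.matAut a B) = B := by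
  have hD := isUnit_iff_ne_zero.2
    (det_one_sub_smul_ne_zero hB (c := starRingEnd ℂ a) (by rw [RCLike.norm_conj]; exact ha.le))
  have hM := isUnit_iff_ne_zero.2 (det_one_sub_smul_ne_zero (hB.matAut ha)
    (c := starRingEnd ℂ (-a)) (by rw [RCLike.norm_conj, norm_neg]; exact ha.le))
  have key : _root_.matAut a B - (-a) • 1 = B * (1 - starRingEnd ℂ (-a) • _root_.matAut a B) := by
    have : (_root_.matAut a B - (-a) • 1) * (1 - starRingEnd ℂ a • B) =
        B * (1 - starRingEnd ℂ (-a) • _root_.matAut a B) * (1 - starRingEnd ℂ a • B) := by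
      have h0 : _root_.matAut a B * (1 - starRingEnd ℂ a • B) = B - a • 1 := by
        rw [_root_.matAut, nonsing_inv_mul_cancel_right _ _ hD]
      have h1 : (1 - starRingEnd ℂ (-a) • _root_.matAut a B) * (1 - starRingEnd ℂ a • B) =
          (1 - starRingEnd ℂ a * a) • 1 := by
        rw [sub_mul, smul_mul_assoc, h0, map_neg, one_mul]; module
      rw [mul_assoc, h1, sub_mul, h0, smul_mul_assoc, one_mul, mul_smul_comm, mul_one]
      module
    have h := congrArg (· * (1 - starRingEnd ℂ a • B)⁻¹) this
    simpa only [mul_nonsing_inv_cancel_right _ _ hD] using h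
  conv_lhs => rw [_root_.matAut]
  rw [key, mul_nonsing_inv_cancel_right _ _ hM]

theorem HolOn.inv {F : ℂ → Matrix ι ι ℂ} {U : Set ℂ} (hF : HolOn F U)
    (h : ∀ z ∈ U, (F z).det ≠ 0) : HolOn (fun z => (F z)⁻¹) U := by
  intro i j
  simp only [inv_def, Ring.inverse_eq_inv', Matrix.smul_apply, adjugate_apply, smul_eq_mul]
  refine (hF.det.inv h).mul (HolOn.det fun k l => ?_)
  rcases eq_or_ne k j with rfl | hk
  · simp only [updateRow_self]; exact differentiableOn_const _
  · simp only [updateRow_ne hk]; exact hF k l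

theorem HolOn.matAut {a : ℂ} (ha : ‖a‖ < 1) {F : ℂ → Matrix ι ι ℂ} {U : Set ℂ} (hF : HolOn F U)
    (h : ∀ z ∈ U, SpecLT 1 (F z)) : HolOn (fun z => _root_.matAut a (F z)) U := by
  unfold _root_.matAut
  refine (hF.sub (holOn_const _ U)).mul (HolOn.inv ?_ fun z hz => ?_)
  · exact (holOn_const _ U).sub (HolOn.smul (differentiableOn_const _) hF)
  · exact det_one_sub_smul_ne_zero (h z hz) (by rw [RCLike.norm_conj]; exact ha.le)

theorem continuousOn_matAut {a : ℂ} (ha : ‖a‖ < 1) :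
    ContinuousOn (matAut a : Matrix ι ι ℂ → Matrix ι ι ℂ) {B | SpecLT 1 B} := by
  unfold matAut
  simp only [inv_def, Ring.inverse_eq_inv']
  have hc : Continuous fun B : Matrix ι ι ℂ => 1 - starRingEnd ℂ a • B :=
    by fun_prop
  refine ContinuousOn.mul (continuous_id.sub continuous_const).continuousOn
    (ContinuousOn.smul (f := fun B : Matrix ι ι ℂ => (1 - starRingEnd ℂ a • B).det⁻¹) ?_
      hc.matrix_adjugate.continuousOn)
  exact hc.matrix_det.continuousOn.inv₀ fun B hB =>
    det_one_sub_smul_ne_zero hB (by rw [RCLike.norm_conj]; exact ha.le)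

theorem matAut_smul_one {a c : ℂ} (ha : ‖a‖ < 1) (hc : ‖c‖ < 1) :
    matAut a (c • (1 : Matrix ι ι ℂ)) = discAut a c • 1 := by
  have h := one_sub_conj_mul_ne_zero ha hc.le
  have h1 : (1 : Matrix ι ι ℂ) - starRingEnd ℂ a • c • (1 : Matrix ι ι ℂ) =
      (1 - starRingEnd ℂ a * c) • 1 := by module
  have h2 : ((1 - starRingEnd ℂ a * c) • (1 : Matrix ι ι ℂ))⁻¹ =
      (1 - starRingEnd ℂ a * c)⁻¹ • 1 := by
    refine inv_eq_right_inv ?_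
    rw [smul_mul_smul_comm, mul_inv_cancel₀ h, one_mul, one_smul]
  rw [matAut, h1, h2, ← sub_smul, smul_mul_smul_comm, one_mul, discAut, div_eq_mul_inv]

end Moebius

/-! ### Analytic discs between two matrices, and their symmetries -/

section Reach
variable {n : ℕ}

/-- There is an analytic disc in the spectral ball through `A` at `0` and `B` at `α`. -/
def Reach (A B : Matrix (Fin n) (Fin n) ℂ) (α : ℂ) : Prop :=
  ‖α‖ < 1 ∧ ∃ φ : ℂ → Matrix (Fin n) (Fin n) ℂ, HolOn φ (Metric.ball 0 1) ∧
    (∀ z, ‖z‖ < 1 → SpecLT 1 (φ z)) ∧ φ 0 = A ∧ φ α = B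

theorem lempertFunction_eq (A B : Matrix (Fin n) (Fin n) ℂ) :
    lempertFunction (spectralBall n) A B = sInf {t : ℝ | ∃ α, Reach A B α ∧ t = ‖α‖} := by
  unfold lempertFunction
  congr 1
  ext t
  constructor
  · rintro ⟨α, φ, hα, hd, hm, h0, h1, rfl⟩
    refine ⟨α, ⟨by simpa [unitDiscSet] using hα, φ, differentiableOn_matrix_iff.1 hd, fun z hz => ?_,
      h0, h1⟩, rfl⟩
    exact mem_spectralBall_iff.1 (hm (by simpa [unitDiscSet] using hz))
  · rintro ⟨α, ⟨hα, φ, hd, hm, h0, h1⟩, rfl⟩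
    exact ⟨α, φ, by simpa [unitDiscSet] using hα, differentiableOn_matrix_iff.2 hd,
      fun z hz => mem_spectralBall_iff.2 (hm z (by simpa [unitDiscSet] using hz)), h0, h1, rfl⟩

theorem lempert_nonneg (A B : Matrix (Fin n) (Fin n) ℂ) :
    0 ≤ lempertFunction (spectralBall n) A B := by
  rw [lempertFunction_eq]
  refine Real.sInf_nonneg ?_
  rintro _ ⟨α, -, rfl⟩
  exact norm_nonneg α

theorem Reach.lempert_le {A B : Matrix (Fin n) (Fin n) ℂ} {α : ℂ} (h : Reach A B α) :
    lempertFunction (spectralBall n) A B ≤ ‖α‖ := by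
  rw [lempertFunction_eq]
  refine csInf_le ⟨0, ?_⟩ ⟨α, h, rfl⟩
  rintro _ ⟨α, -, rfl⟩
  exact norm_nonneg α

theorem exists_reach_of_lempert_lt {A B : Matrix (Fin n) (Fin n) ℂ} {c : ℝ}
    (hne : ∃ α, Reach A B α) (h : lempertFunction (spectralBall n) A B < c) :
    ∃ α, Reach A B α ∧ ‖α‖ < c := by
  rw [lempertFunction_eq] at h
  obtain ⟨α, hα⟩ := hne
  obtain ⟨_, ⟨β, hβ, rfl⟩, hlt⟩ := exists_lt_of_csInf_lt
    (s := {t : ℝ | ∃ α, Reach A B α ∧ t = ‖α‖}) ⟨‖α‖, α, hα, rfl⟩ h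
  exact ⟨β, hβ, hlt⟩

theorem le_lempert {A B : Matrix (Fin n) (Fin n) ℂ} {c : ℝ}
    (hne : ∃ α, Reach A B α) (h : ∀ α, Reach A B α → c ≤ ‖α‖) :
    c ≤ lempertFunction (spectralBall n) A B := by
  by_contra! hlt
  obtain ⟨α, hα, hα'⟩ := exists_reach_of_lempert_lt hne hlt
  exact absurd (h α hα) (not_le.2 hα')

theorem Reach.enlarge {A B : Matrix (Fin n) (Fin n) ℂ} {α β : ℂ} (h : Reach A B α)
    (hαβ : ‖α‖ ≤ ‖β‖) (hβ : ‖β‖ < 1) : Reach A B β := by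
  obtain ⟨hα, φ, h1, h2, h3, h4⟩ := h
  rcases eq_or_ne β 0 with rfl | hβ0
  · have : α = 0 := by simpa using hαβ
    subst this
    exact ⟨hα, φ, h1, h2, h3, h4⟩
  have hle : ‖α / β‖ ≤ 1 := by
    rw [norm_div]; exact div_le_one_of_le₀ hαβ (norm_nonneg _)
  have hmap : ∀ z : ℂ, ‖z‖ < 1 → ‖α / β * z‖ < 1 := fun z hz => by
    rw [norm_mul]; nlinarith [norm_nonneg z, norm_nonneg (α / β)]
  refine ⟨hβ, fun z => φ (α / β * z), h1.comp (by fun_prop) fun z hz => ?_, fun z hz => h2 _ (hmap z hz),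
    by simp [h3], by simp [hβ0, h4]⟩
  simpa using hmap z (by simpa using hz)

/-- The map `-discAut α` is the disc automorphism exchanging 0 and `α`. -/
theorem Reach.symm {A B : Matrix (Fin n) (Fin n) ℂ} {α : ℂ} (h : Reach A B α) : Reach B A α := by
  obtain ⟨hα, φ, h1, h2, h3, h4⟩ := h
  have hmap : ∀ z : ℂ, ‖z‖ < 1 → ‖-discAut α z‖ < 1 := fun z hz => by
    rw [norm_neg]; exact norm_discAut_lt_one hα hz
  refine ⟨hα, fun z => φ (-discAut α z), h1.comp (differentiableOn_discAut hα).neg fun z hz => ?_,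
    fun z hz => h2 _ (hmap z hz), by simp [discAut, h4], by simp [discAut, h3]⟩
  simpa using hmap z (by simpa using hz)

theorem lempert_comm (A B : Matrix (Fin n) (Fin n) ℂ) :
    lempertFunction (spectralBall n) A B = lempertFunction (spectralBall n) B A := by
  rw [lempertFunction_eq, lempertFunction_eq]
  congr 1
  ext t
  exact exists_congr fun α => and_congr_left fun _ => ⟨Reach.symm, Reach.symm⟩

theorem Reach.matAut {A B : Matrix (Fin n) (Fin n) ℂ} {α a : ℂ} (ha : ‖a‖ < 1) (h : Reach A B α) :
    Reach (matAut a A) (matAut a B) α := by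
  obtain ⟨hα, φ, h1, h2, h3, h4⟩ := h
  exact ⟨hα, fun z => _root_.matAut a (φ z), h1.matAut ha fun z hz => h2 z (by simpa using hz),
    fun z hz => (h2 z hz).matAut ha, by simp only [h3], by simp only [h4]⟩

theorem lempert_matAut {A B : Matrix (Fin n) (Fin n) ℂ} {a : ℂ} (ha : ‖a‖ < 1) (hA : SpecLT 1 A)
    (hB : SpecLT 1 B) : lempertFunction (spectralBall n) (matAut a A) (matAut a B) =
      lempertFunction (spectralBall n) A B := by
  rw [lempertFunction_eq, lempertFunction_eq]
  congr 1
  ext t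
  refine exists_congr fun α => and_congr_left fun _ => ⟨fun h => ?_, fun h => h.matAut ha⟩
  have := h.matAut (a := -a) (by simpa using ha)
  rwa [matAut_neg_matAut ha hA, matAut_neg_matAut ha hB] at this

theorem continuousOn_lempert_matAut {A : Matrix (Fin n) (Fin n) ℂ} {a : ℂ} (ha : ‖a‖ < 1)
    (hA : SpecLT 1 A)
    (h : ContinuousOn (fun B => lempertFunction (spectralBall n) A B) (spectralBall n)) :
    ContinuousOn (fun B => lempertFunction (spectralBall n) (matAut a A) B) (spectralBall n) := by
  have ha' : ‖-a‖ < 1 := by simpa using ha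
  have hset : spectralBall n = {B : Matrix (Fin n) (Fin n) ℂ | SpecLT 1 B} :=
    Set.ext fun B => mem_spectralBall_iff
  have hc : ContinuousOn (fun B => lempertFunction (spectralBall n) A (matAut (-a) B))
      (spectralBall n) := by
    refine h.comp (hset ▸ continuousOn_matAut ha') fun B hB => ?_
    exact mem_spectralBall_iff.2 ((mem_spectralBall_iff.1 hB).matAut ha')
  refine hc.congr fun B hB => ?_
  have hB' := mem_spectralBall_iff.1 hB
  change lempertFunction (spectralBall n) (matAut a A) B = _
  conv_lhs => rw [← matAut_neg_matAut ha' hB', neg_neg]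
  exact lempert_matAut ha hA (hB'.matAut ha')

/-- An invertible matrix is a product of transvections and an invertible diagonal matrix. Each
factor is joined to 1 explicitly, by scaling the off-diagonal entry or by exponentiating logarithms.
-/
theorem exists_holOn_interpolating (S : Matrix (Fin n) (Fin n) ℂ) (hS : S.det ≠ 0) {α : ℂ}
    (hα : α ≠ 0) : ∃ P : ℂ → Matrix (Fin n) (Fin n) ℂ, HolOn P Set.univ ∧ (∀ z, (P z).det ≠ 0) ∧
      P 0 = 1 ∧ P α = S := by
  refine diagonal_transvection_induction_of_det_ne_zero (P := fun S : Matrix (Fin n) (Fin n) ℂ =>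
    ∃ P : ℂ → Matrix (Fin n) (Fin n) ℂ, HolOn P Set.univ ∧ (∀ z, (P z).det ≠ 0) ∧
      P 0 = 1 ∧ P α = S) S hS ?_ ?_ ?_
  · intro D hD
    rw [det_diagonal, Finset.prod_ne_zero_iff] at hD
    refine ⟨fun z => diagonal fun i => Complex.exp (z / α * Complex.log (D i)), fun i j => ?_,
      fun z => ?_, by simp, ?_⟩
    · rcases eq_or_ne i j with rfl | hij
      · simp only [diagonal_apply_eq]; fun_prop
      · simp only [diagonal_apply_ne _ hij]; fun_prop
    · rw [det_diagonal, Finset.prod_ne_zero_iff]; exact fun i _ => Complex.exp_ne_zero _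
    · simp only [div_self hα, one_mul]
      congr 1
      funext i
      exact Complex.exp_log (hD i (Finset.mem_univ i))
  · intro t
    refine ⟨fun z => transvection t.i t.j (z / α * t.c), fun i j => ?_, fun z => ?_, by simp, ?_⟩
    · simp only [transvection, Matrix.add_apply, single_apply]
      split_ifs <;> fun_prop
    · rw [det_transvection_of_ne _ _ t.hij]; exact one_ne_zero
    · simp [div_self hα, TransvectionStruct.toMatrix]
  · rintro A B - - ⟨P, h1, h2, h3, h4⟩ ⟨Q, k1, k2, k3, k4⟩
    exact ⟨fun z => P z * Q z, h1.mul k1, fun z => by rw [det_mul]; exact mul_ne_zero (h2 z) (k2 z),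
      by simp [h3, k3], by simp [h4, k4]⟩

theorem SpecLT.conj {A S : Matrix (Fin n) (Fin n) ℂ} {t : ℝ} (hA : SpecLT t A) (hS : S.det ≠ 0) :
    SpecLT t (S * A * S⁻¹) := by
  refine hA.of_charpoly_eq ?_
  have hu : IsUnit S := (isUnit_iff_isUnit_det S).2 (isUnit_iff_ne_zero.2 hS)
  obtain ⟨U, rfl⟩ := hu
  exact (charpoly_units_conj U A).symm

/-- Conjugating pointwise by the interpolating family keeps the spectrum and the starting point and
moves only the endpoint. At `α = 0` the two conditions on the family would clash. -/
theorem Reach.conj_right {A B S : Matrix (Fin n) (Fin n) ℂ} {α : ℂ} (h : Reach A B α) (hα : α ≠ 0)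
    (hS : S.det ≠ 0) : Reach A (S * B * S⁻¹) α := by
  obtain ⟨hα1, φ, h1, h2, h3, h4⟩ := h
  obtain ⟨P, k1, k2, k3, k4⟩ := exists_holOn_interpolating S hS hα
  refine ⟨hα1, fun z => P z * φ z * (P z)⁻¹, ?_, fun z hz => (h2 z hz).conj (k2 z),
    by simp [k3, h3], by simp [k4, h4]⟩
  have k1' := k1.mono (Set.subset_univ (Metric.ball 0 1))
  exact (k1'.mul h1).mul (k1'.inv fun z _ => k2 z)

/-- The correction `(1 - z / α) • (A - F 0)` changes the start to `A` and vanishes at `α`;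
compactness of the closed disc keeps the spectrum inside for `A` close to `F 0`. -/
theorem eventually_reach {F : ℂ → Matrix (Fin n) (Fin n) ℂ} (hF : HolOn F Set.univ)
    (hspec : ∀ z, ‖z‖ ≤ 1 → SpecLT 1 (F z)) {α : ℂ} (hα : ‖α‖ < 1) (hα0 : α ≠ 0) :
    ∀ᶠ A in 𝓝 (F 0), Reach A (F α) α := by
  have hc : Continuous F := continuousOn_univ.1 hF.continuousOn
  have h : ∀ᶠ A in 𝓝 (F 0), ∀ z ∈ Metric.closedBall (0 : ℂ) 1,
      SpecLT 1 (F z + (1 - z / α) • (A - F 0)) := by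
    refine (isCompact_closedBall (0 : ℂ) 1).eventually_forall_of_forall_eventually fun z hz => ?_
    have hg : Continuous fun p : Matrix (Fin n) (Fin n) ℂ × ℂ =>
        F p.2 + (1 - p.2 / α) • (p.1 - F 0) := by fun_prop
    refine hg.continuousAt.eventually ((isOpen_specLT 1).mem_nhds ?_)
    simpa using hspec z (by simpa using hz)
  filter_upwards [h] with A hA
  refine ⟨hα, fun z => F z + (1 - z / α) • (A - F 0), ?_, fun z hz => hA z (by simpa using hz.le),
    by simp, by simp [div_self hα0]⟩
  exact (hF.mono (Set.subset_univ _)).add (HolOn.smul (by fun_prop) (holOn_const _ _))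

/-- The spectral condition on the closed disc persists on a slightly larger one; rescaling that one
to unit radius shortens the time. -/
theorem exists_reach_lt {F : ℂ → Matrix (Fin n) (Fin n) ℂ} (hF : HolOn F Set.univ)
    (hspec : ∀ z, ‖z‖ ≤ 1 → SpecLT 1 (F z)) {α : ℂ} (hα : ‖α‖ < 1) (hα0 : α ≠ 0) :
    ∃ β, ‖β‖ < ‖α‖ ∧ β ≠ 0 ∧ Reach (F 0) (F α) β := by
  have hc : Continuous F := continuousOn_univ.1 hF.continuousOn
  have ho : IsOpen (F ⁻¹' {A | SpecLT 1 A}) := (isOpen_specLT 1).preimage hc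
  obtain ⟨δ, hδ, hsub⟩ := (isCompact_closedBall (0 : ℂ) 1).exists_thickening_subset_open ho
    fun z hz => hspec z (by simpa using hz)
  rw [thickening_closedBall hδ zero_le_one] at hsub
  have hpos : (0 : ℝ) < 1 + δ := by linarith
  have hpos' : ((1 + δ : ℝ) : ℂ) ≠ 0 := by exact_mod_cast hpos.ne'
  have hnorm : ‖((1 + δ : ℝ) : ℂ)‖ = 1 + δ := by
    rw [Complex.norm_real, Real.norm_eq_abs, abs_of_pos hpos]
  have hlt : ‖α / (1 + δ : ℝ)‖ < ‖α‖ := by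
    rw [norm_div, hnorm]
    exact div_lt_self (norm_pos_iff.2 hα0) (by linarith)
  refine ⟨α / (1 + δ : ℝ), hlt, div_ne_zero hα0 hpos', hlt.trans hα, fun z => F ((1 + δ : ℝ) * z),
    (hF.comp (V := Set.univ) (by fun_prop) (Set.mapsTo_univ _ _)).mono (Set.subset_univ _), fun z hz => ?_,
    by simp, by simp only [mul_div_cancel₀ _ hpos']⟩
  refine hsub ?_
  rw [mem_ball_zero_iff, norm_mul, hnorm]
  nlinarith

end Reach

/-! ### Scalar centre: the Lempert function from 0 is the spectral radius -/

section ScalarCentre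
variable {n : ℕ}

theorem exists_smul_eq_of_holOn {φ : ℂ → Matrix (Fin n) (Fin n) ℂ} {R : ℝ} (hR : 0 < R)
    (hφ : HolOn φ (Metric.ball 0 R)) (h0 : φ 0 = 0) :
    ∃ G : ℂ → Matrix (Fin n) (Fin n) ℂ, HolOn G (Metric.ball 0 R) ∧ ∀ z, φ z = z • G z := by
  refine ⟨fun z => Matrix.of fun i j => dslope (fun w => φ w i j) 0 z, fun i j => ?_, fun z => ?_⟩
  · exact (Complex.differentiableOn_dslope (Metric.ball_mem_nhds 0 hR)).2 (hφ i j)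
  · ext i j
    have := sub_smul_dslope (fun w => φ w i j) 0 z
    simp only [h0, sub_zero, Matrix.zero_apply] at this
    exact this.symm

/-- Schwarz lemma for the spectral radius: divide the disc by `z` and apply the maximum principle to
the quotient on circles of radius `s` tending to 1. -/
theorem Reach.specLE_of_left_zero {B : Matrix (Fin n) (Fin n) ℂ} {α : ℂ} (h : Reach 0 B α) :
    SpecLE ‖α‖ B := by
  obtain ⟨hα, φ, h1, h2, h3, rfl⟩ := h
  obtain ⟨G, hG, hφG⟩ := exists_smul_eq_of_holOn one_pos h1 h3
  have key : ∀ s : ℝ, ‖α‖ < s → s < 1 → SpecLE (‖α‖ * s⁻¹) (φ α) := by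
    intro s hs hs1
    have hs0 : 0 < s := (norm_nonneg α).trans_lt hs
    have hGα : SpecLE s⁻¹ (G α) := by
      refine specLE_of_circle hG hs0 hs1 (fun z hz => ?_) hs.le
      have hz0 : z ≠ 0 := by rintro rfl; simp at hz; linarith
      have : G z = z⁻¹ • φ z := by rw [hφG, smul_smul, inv_mul_cancel₀ hz0, one_smul]
      rw [this]
      exact (h2 z (by rw [hz]; exact hs1)).le.smul (by positivity) (by rw [norm_inv, hz, mul_one])
    rw [hφG]
    exact hGα.smul (by positivity) le_rfl
  intro x hx
  by_contra! hlt
  have hx1 : ‖x‖ < 1 := h2 α hα x hx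
  have hx0 : 0 < ‖x‖ := (norm_nonneg α).trans_lt hlt
  rcases eq_or_ne α 0 with rfl | hα0
  · have := key ‖x‖ (by simpa using hx0) hx1 x hx
    simp at this; simp [this] at hx0
  · have hαp := norm_pos_iff.2 hα0
    -- With this choice `‖α‖ / s < ‖x‖`, which contradicts `key`.
    obtain ⟨s, hs, hs1⟩ := exists_between (show ‖α‖ / ‖x‖ < 1 by rwa [div_lt_one hx0])
    have hαs : ‖α‖ < s := lt_of_le_of_lt ((le_div_iff₀ hx0).2 (by nlinarith)) hs
    have h4 := key s hαs hs1 x hx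
    have hs0 : 0 < s := hαp.trans hαs
    rw [← div_eq_mul_inv, le_div_iff₀ hs0] at h4
    rw [div_lt_iff₀ hx0] at hs
    linarith

theorem exists_specLE_lt {ι : Type*} [Fintype ι] [DecidableEq ι] {B : Matrix ι ι ℂ} {t : ℝ}
    (ht : 0 < t) (hB : SpecLT t B) : ∃ s, 0 ≤ s ∧ s < t ∧ SpecLE s B := by
  obtain ⟨s, h0, h1, h2⟩ := exists_specLE_of_isCompact (F := fun _ : Unit => B) isCompact_univ
    continuousOn_const ht fun _ _ => hB
  exact ⟨s, h0, h1, h2 () trivial⟩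

theorem specLT_smul_of_norm_le {ι : Type*} [Fintype ι] [DecidableEq ι] {B : Matrix ι ι ℂ} {α z : ℂ}
    (hα0 : α ≠ 0) (hB : SpecLT ‖α‖ B) (hz : ‖z‖ ≤ 1) : SpecLT 1 ((z / α) • B) := by
  refine hB.smul one_pos ?_
  rwa [norm_div, div_mul_cancel₀ _ (norm_ne_zero_iff.2 hα0)]

theorem reach_zero_left {B : Matrix (Fin n) (Fin n) ℂ} {α : ℂ} (hα0 : α ≠ 0) (hα : ‖α‖ < 1)
    (hB : SpecLT ‖α‖ B) : Reach 0 B α :=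
  ⟨hα, fun z => (z / α) • B, HolOn.smul (by fun_prop) (holOn_const _ _),
    fun z hz => specLT_smul_of_norm_le hα0 hB hz.le, by simp, by simp [div_self hα0]⟩

theorem exists_reach_zero_lt {B : Matrix (Fin n) (Fin n) ℂ} {t : ℝ} (ht : 0 < t) (ht1 : t ≤ 1)
    (hB : SpecLT t B) : ∃ α, Reach 0 B α ∧ ‖α‖ < t := by
  obtain ⟨s, hs0, hst, hs⟩ := exists_specLE_lt ht hB
  obtain ⟨r, hsr, hrt⟩ := exists_between hst
  have hr0 : 0 < r := hs0.trans_lt hsr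
  have hr : ‖(r : ℂ)‖ = r := by rw [Complex.norm_real, Real.norm_eq_abs, abs_of_pos hr0]
  refine ⟨r, reach_zero_left (by exact_mod_cast hr0.ne') (by rw [hr]; linarith) ?_, by rwa [hr]⟩
  rw [hr]; exact hs.lt hsr

theorem lempert_zero_lt {B : Matrix (Fin n) (Fin n) ℂ} {t : ℝ} (ht : 0 < t) (ht1 : t ≤ 1)
    (hB : SpecLT t B) : lempertFunction (spectralBall n) 0 B < t := by
  obtain ⟨α, h, hlt⟩ := exists_reach_zero_lt ht ht1 hB
  exact h.lempert_le.trans_lt hlt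

theorem specLE_of_lempert_zero_le {B : Matrix (Fin n) (Fin n) ℂ} {t : ℝ} (hB : SpecLT 1 B)
    (h : lempertFunction (spectralBall n) 0 B ≤ t) : SpecLE t B := by
  intro x hx
  refine le_of_forall_gt fun c hc => ?_
  obtain ⟨α, -, -⟩ := exists_reach_zero_lt one_pos le_rfl hB
  obtain ⟨α, hα, hlt⟩ := exists_reach_of_lempert_lt
    ((exists_reach_zero_lt one_pos le_rfl hB).imp fun _ h => h.1) (h.trans_lt hc)
  exact (hα.specLE_of_left_zero x hx).trans_lt hlt

/-- Strict upper bounds on the spectral radius are open and weak ones closed; these are the two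
halves of continuity. -/
theorem continuousOn_lempert_zero :
    ContinuousOn (fun B => lempertFunction (spectralBall n) 0 B) (spectralBall n) := by
  intro B₀ hB₀
  have hB₀' := mem_spectralBall_iff.1 hB₀
  refine tendsto_order.2 ⟨fun a ha => ?_, fun b hb => ?_⟩
  · rcases lt_or_ge a 0 with h0 | h0
    · exact Eventually.of_forall fun B => h0.trans_le (lempert_nonneg _ _)
    have hnot : ¬ SpecLE a B₀ := by
      intro hle
      have h1 := lempert_zero_lt one_pos le_rfl hB₀'
      obtain ⟨t, hat, ht⟩ := exists_between ha
      have := lempert_zero_lt (h0.trans_lt hat) (ht.trans h1).le (hle.lt hat)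
      linarith
    have hev : ∀ᶠ B in 𝓝 B₀, ¬ SpecLE a B := (isClosed_specLE a).isOpen_compl.mem_nhds hnot
    filter_upwards [hev.filter_mono nhdsWithin_le_nhds, self_mem_nhdsWithin] with B h1 h2
    by_contra! hle
    exact h1 (specLE_of_lempert_zero_le (mem_spectralBall_iff.1 h2) hle)
  · have hb0 : 0 < b := (lempert_nonneg _ _).trans_lt hb
    have h1 : SpecLT (min b 1) B₀ := fun x hx =>
      lt_min ((specLE_of_lempert_zero_le hB₀' le_rfl x hx).trans_lt hb) (hB₀' x hx)
    have hev : ∀ᶠ B in 𝓝 B₀, SpecLT (min b 1) B := (isOpen_specLT _).mem_nhds h1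
    filter_upwards [hev.filter_mono nhdsWithin_le_nhds] with B h2
    exact (lempert_zero_lt (lt_min hb0 one_pos) (min_le_right _ _) h2).trans_le (min_le_left _ _)

theorem continuousOn_lempert_of_isScalarMatrix {A : Matrix (Fin n) (Fin n) ℂ}
    (hA : A ∈ spectralBall n) (hs : IsScalarMatrix A) :
    ContinuousOn (fun B => lempertFunction (spectralBall n) A B) (spectralBall n) := by
  rcases isEmpty_or_nonempty (Fin n) with hn | ⟨⟨i⟩⟩
  · rw [Subsingleton.elim A 0]; exact continuousOn_lempert_zero
  obtain ⟨c, rfl⟩ := hs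
  have hc : ‖c‖ < 1 := by
    refine mem_spectralBall_iff.1 hA c (isRoot_charpoly_iff_exists_mulVec.2 ⟨1, ?_, by
      rw [smul_mulVec, one_mulVec]⟩)
    exact fun h => one_ne_zero (congrFun h i)
  have hc' : ‖-c‖ < 1 := by simpa using hc
  have h0 : SpecLT 1 (0 : Matrix (Fin n) (Fin n) ℂ) := specLT_zero one_pos
  have := continuousOn_lempert_matAut hc' h0 continuousOn_lempert_zero
  have h2 : matAut (-c) (0 : Matrix (Fin n) (Fin n) ℂ) = c • 1 := by
    have := matAut_smul_one (ι := Fin n) hc' (c := 0) (by simp)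
    rw [zero_smul] at this
    rw [this]; simp [discAut]
  rwa [h2] at this

end ScalarCentre

/-! ### Similarity and limits of similar matrices -/

section Similarity

/-- Similarity of matrices with possibly different index types. -/
def Sim {ι κ : Type*} [Fintype ι] [Fintype κ] [DecidableEq ι] [DecidableEq κ]
    (A : Matrix ι ι ℂ) (B : Matrix κ κ ℂ) : Prop :=
  ∃ (P : Matrix ι κ ℂ) (Q : Matrix κ ι ℂ), P * Q = 1 ∧ Q * P = 1 ∧ A = P * B * Q

/-- `B` is a limit of matrices similar to `A`. -/
def SimLim {ι κ : Type*} [Fintype ι] [Fintype κ] [DecidableEq ι] [DecidableEq κ]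
    (A : Matrix ι ι ℂ) (B : Matrix κ κ ℂ) : Prop := B ∈ closure {B' : Matrix κ κ ℂ | Sim A B'}

variable {ι κ μ : Type*} [Fintype ι] [Fintype κ] [Fintype μ] [DecidableEq ι] [DecidableEq κ]
  [DecidableEq μ]

theorem Sim.refl (A : Matrix ι ι ℂ) : Sim A A := ⟨1, 1, by simp, by simp, by simp⟩

theorem Sim.symm {A : Matrix ι ι ℂ} {B : Matrix κ κ ℂ} (h : Sim A B) : Sim B A := by
  obtain ⟨P, Q, h1, h2, rfl⟩ := h
  refine ⟨Q, P, h2, h1, ?_⟩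
  calc B = (Q * P) * B * (Q * P) := by simp [h2]
    _ = _ := by simp only [Matrix.mul_assoc]

theorem Sim.trans {A : Matrix ι ι ℂ} {B : Matrix κ κ ℂ} {D : Matrix μ μ ℂ} (h : Sim A B)
    (h' : Sim B D) : Sim A D := by
  obtain ⟨P, Q, h1, h2, rfl⟩ := h
  obtain ⟨P', Q', h1', h2', rfl⟩ := h'
  refine ⟨P * P', Q' * Q, ?_, ?_, by simp only [Matrix.mul_assoc]⟩
  · calc P * P' * (Q' * Q) = P * (P' * Q') * Q := by simp only [Matrix.mul_assoc]
      _ = 1 := by rw [h1', Matrix.mul_one, h1]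
  · calc Q' * Q * (P * P') = Q' * (Q * P) * P' := by simp only [Matrix.mul_assoc]
      _ = 1 := by rw [h2, Matrix.mul_one, h2']

theorem Sim.card_eq {A : Matrix ι ι ℂ} {B : Matrix κ κ ℂ} (h : Sim A B) :
    Fintype.card ι = Fintype.card κ := by
  obtain ⟨P, Q, h1, h2, -⟩ := h
  have h3 := congrArg trace h1
  have h4 := congrArg trace h2
  rw [trace_one] at h3 h4
  rw [trace_mul_comm, h4] at h3
  exact_mod_cast h3.symm

theorem Sim.charpoly_eq {A : Matrix ι ι ℂ} {B : Matrix κ κ ℂ} (h : Sim A B) :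
    A.charpoly = B.charpoly := by
  have hc := h.card_eq
  obtain ⟨P, Q, h1, h2, rfl⟩ := h
  have := charpoly_mul_comm' (P * B) Q
  rw [← Matrix.mul_assoc, h2, Matrix.one_mul, hc] at this
  exact mul_left_cancel₀ (pow_ne_zero _ X_ne_zero) this

theorem Sim.submatrix (A : Matrix ι ι ℂ) (e : κ ≃ ι) : Sim A (A.submatrix e e) := by
  refine ⟨(1 : Matrix ι ι ℂ).submatrix id e, (1 : Matrix ι ι ℂ).submatrix e id, ?_, ?_, ?_⟩
  · rw [submatrix_mul_equiv, Matrix.one_mul, submatrix_id_id]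
  · rw [← submatrix_mul _ _ _ _ _ Function.bijective_id, Matrix.one_mul, submatrix_one_equiv]
  · rw [submatrix_mul_equiv, submatrix_mul_equiv, Matrix.one_mul, Matrix.mul_one, submatrix_id_id]

theorem Sim.smul {A : Matrix ι ι ℂ} {B : Matrix κ κ ℂ} (h : Sim A B) (c : ℂ) :
    Sim (c • A) (c • B) := by
  obtain ⟨P, Q, h1, h2, rfl⟩ := h
  exact ⟨P, Q, h1, h2, by rw [Matrix.mul_smul, Matrix.smul_mul]⟩

theorem Sim.simLim {A : Matrix ι ι ℂ} {B : Matrix κ κ ℂ} (h : Sim A B) : SimLim A B :=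
  subset_closure h

theorem Sim.trans_simLim {A : Matrix ι ι ℂ} {B : Matrix κ κ ℂ} {D : Matrix μ μ ℂ} (h : Sim A B)
    (h' : SimLim B D) : SimLim A D := closure_mono (fun _ hD => h.trans hD) h'

theorem SimLim.trans_sim {A : Matrix ι ι ℂ} {B : Matrix κ κ ℂ} {D : Matrix μ μ ℂ} (h : SimLim A B)
    (h' : Sim B D) : SimLim A D := by
  obtain ⟨P, Q, h1, h2, h3⟩ := h'.symm
  subst h3
  refine map_mem_closure (f := fun B : Matrix κ κ ℂ => P * B * Q) (by fun_prop) h fun B' hB' => ?_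
  exact Sim.trans hB' (Sim.symm ⟨P, Q, h1, h2, rfl⟩)

/-- Conjugation by a block scalar scales the off-diagonal block by δ, which then tends to 0. -/
theorem SimLim.fromBlocks {A₁ : Matrix ι ι ℂ} {X : Matrix ι κ ℂ} {A₂ : Matrix κ κ ℂ}
    {D : Matrix μ μ ℂ} (h : SimLim A₂ D) :
    SimLim (fromBlocks A₁ X 0 A₂) (fromBlocks A₁ 0 0 D) := by
  have hsub : Set.MapsTo (fun D' : Matrix μ μ ℂ => Matrix.fromBlocks A₁ 0 0 D') {D' | Sim A₂ D'}
      (closure {B' | Sim (Matrix.fromBlocks A₁ X 0 A₂) B'}) := by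
    rintro D' ⟨P, Q, h1, h2, rfl⟩
    have hlim : Tendsto (fun δ : ℂ => Matrix.fromBlocks A₁ (δ • (X * P)) 0 D') (𝓝[≠] 0)
        (𝓝 (Matrix.fromBlocks A₁ 0 0 D')) := by
      have hc : Continuous fun δ : ℂ => Matrix.fromBlocks A₁ (δ • (X * P)) 0 D' :=
        Continuous.matrix_fromBlocks continuous_const (by fun_prop) continuous_const
          continuous_const
      have := hc.tendsto 0
      rw [zero_smul] at this
      exact this.mono_left nhdsWithin_le_nhds
    refine mem_closure_of_tendsto hlim (eventually_mem_nhdsWithin.mono fun δ hδ => ?_)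
    have hδ : δ ≠ 0 := hδ
    refine ⟨Matrix.fromBlocks (δ⁻¹ • 1) 0 0 P, Matrix.fromBlocks (δ • 1) 0 0 Q, ?_, ?_, ?_⟩
    · simp [fromBlocks_multiply, smul_smul, hδ, h1]
    · simp [fromBlocks_multiply, smul_smul, hδ, h2]
    · simp [fromBlocks_multiply, smul_smul, hδ, Matrix.mul_assoc, h1]
  have := map_mem_closure (f := fun D' : Matrix μ μ ℂ => Matrix.fromBlocks A₁ 0 0 D')
    (Continuous.matrix_fromBlocks continuous_const continuous_const continuous_const
      continuous_id) h hsub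
  rwa [closure_closure] at this

/-- The family `v` spans an invariant subspace on which `A` acts by `P`; extending it to a basis
gives block triangular form. All later normal forms come from suitable choices of `v`. -/
theorem exists_sim_fromBlocks {ι κ : Type} [Fintype ι] [Fintype κ] [DecidableEq ι] [DecidableEq κ]
    {A : Matrix ι ι ℂ} {v : κ → ι → ℂ} (hv : LinearIndependent ℂ v) {P : Matrix κ κ ℂ}
    (hP : ∀ k, A *ᵥ v k = ∑ l, P l k • v l) :
    ∃ (J : Type) (_ : Fintype J) (_ : DecidableEq J) (X : Matrix κ J ℂ) (A₂ : Matrix J J ℂ),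
      Sim A (fromBlocks P X 0 A₂) := by
  classical
  let b := Module.Basis.sumExtend hv
  have : Fintype (κ ⊕ Module.Basis.sumExtendIndex hv) :=
    FiniteDimensional.fintypeBasisIndex b
  have : Fintype (Module.Basis.sumExtendIndex hv) :=
    Fintype.ofInjective (Sum.inr : _ → κ ⊕ Module.Basis.sumExtendIndex hv) Sum.inr_injective
  have hb : ∀ k, b (Sum.inl k) = v k := fun k => by
    simp only [b, Module.Basis.sumExtend, Module.Basis.coe_reindex, Function.comp_apply,
      Module.Basis.coe_extend]
    rfl
  let E := Pi.basisFun ℂ ι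
  have hAE : LinearMap.toMatrix E E (toLin' A) = A := by
    rw [← toLin_eq_toLin', LinearMap.toMatrix_toLin]
  have hM : Sim A (LinearMap.toMatrix b b (toLin' A)) := by
    refine ⟨E.toMatrix b, b.toMatrix E, E.toMatrix_mul_toMatrix_flip b,
      b.toMatrix_mul_toMatrix_flip E, ?_⟩
    rw [basis_toMatrix_mul_linearMap_toMatrix_mul_basis_toMatrix, hAE]
  set M := LinearMap.toMatrix b b (toLin' A) with hMdef
  have hcol : ∀ (i : κ ⊕ Module.Basis.sumExtendIndex hv) (k : κ),
      M i (Sum.inl k) = ∑ l, P l k * (if Sum.inl l = i then 1 else 0) := by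
    intro i k
    rw [hMdef, LinearMap.toMatrix_apply, hb, toLin'_apply, hP]
    simp only [map_sum, map_smul, ← hb, Module.Basis.repr_self, Finsupp.coe_finsetSum,
      Finset.sum_apply, Finsupp.coe_smul, Pi.smul_apply, smul_eq_mul, Finsupp.single_apply]
  refine ⟨Module.Basis.sumExtendIndex hv, inferInstance, inferInstance, M.toBlocks₁₂, M.toBlocks₂₂, ?_⟩
  have h11 : M.toBlocks₁₁ = P := by
    ext i k
    simp [toBlocks₁₁, hcol]
  have h21 : M.toBlocks₂₁ = 0 := by
    ext i k
    simp [toBlocks₂₁, hcol]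
  rw [← fromBlocks_toBlocks M, h11, h21] at hM
  convert hM

end Similarity

/-! ### Degenerations to diagonal and to rank-one matrices -/

section SimilarityLimits

theorem charpoly_of_unit (c : ℂ) : (c • (1 : Matrix Unit Unit ℂ)).charpoly = X - C c := by
  rw [smul_one_eq_diagonal, charpoly_diagonal]; simp

/-- Induction on the size: split off one eigenvector and let the off-diagonal block tend to 0. -/
theorem simLim_diagonal {N : ℕ} : ∀ {ι : Type} [Fintype ι] [DecidableEq ι], Fintype.card ι = N →
    ∀ {A : Matrix ι ι ℂ} {d : ι → ℂ}, A.charpoly = ∏ i, (X - C (d i)) →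
      SimLim A (diagonal d) := by
  induction N with
  | zero =>
    intro ι _ _ hc A d _
    have := Fintype.card_eq_zero_iff.1 hc
    rw [Subsingleton.elim (diagonal d) A]
    exact (Sim.refl A).simLim
  | succ N ih =>
    intro ι _ _ hc A d hd
    have : Nonempty ι := Fintype.card_pos_iff.1 (by omega)
    obtain ⟨i₀⟩ := this
    obtain ⟨v, hv, hAv⟩ := isRoot_charpoly_iff_exists_mulVec.1 (isRoot_of_charpoly_eq_prod hd i₀)
    have hli : LinearIndependent ℂ (fun _ : Unit => v) :=
      LinearIndependent.of_subsingleton () hv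
    obtain ⟨J, _, _, X', A₂, hsim⟩ := exists_sim_fromBlocks (A := A) hli
      (P := d i₀ • (1 : Matrix Unit Unit ℂ)) (fun k => by simp [hAv])
    have hcard := hsim.card_eq
    have hJ : Fintype.card J = Fintype.card {i // i ≠ i₀} := by
      rw [Fintype.card_subtype_compl, Fintype.card_subtype_eq]
      simp only [Fintype.card_sum, Fintype.card_unit] at hcard
      omega
    let e : J ≃ {i // i ≠ i₀} := Fintype.equivOfCardEq hJ
    have hch : A₂.charpoly = ∏ j, (X - C (d (e j))) := by
      have h1 := hsim.charpoly_eq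
      rw [charpoly_fromBlocks_zero₂₁, charpoly_of_unit, hd,
        ← Finset.mul_prod_erase _ _ (Finset.mem_univ i₀)] at h1
      rw [← mul_left_cancel₀ (X_sub_C_ne_zero (d i₀)) h1,
        Equiv.prod_comp e (fun i : {i // i ≠ i₀} => X - C (d i))]
      exact (Finset.prod_subtype _ (by simp) _)
    have h2 : SimLim A₂ (diagonal fun j => d (e j)) := ih (by
      simp only [Fintype.card_sum, Fintype.card_unit] at hcard; omega) hch
    have h3 := hsim.trans_simLim (h2.fromBlocks (A₁ := d i₀ • (1 : Matrix Unit Unit ℂ)) (X := X'))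
    let f₀ : Unit ⊕ J → ι := Sum.elim (fun _ => i₀) fun j => e j
    have hf₀ : Function.Bijective f₀ := by
      constructor
      · rintro (a | a) (b | b) h
        · rfl
        · exact absurd h.symm (e b).2
        · exact absurd h (e a).2
        · exact congrArg Sum.inr (e.injective (Subtype.ext h))
      · intro i
        by_cases hi : i = i₀
        · exact ⟨Sum.inl (), hi.symm⟩
        · exact ⟨Sum.inr (e.symm ⟨i, hi⟩), by simp [f₀]⟩
    let f := Equiv.ofBijective f₀ hf₀
    have h4 : (diagonal d).submatrix f f =
        fromBlocks (d i₀ • (1 : Matrix Unit Unit ℂ)) 0 0 (diagonal fun j => d (e j)) := by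
      rw [submatrix_diagonal_equiv, smul_one_eq_diagonal, fromBlocks_diagonal]
      congr 1
      funext x
      rcases x with a | a <;> rfl
    refine h3.trans_sim (Sim.symm ?_)
    rw [← h4]
    exact Sim.submatrix _ f

theorem simLim_zero {ι : Type} [Fintype ι] [DecidableEq ι] {A : Matrix ι ι ℂ}
    (hA : A.charpoly = X ^ Fintype.card ι) : SimLim A (0 : Matrix ι ι ℂ) := by
  have := simLim_diagonal (A := A) (d := fun _ => 0) rfl (by simp [hA])
  rwa [show (diagonal fun _ : ι => (0 : ℂ)) = 0 from diagonal_zero] at this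

theorem pow_card_eq_zero {ι : Type*} [Fintype ι] [DecidableEq ι] {A : Matrix ι ι ℂ}
    (hA : A.charpoly = X ^ Fintype.card ι) : A ^ Fintype.card ι = 0 := by
  have := aeval_self_charpoly A
  simpa [hA] using this

theorem exists_equiv_of_card_eq {ι J : Type} [Fintype ι] [DecidableEq ι] [Fintype J]
    (h : Fintype.card (Fin 2 ⊕ J) = Fintype.card ι) {i j : ι} (hij : i ≠ j) :
    ∃ e : Fin 2 ⊕ J ≃ ι, e (Sum.inl 0) = i ∧ e (Sum.inl 1) = j := by
  let e₀ : Fin 2 ⊕ J ≃ ι := Fintype.equivOfCardEq h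
  let e₁ := e₀.trans (Equiv.swap (e₀ (Sum.inl 0)) i)
  have h1 : e₁ (Sum.inl 0) = i := by simp [e₁]
  have h2 : e₁ (Sum.inl 1) ≠ i := by
    rw [← h1]; exact fun h => by simpa using e₁.injective h
  refine ⟨e₁.trans (Equiv.swap (e₁ (Sum.inl 1)) j), ?_, by simp⟩
  simp only [Equiv.trans_apply, h1]
  exact Equiv.swap_apply_of_ne_of_ne h2.symm hij

theorem exists_mulVec_mulVec_eq_zero {ι : Type*} [Fintype ι] [DecidableEq ι] {A : Matrix ι ι ℂ}
    {k : ℕ} (hk : A ^ k = 0) (hA : A ≠ 0) : ∃ v : ι → ℂ, A *ᵥ v ≠ 0 ∧ A *ᵥ (A *ᵥ v) = 0 := by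
  classical
  have hex : ∃ k, A ^ k = 0 := ⟨k, hk⟩
  set m := Nat.find hex
  have hm : A ^ m = 0 := Nat.find_spec hex
  have hm2 : 2 ≤ m := by
    by_contra! h
    interval_cases hmm : m
    · exact hA (by rw [← mul_one A, ← pow_zero A, hm, mul_zero])
    · exact hA (by simpa using hm)
  have hm1 : A ^ (m - 1) ≠ 0 := Nat.find_min hex (by omega)
  obtain ⟨u, hu⟩ : ∃ u, (A ^ (m - 1)) *ᵥ u ≠ 0 := by
    by_contra! h
    exact hm1 (ext_of_mulVec_single fun i => by rw [h, zero_mulVec])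
  refine ⟨(A ^ (m - 2)) *ᵥ u, ?_, ?_⟩
  · rw [mulVec_mulVec, ← pow_succ', show m - 2 + 1 = m - 1 by omega]; exact hu
  · rw [mulVec_mulVec, mulVec_mulVec, mul_assoc, ← pow_succ', ← pow_succ', show m - 2 + 1 + 1 = m by omega, hm,
      zero_mulVec]

/-- The smallest nonzero nilpotent class lies in the closure of every other. A vector `v` with A v ≠
0 and A² v = 0 gives a 2 × 2 Jordan block, and the complementary nilpotent block degenerates to 0.
-/
theorem simLim_single {ι : Type} [Fintype ι] [DecidableEq ι] {A : Matrix ι ι ℂ}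
    (hA : A.charpoly = X ^ Fintype.card ι) (hA0 : A ≠ 0) {i j : ι} (hij : i ≠ j) :
    SimLim A (single i j (1 : ℂ)) := by
  obtain ⟨v, hv1, hv2⟩ := exists_mulVec_mulVec_eq_zero (pow_card_eq_zero hA) hA0
  have hli : LinearIndependent ℂ ![A *ᵥ v, v] := by
    rw [LinearIndependent.pair_iff]
    intro s t hst
    have h1 := congrArg (A *ᵥ ·) hst
    simp only [mulVec_add, mulVec_smul, hv2, smul_zero, zero_add, mulVec_zero] at h1
    have ht : t = 0 := (smul_eq_zero.1 h1).resolve_right hv1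
    rw [ht, zero_smul, add_zero] at hst
    exact ⟨(smul_eq_zero.1 hst).resolve_right hv1, ht⟩
  obtain ⟨J, _, _, X', A₂, hsim⟩ := exists_sim_fromBlocks (A := A) hli (P := !![0, 1; 0, 0])
    (fun k => by fin_cases k <;> simp [Fin.sum_univ_two, hv2])
  have hcard := hsim.card_eq
  have hP : (!![0, 1; 0, 0] : Matrix (Fin 2) (Fin 2) ℂ).charpoly = X ^ 2 := by
    rw [charpoly_fin_two]; simp [trace_fin_two]
  have hch : A₂.charpoly = X ^ Fintype.card J := by
    have h1 := hsim.charpoly_eq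
    rw [charpoly_fromBlocks_zero₂₁, hP, hA, hcard, Fintype.card_sum, Fintype.card_fin, pow_add] at h1
    exact (mul_left_cancel₀ (pow_ne_zero _ X_ne_zero) h1).symm
  have h3 := hsim.trans_simLim
    ((simLim_zero hch).fromBlocks (A₁ := (!![0, 1; 0, 0] : Matrix (Fin 2) (Fin 2) ℂ)) (X := X'))
  obtain ⟨e, he0, he1⟩ := exists_equiv_of_card_eq hcard.symm hij
  refine h3.trans_sim (Sim.symm ?_)
  have h4 : (single i j (1 : ℂ)).submatrix e e =
      fromBlocks (!![0, 1; 0, 0] : Matrix (Fin 2) (Fin 2) ℂ) 0 0 0 := by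
    have hi : ∀ x, i = e x ↔ x = Sum.inl 0 := fun x => by rw [← he0, e.injective.eq_iff, eq_comm]
    have hj : ∀ x, j = e x ↔ x = Sum.inl 1 := fun x => by rw [← he1, e.injective.eq_iff, eq_comm]
    ext x y
    rw [submatrix_apply, single_apply]
    simp only [hi, hj]
    rcases x with x | x <;> rcases y with y | y
    · fin_cases x <;> fin_cases y <;> simp
    · simp
    · simp
    · simp
  rw [← h4]
  exact Sim.submatrix _ e

end SimilarityLimits

/-! ### Discs and degenerations -/

section ReachLimits
variable {n : ℕ}

theorem Sim.exists_conj {A B : Matrix (Fin n) (Fin n) ℂ} (h : Sim A B) :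
    ∃ S : Matrix (Fin n) (Fin n) ℂ, S.det ≠ 0 ∧ B = S * A * S⁻¹ := by
  obtain ⟨P, Q, h1, h2, h3⟩ := h.symm
  refine ⟨P, fun h0 => ?_, ?_⟩
  · have := congrArg Matrix.det h1
    rw [det_mul, h0, zero_mul, det_one] at this
    exact zero_ne_one this
  · rw [inv_eq_right_inv h1, h3]

theorem Reach.sim_right {A B B' : Matrix (Fin n) (Fin n) ℂ} {α : ℂ} (h : Reach A B α) (hα : α ≠ 0)
    (hs : Sim B B') : Reach A B' α := by
  obtain ⟨S, hS, rfl⟩ := hs.exists_conj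
  exact h.conj_right hα hS

theorem Reach.sim_left {A A' B : Matrix (Fin n) (Fin n) ℂ} {α : ℂ} (h : Reach A B α) (hα : α ≠ 0)
    (hs : Sim A A') : Reach A' B α := (h.symm.sim_right hα hs).symm

theorem SimLim.reach_left {A A₀ B : Matrix (Fin n) (Fin n) ℂ} {α : ℂ} (hα : α ≠ 0)
    (hs : SimLim A A₀) (h : ∀ᶠ A' in 𝓝 A₀, Reach A' B α) : Reach A B α := by
  obtain ⟨A', hA', hsim⟩ := ((mem_closure_iff_frequently.1 hs).and_eventually h).exists
  exact hsim.sim_left hα hA'.symm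

/-- The disc `z ↦ (z / α) • B` starts at 0. Its start can be moved to any matrix near 0, hence to
some conjugate of the nilpotent `A`. -/
theorem reach_of_nilpotent {A B : Matrix (Fin n) (Fin n) ℂ} (hA : A.charpoly = X ^ n) {α : ℂ}
    (hα0 : α ≠ 0) (hα : ‖α‖ < 1) (hB : SpecLT ‖α‖ B) : Reach A B α := by
  have h := eventually_reach (F := fun z => (z / α) • B)
    (HolOn.smul (by fun_prop) (holOn_const _ _))
    (fun z hz => specLT_smul_of_norm_le hα0 hB hz) hα hα0
  simp only [zero_div, zero_smul, div_self hα0, one_smul] at h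
  exact SimLim.reach_left hα0 (simLim_zero (by simpa using hA)) h

theorem exists_reach_of_nilpotent {A B : Matrix (Fin n) (Fin n) ℂ} (hA : A.charpoly = X ^ n)
    (hB : SpecLT 1 B) : ∃ α, Reach A B α := by
  obtain ⟨s, hs0, hs1, hs⟩ := exists_specLE_lt one_pos hB
  obtain ⟨r, hsr, hr1⟩ := exists_between hs1
  have hr0 : 0 < r := hs0.trans_lt hsr
  have hr : ‖(r : ℂ)‖ = r := by rw [Complex.norm_real, Real.norm_eq_abs, abs_of_pos hr0]
  exact ⟨r, reach_of_nilpotent hA (by exact_mod_cast hr0.ne') (by rwa [hr]) (by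
    rw [hr]; exact hs.lt hsr)⟩

/-- The obstruction behind every negative result: all conjugates of `B` are reached at the same time
`α`, so continuity carries the bound to their limit `D`. -/
theorem lempert_le_of_simLim {A B D : Matrix (Fin n) (Fin n) ℂ} {α : ℂ}
    (hcont : ContinuousOn (fun B => lempertFunction (spectralBall n) A B) (spectralBall n))
    (hD : SpecLT 1 D) (hα : α ≠ 0) (h : Reach A B α) (hs : SimLim B D) :
    lempertFunction (spectralBall n) A D ≤ ‖α‖ := by
  have hDm := mem_spectralBall_iff.2 hD
  have ho : spectralBall n ∈ 𝓝 D := by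
    have : spectralBall n = {B : Matrix (Fin n) (Fin n) ℂ | SpecLT 1 B} :=
      Set.ext fun B => mem_spectralBall_iff
    rw [this]
    exact (isOpen_specLT 1).mem_nhds hD
  have hc := (hcont D hDm).continuousAt ho
  by_contra! hlt
  obtain ⟨B', hB', hlt'⟩ := ((mem_closure_iff_frequently.1 hs).and_eventually
    (hc.eventually (lt_mem_nhds hlt))).exists
  exact absurd (h.sim_right hα hB').lempert_le (not_le.2 hlt')

end ReachLimits

/-! ### Discontinuity when there are two distinct eigenvalues -/

section DistinctEigenvalues

/-- The segment-type pencil `(z / l) A + (1 - z / l) N` has, for some nilpotent `N`, its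
eigenvalues in the open unit disc when `z` runs through the unit circle. -/
def NilpotentPencil {ι : Type*} [Fintype ι] [DecidableEq ι] (l : ℂ) (A : Matrix ι ι ℂ) : Prop :=
  ∃ N : Matrix ι ι ℂ, N.charpoly = X ^ Fintype.card ι ∧
    ∀ z : ℂ, ‖z‖ = 1 → SpecLT 1 ((z / l) • A + (1 - z / l) • N)

variable {ι κ : Type*} [Fintype ι] [Fintype κ] [DecidableEq ι] [DecidableEq κ]

theorem NilpotentPencil.of_sim {l : ℂ} {A : Matrix ι ι ℂ} {B : Matrix κ κ ℂ} (h : Sim A B)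
    (hB : NilpotentPencil l B) : NilpotentPencil l A := by
  have hc := h.card_eq
  obtain ⟨P, Q, h1, h2, rfl⟩ := h
  obtain ⟨N, hN, hs⟩ := hB
  have hsim : ∀ M : Matrix κ κ ℂ, Sim (P * M * Q) M := fun M => ⟨P, Q, h1, h2, rfl⟩
  refine ⟨P * N * Q, by rw [(hsim N).charpoly_eq, hN, hc], fun z hz => ?_⟩
  refine (hs z hz).of_charpoly_eq ?_
  rw [← (hsim _).charpoly_eq, Matrix.mul_add, Matrix.add_mul, Matrix.mul_smul, Matrix.mul_smul,
    Matrix.smul_mul, Matrix.smul_mul]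

theorem NilpotentPencil.fromBlocks {l : ℂ} {A₁ : Matrix ι ι ℂ} {X' : Matrix ι κ ℂ}
    {A₂ : Matrix κ κ ℂ} (h₁ : NilpotentPencil l A₁) (h₂ : NilpotentPencil l A₂) :
    NilpotentPencil l (fromBlocks A₁ X' 0 A₂) := by
  obtain ⟨N₁, hN₁, hs₁⟩ := h₁
  obtain ⟨N₂, hN₂, hs₂⟩ := h₂
  refine ⟨Matrix.fromBlocks N₁ 0 0 N₂, ?_, fun z hz x hx => ?_⟩
  · rw [charpoly_fromBlocks_zero₂₁, hN₁, hN₂, Fintype.card_sum, pow_add]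
  · rw [fromBlocks_smul, fromBlocks_smul, fromBlocks_add, smul_zero, smul_zero, smul_zero, add_zero,
      add_zero, charpoly_fromBlocks_zero₂₁, IsRoot, eval_mul, mul_eq_zero] at hx
    exact hx.elim (hs₁ z hz x) (hs₂ z hz x)

theorem NilpotentPencil.of_specLT {l : ℂ} (hl : l ≠ 0) {A : Matrix ι ι ℂ} (h : SpecLT ‖l‖ A) :
    NilpotentPencil l A :=
  ⟨0, charpoly_zero, fun z hz => by
    rw [smul_zero, add_zero]; exact specLT_smul_of_norm_le hl h hz.le⟩

/-- At ε = 0 the roots are 1 and ν; for small ε the root near 1 is 1 - ε + εc + O(ε²), to first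
order a convex combination of 1 and the interior point c. If |u| ≥ 1, then |u - ν| ≥ δ, and the
error is at most 8ε²/δ², less than the gain ε(1 - |c|). -/
theorem norm_lt_one_of_mul_eq {u ν c : ℂ} {ε : ℝ} (hν : ‖ν‖ < 1) (hc : ‖c‖ < 1) (hε : 0 < ε)
    (hε1 : ε ≤ 1) (hε2 : 8 * ε < (1 - ‖ν‖) ^ 2 * (1 - ‖c‖))
    (h : (u - 1) * (u - ν) = ε * (c - 1) * (1 - ν)) : ‖u‖ < 1 := by
  by_contra! hu
  set δ := 1 - ‖ν‖ with hδ
  have hδ0 : 0 < δ := by linarith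
  have hδ1 : δ ≤ ‖u - ν‖ := by
    have := norm_sub_norm_le u ν
    linarith
  have hne : u - ν ≠ 0 := norm_pos_iff.1 (hδ0.trans_le hδ1)
  have hu1 : u - 1 = ε * (c - 1) * ((1 - ν) / (u - ν)) := by
    field_simp; exact h
  have h1ν : ‖1 - ν‖ ≤ 2 := (norm_sub_le _ _).trans (by rw [norm_one]; linarith)
  have hc1 : ‖c - 1‖ ≤ 2 := (norm_sub_le _ _).trans (by rw [norm_one]; linarith)
  have hεn : ‖(ε : ℂ)‖ = ε := by rw [Complex.norm_real, Real.norm_eq_abs, abs_of_pos hε]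
  have hκ : ‖(1 - ν) / (u - ν)‖ ≤ 2 / δ := by
    rw [norm_div]; exact div_le_div₀ zero_le_two h1ν hδ0 hδ1
  have hu2 : ‖u - 1‖ ≤ 4 * ε / δ := by
    rw [hu1, norm_mul, norm_mul, hεn]
    calc ε * ‖c - 1‖ * ‖(1 - ν) / (u - ν)‖ ≤ ε * 2 * (2 / δ) := by gcongr
      _ = _ := by ring
  have hκ1 : ‖(1 - ν) / (u - ν) - 1‖ ≤ 4 * ε / δ ^ 2 := by
    have : (1 - ν) / (u - ν) - 1 = (1 - u) / (u - ν) := by field_simp; ring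
    rw [this, norm_div, norm_sub_rev]
    calc ‖u - 1‖ / ‖u - ν‖ ≤ (4 * ε / δ) / δ := div_le_div₀ (by positivity) hu2 hδ0 hδ1
      _ = _ := by field_simp
  have hdec : u = ((1 - ε : ℝ) : ℂ) + ε * c + ε * (c - 1) * ((1 - ν) / (u - ν) - 1) := by
    push_cast; linear_combination hu1
  have hfin : ‖u‖ ≤ (1 - ε) + ε * ‖c‖ + ε * 2 * (4 * ε / δ ^ 2) := by
    refine (congrArg norm hdec).le.trans (norm_add₃_le.trans ?_)
    rw [norm_mul, norm_mul, norm_mul, hεn, Complex.norm_real, Real.norm_eq_abs,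
      abs_of_nonneg (by linarith : (0 : ℝ) ≤ 1 - ε)]
    gcongr
  have h3 : ε * 2 * (4 * ε / δ ^ 2) < ε * (1 - ‖c‖) := by
    have : ε * 2 * (4 * ε / δ ^ 2) = ε * (8 * ε / δ ^ 2) := by ring
    rw [this]
    refine mul_lt_mul_of_pos_left ?_ hε
    rw [div_lt_iff₀ (by positivity)]
    linarith
  linarith

/-- With `N = 0` the pencil has the eigenvalue `z` on the unit circle. A small nilpotent mixing the
two eigenvectors moves it inwards, while the other eigenvalue has room to spare. -/
theorem nilpotentPencil_pair {l m : ℂ} (hl0 : l ≠ 0) (hl : ‖l‖ < 1) (hm : ‖m‖ < ‖l‖) :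
    NilpotentPencil l !![l, 0; 0, m] := by
  have hlp := norm_pos_iff.2 hl0
  have hν : ‖m / l‖ < 1 := by rwa [norm_div, div_lt_one hlp]
  set ε : ℝ := (1 - ‖m / l‖) ^ 2 * (1 - ‖l‖) / 16 with hε
  have hP : 0 < (1 - ‖m / l‖) ^ 2 * (1 - ‖l‖) :=
    mul_pos (pow_pos (by linarith) 2) (by linarith)
  have hP1 : (1 - ‖m / l‖) ^ 2 * (1 - ‖l‖) ≤ 1 := by
    have h1 : (1 - ‖m / l‖) ^ 2 ≤ 1 := by nlinarith [norm_nonneg (m / l)]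
    nlinarith [norm_nonneg l]
  refine ⟨((ε : ℂ) * l) • !![1, 1; -1, -1], ?_, fun z hz x hx => ?_⟩
  · rw [charpoly_fin_two]
    simp [trace_fin_two, det_fin_two]
  have hz0 : z ≠ 0 := by rintro rfl; simp at hz
  rw [IsRoot, charpoly_fin_two] at hx
  simp [trace_fin_two, det_fin_two] at hx
  have h := norm_lt_one_of_mul_eq (u := x / z) (ν := m / l) (c := l / z) (ε := ε) hν
    (by rw [norm_div, hz, div_one]; exact hl) (by positivity) (by rw [hε]; linarith)
    (by rw [norm_div l z, hz, div_one, hε]; linarith) (by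
      field_simp
      field_simp at hx
      linear_combination hx)
  rwa [norm_div, hz, div_one] at h

/-- Each copy of `l` is paired with a copy of `m`, and the 2 × 2 blocks are split off one at a time.
Once no `l` remains, the zero nilpotent works. -/
theorem nilpotentPencil_of_count_le {N : ℕ} : ∀ {ι : Type} [Fintype ι] [DecidableEq ι],
    Fintype.card ι = N → ∀ {A : Matrix ι ι ℂ} {l m : ℂ}, l ≠ 0 → ‖l‖ < 1 → ‖m‖ < ‖l‖ →
      (∀ x ∈ A.charpoly.roots, x = l ∨ ‖x‖ < ‖l‖) →
      A.charpoly.roots.count l ≤ A.charpoly.roots.count m → NilpotentPencil l A := by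
  induction N using Nat.strong_induction_on with
  | _ N ih =>
    intro ι _ _ hN A l m hl0 hl hm htop hcount
    have hA0 := A.charpoly_monic.ne_zero
    by_cases hlr : l ∈ A.charpoly.roots
    swap
    · refine NilpotentPencil.of_specLT hl0 fun x hx => ?_
      have hx' := (mem_roots hA0).2 hx
      exact (htop x hx').resolve_left fun h => hlr (h ▸ hx')
    have hmr : m ∈ A.charpoly.roots :=
      Multiset.count_pos.1 ((Multiset.count_pos.2 hlr).trans_le hcount)
    obtain ⟨v, hv, hAv⟩ := isRoot_charpoly_iff_exists_mulVec.1 ((mem_roots hA0).1 hlr)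
    obtain ⟨w, hw, hAw⟩ := isRoot_charpoly_iff_exists_mulVec.1 ((mem_roots hA0).1 hmr)
    have hlm : l ≠ m := by rintro rfl; exact lt_irrefl _ hm
    have hli : LinearIndependent ℂ ![v, w] := by
      rw [LinearIndependent.pair_iff]
      intro s t hst
      have h1 := congrArg (A *ᵥ ·) hst
      simp only [mulVec_add, mulVec_smul, hAv, hAw, mulVec_zero] at h1
      have h2 : (t * (m - l)) • w = 0 := by
        have : (t * (m - l)) • w = (s • l • v + t • m • w) - l • (s • v + t • w) := by module
        rw [this, h1, hst, smul_zero, sub_zero]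
      have ht : t = 0 := by
        have := (smul_eq_zero.1 h2).resolve_right hw
        exact (mul_eq_zero.1 this).resolve_right (sub_ne_zero.2 hlm.symm)
      rw [ht, zero_smul, add_zero] at hst
      exact ⟨(smul_eq_zero.1 hst).resolve_right hv, ht⟩
    obtain ⟨J, _, _, X', A₂, hsim⟩ := exists_sim_fromBlocks (A := A) hli (P := !![l, 0; 0, m])
      (fun k => by fin_cases k <;> simp [Fin.sum_univ_two, hAv, hAw])
    refine NilpotentPencil.of_sim hsim
      (NilpotentPencil.fromBlocks (nilpotentPencil_pair hl0 hl hm) ?_)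
    have hcard := hsim.card_eq
    rw [Fintype.card_sum, Fintype.card_fin] at hcard
    have hP : (!![l, 0; 0, m] : Matrix (Fin 2) (Fin 2) ℂ).charpoly = (X - C l) * (X - C m) := by
      rw [charpoly_fin_two]; simp [trace_fin_two, det_fin_two]; ring
    have hroots : A.charpoly.roots = {l} + {m} + A₂.charpoly.roots := by
      have h0 : (X - C l) * (X - C m) ≠ 0 := mul_ne_zero (X_sub_C_ne_zero l) (X_sub_C_ne_zero m)
      rw [hsim.charpoly_eq, charpoly_fromBlocks_zero₂₁, hP,
        roots_mul (mul_ne_zero h0 A₂.charpoly_monic.ne_zero), roots_mul h0, roots_X_sub_C,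
        roots_X_sub_C]
    refine ih (Fintype.card J) (by omega) rfl hl0 hl hm (fun x hx => htop x ?_) ?_
    · rw [hroots]; exact Multiset.mem_add.2 (Or.inr hx)
    · rw [hroots] at hcount
      simp only [Multiset.count_add, Multiset.count_singleton, if_true, hlm, hlm.symm,
        if_false] at hcount
      omega

theorem not_continuousOn_lempert_of_count_le {n : ℕ} {A : Matrix (Fin n) (Fin n) ℂ}
    (hA : SpecLT 1 A) {l m : ℂ} (hl0 : l ≠ 0) (hm : ‖m‖ < ‖l‖) (hlr : l ∈ A.charpoly.roots)
    (htop : ∀ x ∈ A.charpoly.roots, x = l ∨ ‖x‖ < ‖l‖)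
    (hcount : A.charpoly.roots.count l ≤ A.charpoly.roots.count m) :
    ¬ ContinuousOn (fun B => lempertFunction (spectralBall n) A B) (spectralBall n) := by
  intro hcont
  have hroot : A.charpoly.IsRoot l := (mem_roots A.charpoly_monic.ne_zero).1 hlr
  have hl : ‖l‖ < 1 := hA l hroot
  obtain ⟨N, hN, hs⟩ := nilpotentPencil_of_count_le rfl hl0 hl hm htop hcount
  have hF : HolOn (fun z : ℂ => (z / l) • A + (1 - z / l) • N) Set.univ :=
    (HolOn.smul (by fun_prop) (holOn_const _ _)).add (HolOn.smul (by fun_prop) (holOn_const _ _))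
  have hF' := hF.mono (Set.subset_univ (Metric.ball 0 2))
  obtain ⟨β, hβ, hβ0, hreach⟩ := exists_reach_lt hF
    (fun z hz => specLT_of_circle hF' one_pos one_lt_two one_pos hs hz) hl hl0
  simp only [zero_div, zero_smul, sub_zero, one_smul, zero_add, div_self hl0, sub_self,
    add_zero] at hreach
  -- The nilpotent `N` degenerates to 0, so the distance from `A` to 0 would be at most `‖β‖ < ‖l‖`,
  -- less than the modulus of an eigenvalue of `A`.
  have h1 := lempert_le_of_simLim hcont (specLT_zero one_pos) hβ0 hreach.symm (simLim_zero hN)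
  rw [lempert_comm] at h1
  exact absurd (specLE_of_lempert_zero_le hA h1 l hroot) (not_le.2 hβ)

theorem roots_charpoly_matAut {a : ℂ} (ha : ‖a‖ < 1) {B : Matrix ι ι ℂ} (hB : SpecLT 1 B) :
    (matAut a B).charpoly.roots = B.charpoly.roots.map (discAut a) := by
  obtain ⟨d, hd⟩ := exists_charpoly_eq_prod B
  have h : ∀ f : ι → ℂ, (∏ i, (X - C (f i))).roots = Finset.univ.val.map f := fun f => by
    have := roots_multiset_prod_X_sub_C (Finset.univ.val.map f)
    rwa [Multiset.map_map] at this
  rw [charpoly_matAut ha hB hd, hd, h, h, Multiset.map_map]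
  rfl

theorem discAut_injOn {a : ℂ} (ha : ‖a‖ < 1) {z w : ℂ} (hz : ‖z‖ < 1) (hw : ‖w‖ < 1)
    (h : discAut a z = discAut a w) : z = w := by
  have h1 := one_sub_conj_mul_ne_zero ha hz.le
  have h2 := one_sub_conj_mul_ne_zero ha hw.le
  have h3 := one_sub_conj_mul_ne_zero ha ha.le
  rw [discAut, discAut, div_eq_div_iff h1 h2] at h
  have : (z - w) * (1 - starRingEnd ℂ a * a) = 0 := by linear_combination h
  exact sub_eq_zero.1 ((mul_eq_zero.1 this).resolve_right h3)

/-- Moving the centre away from `l` makes it the unique farthest point of the closed disc of radius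
`‖l‖`. This separates `l` from other eigenvalues of equal modulus. -/
theorem norm_discAut_neg_lt {l x : ℂ} (hl : ‖l‖ < 1) (hx : ‖x‖ ≤ ‖l‖) (hne : x ≠ l) :
    ‖discAut (-l) x‖ < ‖discAut (-l) l‖ := by
  have hl' : ‖-l‖ < 1 := by simpa using hl
  have h1 := one_sub_conj_mul_ne_zero hl' (hx.trans hl.le)
  have h2 := one_sub_conj_mul_ne_zero hl' hl.le
  rw [discAut, discAut, norm_div, norm_div, div_lt_div_iff₀ (norm_pos_iff.2 h1) (norm_pos_iff.2 h2)]
  refine lt_of_pow_lt_pow_left₀ 2 (by positivity) ?_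
  have e1 := normSq_discAut_identity (-l) x
  have e2 := normSq_discAut_identity (-l) l
  have e3 : ‖x - -l‖ ^ 2 + ‖x - l‖ ^ 2 = 2 * (‖x‖ ^ 2 + ‖l‖ ^ 2) := by
    simp only [← Complex.normSq_eq_norm_sq, Complex.normSq_apply]
    simp; ring
  have e4 : ‖l - -l‖ ^ 2 = 4 * ‖l‖ ^ 2 := by
    rw [show l - -l = 2 * l by ring, norm_mul]; norm_num [mul_pow]
  have e5 : 0 < ‖x - l‖ ^ 2 := pow_pos (norm_pos_iff.2 (sub_ne_zero.2 hne)) 2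
  rw [norm_neg] at e1 e2
  rw [mul_pow, mul_pow]
  set q := ‖x‖ ^ 2
  set R := ‖l‖ ^ 2
  have hqR : q ≤ R := pow_le_pow_left₀ (norm_nonneg _) hx 2
  have hR1 : R < 1 := by
    have := pow_lt_one₀ (norm_nonneg l) hl two_ne_zero
    exact this
  have hq0 : 0 ≤ q := by positivity
  set a := ‖x - -l‖ ^ 2
  have hb : ‖1 - starRingEnd ℂ (-l) * x‖ ^ 2 = a + (1 - R) * (1 - q) := by linarith
  have hc : ‖1 - starRingEnd ℂ (-l) * l‖ ^ 2 = (1 + R) ^ 2 := by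
    rw [e4] at e2; linarith
  rw [hb, hc, e4]
  have ha : a < 2 * (q + R) := by linarith
  nlinarith [mul_pos (sub_pos.2 ha) (mul_pos (sub_pos.2 hR1) (sub_pos.2 hR1)),
    mul_nonneg (sub_nonneg.2 hqR) (sub_pos.2 hR1).le,
    mul_nonneg (mul_nonneg (sub_nonneg.2 hqR) (sub_pos.2 hR1).le) (hq0.trans hqR),
    mul_nonneg (mul_nonneg (sub_nonneg.2 hqR) (sub_pos.2 hR1).le) hq0]

theorem not_continuousOn_lempert_of_ne {n : ℕ} {A : Matrix (Fin n) (Fin n) ℂ}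
    (hA : SpecLT 1 A) {x y : ℂ} (hx : x ∈ A.charpoly.roots) (hy : y ∈ A.charpoly.roots)
    (hxy : x ≠ y) :
    ¬ ContinuousOn (fun B => lempertFunction (spectralBall n) A B) (spectralBall n) := by
  intro hcont
  have hmem : ∀ {B : Matrix (Fin n) (Fin n) ℂ}, SpecLT 1 B → ∀ u ∈ B.charpoly.roots, ‖u‖ < 1 :=
    fun {B} hB u hu => hB u ((mem_roots B.charpoly_monic.ne_zero).1 hu)
  -- A most frequent eigenvalue is sent to 0, then a nonzero eigenvalue `l` of largest modulus is
  -- made strictly dominant. The image of 0 keeps maximal multiplicity and serves as `m`.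
  obtain ⟨v, hv, hvmax⟩ := A.charpoly.roots.toFinset.exists_max_image
    (fun u => A.charpoly.roots.count u) ⟨x, Multiset.mem_toFinset.2 hx⟩
  rw [Multiset.mem_toFinset] at hv
  have hv1 := hmem hA v hv
  have hcont₁ := continuousOn_lempert_matAut hv1 hA hcont
  have hA₁ := hA.matAut hv1
  have hroots₁ := roots_charpoly_matAut hv1 hA
  set A₁ := matAut v A
  obtain ⟨l, hl, hlmax⟩ := A₁.charpoly.roots.toFinset.exists_max_image (fun u => ‖u‖)
    ⟨discAut v x, Multiset.mem_toFinset.2 (hroots₁ ▸ Multiset.mem_map_of_mem _ hx)⟩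
  rw [Multiset.mem_toFinset] at hl
  have hl1 := hmem hA₁ l hl
  have hl' : ‖-l‖ < 1 := by simpa using hl1
  have hzero : discAut v v = 0 := by simp [discAut]
  have h0mem : (0 : ℂ) ∈ A₁.charpoly.roots := by
    rw [hroots₁, ← hzero]; exact Multiset.mem_map_of_mem _ hv
  have hl0 : l ≠ 0 := by
    rintro rfl
    have hall : ∀ u ∈ A.charpoly.roots, u = v := fun u hu => by
      have h1 := hlmax (discAut v u) (Multiset.mem_toFinset.2
        (hroots₁ ▸ Multiset.mem_map_of_mem _ hu))
      simp only [norm_zero, norm_le_zero_iff] at h1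
      exact discAut_injOn hv1 (hmem hA u hu) hv1 (h1.trans hzero.symm)
    exact hxy ((hall x hx).trans (hall y hy).symm)
  have hcount₁ : A₁.charpoly.roots.count l ≤ A₁.charpoly.roots.count 0 := by
    have hinj : Set.InjOn (discAut v) {u | u ∈ A.charpoly.roots} := fun u hu w hw h =>
      discAut_injOn hv1 (hmem hA u hu) (hmem hA w hw) h
    rw [hroots₁] at hl ⊢
    obtain ⟨u, hu, rfl⟩ := Multiset.mem_map.1 hl
    rw [← hzero, Multiset.count_map_eq_count _ _ hinj u hu,
      Multiset.count_map_eq_count _ _ hinj v hv]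
    exact hvmax u (Multiset.mem_toFinset.2 hu)
  have hcont₂ := continuousOn_lempert_matAut hl' hA₁ hcont₁
  have hA₂ := hA₁.matAut hl'
  have hroots₂ := roots_charpoly_matAut hl' hA₁
  have hinj : Set.InjOn (discAut (-l)) {u | u ∈ A₁.charpoly.roots} := fun u hu w hw h =>
    discAut_injOn hl' (hmem hA₁ u hu) (hmem hA₁ w hw) h
  have hlt : ‖discAut (-l) 0‖ < ‖discAut (-l) l‖ :=
    norm_discAut_neg_lt hl1 (by simp) hl0.symm
  refine not_continuousOn_lempert_of_count_le hA₂ (l := discAut (-l) l) (m := discAut (-l) 0)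
    (norm_pos_iff.1 ((norm_nonneg _).trans_lt hlt)) hlt ?_ (fun u hu => ?_) ?_ hcont₂
  · rw [hroots₂]; exact Multiset.mem_map_of_mem _ hl
  · rw [hroots₂] at hu
    obtain ⟨w, hw, rfl⟩ := Multiset.mem_map.1 hu
    rcases eq_or_ne w l with rfl | hwl
    · exact Or.inl rfl
    · exact Or.inr (norm_discAut_neg_lt hl1 (hlmax w (Multiset.mem_toFinset.2 hw)) hwl)
  · rw [hroots₂, Multiset.count_map_eq_count _ _ hinj l hl,
      Multiset.count_map_eq_count _ _ hinj 0 h0mem]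
    exact hcount₁

end DistinctEigenvalues

/-! ### Companion matrices and nilpotent normal forms -/

section Companion
variable {m : ℕ}

/-- The companion matrix with last column `a`. -/
def lastColCompanion (a : Fin (m + 1) → ℂ) : Matrix (Fin (m + 1)) (Fin (m + 1)) ℂ :=
  Matrix.of fun i j => if j = Fin.last m then a i else if (i : ℕ) = j + 1 then 1 else 0

/-- The matrix with last column `a` and all other columns zero. -/
def lastCol (a : Fin (m + 1) → ℂ) : Matrix (Fin (m + 1)) (Fin (m + 1)) ℂ :=
  Matrix.of fun i j => if j = Fin.last m then a i else 0

theorem lastColCompanion_smul (c : ℂ) (a : Fin (m + 1) → ℂ) :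
    lastColCompanion (c • a) = lastColCompanion 0 + c • lastCol a := by
  ext i j
  simp only [lastColCompanion, lastCol, of_apply, Matrix.add_apply, Matrix.smul_apply,
    Pi.smul_apply, Pi.zero_apply, smul_eq_mul]
  split_ifs <;> simp

theorem lastColCompanion_pow_mulVec (a : Fin (m + 1) → ℂ) (k : ℕ) (hk : k < m + 1) :
    (lastColCompanion a ^ k) *ᵥ Pi.single 0 1 = Pi.single ⟨k, hk⟩ 1 := by
  induction k with
  | zero => rw [pow_zero, one_mulVec]; rfl
  | succ k ih =>
    rw [pow_succ', ← mulVec_mulVec, ih (by omega), mulVec_single_one]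
    ext i
    have h1 : (⟨k, by omega⟩ : Fin (m + 1)) ≠ Fin.last m := by
      intro h; have := congrArg Fin.val h; simp at this; omega
    simp only [col_apply, lastColCompanion, of_apply, Pi.single_apply]
    rw [if_neg h1]
    simp only [Fin.ext_iff]

theorem lastColCompanion_pow_card_mulVec (a : Fin (m + 1) → ℂ) :
    (lastColCompanion a ^ (m + 1)) *ᵥ Pi.single 0 1 = a := by
  rw [pow_succ', ← mulVec_mulVec, lastColCompanion_pow_mulVec a m (by omega), mulVec_single_one]
  ext i
  have h1 : (⟨m, by omega⟩ : Fin (m + 1)) = Fin.last m := rfl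
  simp [col_apply, lastColCompanion, h1]

/-- The difference of the two monic polynomials has degree at most `m` and, evaluated at the matrix,
kills the first basis vector. The first `m + 1` iterates of that vector form the standard basis, so
all coefficients vanish. -/
theorem charpoly_lastColCompanion (a : Fin (m + 1) → ℂ) :
    (lastColCompanion a).charpoly = X ^ (m + 1) - ∑ i, C (a i) * X ^ (i : ℕ) := by
  set A := lastColCompanion a with hA
  set p : ℂ[X] := X ^ (m + 1) - ∑ i : Fin (m + 1), C (a i) * X ^ (i : ℕ) with hp
  have hsum : (∑ i : Fin (m + 1), C (a i) * X ^ (i : ℕ)).degree < ((m + 1 : ℕ) : WithBot ℕ) := by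
    refine (degree_sum_le _ _).trans_lt ((Finset.sup_lt_iff (WithBot.bot_lt_coe _)).2 fun i _ => ?_)
    exact (degree_C_mul_X_pow_le _ _).trans_lt (by exact_mod_cast i.2)
  have hpm : p.Monic := (monic_X_pow (m + 1)).sub_of_left (by rwa [degree_X_pow])
  have hpd : p.degree = ((m + 1 : ℕ) : WithBot ℕ) := by
    rw [hp, degree_sub_eq_left_of_degree_lt (by rwa [degree_X_pow]), degree_X_pow]
  have hcd : A.charpoly.degree = ((m + 1 : ℕ) : WithBot ℕ) := by
    rw [charpoly_degree_eq_dim, Fintype.card_fin]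
  have hdeg : (A.charpoly - p).degree < ((m + 1 : ℕ) : WithBot ℕ) := by
    rw [← hcd]
    refine degree_sub_lt_left (hcd.trans hpd.symm) A.charpoly_monic.ne_zero ?_
    rw [A.charpoly_monic.leadingCoeff, hpm.leadingCoeff]
  have hann : (aeval A (A.charpoly - p)) *ᵥ Pi.single 0 1 = 0 := by
    rw [map_sub, aeval_self_charpoly, zero_sub, neg_mulVec, neg_eq_zero, hp, map_sub, sub_mulVec,
      map_pow, aeval_X, lastColCompanion_pow_card_mulVec, map_sum, sum_mulVec, sub_eq_zero]
    conv_lhs => rw [← Finset.univ_sum_single a]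
    refine Finset.sum_congr rfl fun i _ => ?_
    rw [map_mul, aeval_C, map_pow, aeval_X, ← mulVec_mulVec, lastColCompanion_pow_mulVec a i i.2,
      Algebra.algebraMap_eq_smul_one, smul_mulVec, one_mulVec, ← Pi.single_smul]
    simp
  set q := A.charpoly - p
  have hq : q = ∑ i : Fin (m + 1), C (q.coeff i) * X ^ (i : ℕ) := by
    rw [Fin.sum_univ_eq_sum_range (fun i => C (q.coeff i) * X ^ i)]
    exact as_sum_range_C_mul_X_pow' q (by
      by_cases h0 : q = 0
      · simp [h0]
      · exact (natDegree_lt_iff_degree_lt h0).2 hdeg)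
  have hcoef : ∀ i : Fin (m + 1), q.coeff i = 0 := by
    intro i
    have h1 : (aeval A q) *ᵥ Pi.single 0 1 = fun i : Fin (m + 1) => q.coeff i := by
      conv_lhs => rw [hq]
      conv_rhs => rw [← Finset.univ_sum_single (fun i : Fin (m + 1) => q.coeff i)]
      rw [map_sum, sum_mulVec]
      refine Finset.sum_congr rfl fun i _ => ?_
      rw [map_mul, aeval_C, map_pow, aeval_X, ← mulVec_mulVec, lastColCompanion_pow_mulVec a i i.2,
        Algebra.algebraMap_eq_smul_one, smul_mulVec, one_mulVec, ← Pi.single_smul]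
      simp
    exact congrFun (h1.symm.trans hann) i
  have : q = 0 := by rw [hq]; exact Finset.sum_eq_zero fun i _ => by rw [hcoef]; simp
  exact sub_eq_zero.1 this

/-- The condition on the last entry says that the trace is zero. It lowers the exponent on the right
from `m` to `m - 1`, so large roots grow only like the square root of `‖c‖`. -/
theorem norm_root_lastColCompanion {a : Fin (m + 1) → ℂ} (ha : a (Fin.last m) = 0) {c x : ℂ}
    (hx : (lastColCompanion (c • a)).charpoly.IsRoot x) :
    ‖x‖ ^ (m + 1) ≤ ‖c‖ * (∑ i, ‖a i‖) * max 1 (‖x‖ ^ (m - 1)) := by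
  rw [charpoly_lastColCompanion, IsRoot] at hx
  simp only [eval_sub, eval_pow, eval_X, eval_finsetSum, eval_mul, eval_C, Pi.smul_apply,
    smul_eq_mul] at hx
  rw [← norm_pow, sub_eq_zero.1 hx, mul_assoc, Finset.sum_mul, Finset.mul_sum]
  refine norm_sum_le_of_le _ fun i _ => ?_
  rw [norm_mul, norm_mul, norm_pow, mul_assoc]
  refine mul_le_mul_of_nonneg_left ?_ (norm_nonneg _)
  by_cases hi : i = Fin.last m
  · simp [hi, ha]
  refine mul_le_mul_of_nonneg_left ?_ (norm_nonneg _)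
  have him : (i : ℕ) ≤ m - 1 := by
    have := Fin.val_lt_last hi
    omega
  rcases le_or_gt 1 ‖x‖ with h1 | h1
  · exact (pow_le_pow_right₀ h1 him).trans (le_max_right _ _)
  · exact (pow_le_one₀ (norm_nonneg _) h1.le).trans (le_max_left _ _)

/-- A nilpotent of maximal index is a single Jordan block: the iterates of a vector not killed by `A
^ m` form a basis. -/
theorem sim_lastColCompanion_zero {A : Matrix (Fin (m + 1)) (Fin (m + 1)) ℂ}
    (h1 : A ^ (m + 1) = 0) (h2 : A ^ m ≠ 0) : Sim A (lastColCompanion (m := m) 0) := by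
  obtain ⟨u, hu⟩ : ∃ u, (A ^ m) *ᵥ u ≠ 0 := by
    by_contra! h
    exact h2 (ext_of_mulVec_single fun i => by rw [h, zero_mulVec])
  have hpow : ∀ k, m + 1 ≤ k → (A ^ k) *ᵥ u = 0 := fun k hk => by
    rw [pow_eq_zero_of_le hk h1, zero_mulVec]
  have hli : LinearIndependent ℂ fun i : Fin (m + 1) => (A ^ (i : ℕ)) *ᵥ u := by
    rw [Fintype.linearIndependent_iff]
    intro g hg
    have key : ∀ k (hk : k < m + 1), g ⟨k, hk⟩ = 0 := by
      intro k
      induction k using Nat.strong_induction_on with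
      | _ k ih =>
        intro hk
        have := congrArg ((A ^ (m - k)) *ᵥ ·) hg
        simp only [mulVec_zero] at this
        rw [mulVec_sum, Finset.sum_eq_single (⟨k, hk⟩ : Fin (m + 1))] at this
        · rw [mulVec_smul, mulVec_mulVec, ← pow_add, show m - k + k = m by omega] at this
          exact (smul_eq_zero.1 this).resolve_right hu
        · intro i _ hi
          have hik : (i : ℕ) ≠ k := fun h => hi (Fin.ext h)
          rcases lt_or_gt_of_ne hik with h | h
          · rw [show g i = 0 from ih i h i.2, zero_smul, mulVec_zero]
          · rw [mulVec_smul, mulVec_mulVec, ← pow_add, hpow _ (by omega), smul_zero]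
        · simp
    exact fun i => key i i.2
  obtain ⟨J, _, _, X', A₂, hsim⟩ := exists_sim_fromBlocks (A := A) hli (P := lastColCompanion (m := m) 0)
    (fun k => by
      rw [mulVec_mulVec, ← pow_succ']
      by_cases hk : k = Fin.last m
      · subst hk
        rw [hpow _ (by simp)]
        simp [lastColCompanion]
      · have hk' := Fin.val_lt_last hk
        rw [Finset.sum_eq_single (⟨k + 1, by omega⟩ : Fin (m + 1))]
        · simp [lastColCompanion, hk]
        · intro b _ hb
          have : (b : ℕ) ≠ k + 1 := fun h => hb (Fin.ext h)
          simp [lastColCompanion, hk, this]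
        · simp)
  have hcard := hsim.card_eq
  rw [Fintype.card_sum, Fintype.card_fin] at hcard
  have : IsEmpty J := Fintype.card_eq_zero_iff.1 (by omega)
  refine hsim.trans ?_
  exact Sim.submatrix (fromBlocks (lastColCompanion 0) X' 0 A₂)
    (Equiv.sumEmpty (Fin (m + 1)) J).symm

theorem sim_lastCol {u : Fin (m + 1) → ℂ} (hu : u (Fin.last m) = 0) {i₀ : Fin (m + 1)}
    (hi₀ : u i₀ ≠ 0) : Sim (lastCol u) (single i₀ (Fin.last m) (1 : ℂ)) := by
  have hne : i₀ ≠ Fin.last m := by rintro rfl; exact hi₀ hu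
  set P : Matrix (Fin (m + 1)) (Fin (m + 1)) ℂ := updateCol 1 i₀ u with hP
  have hdet : P.det = u i₀ := by
    have := det_updateCol_sum (1 : Matrix (Fin (m + 1)) (Fin (m + 1)) ℂ) i₀ u
    rw [det_one, smul_eq_mul, mul_one] at this
    rw [← this, hP]
    congr 2
    ext k
    simp [Matrix.one_apply]
  have hPu : IsUnit P.det := isUnit_iff_ne_zero.2 (by rwa [hdet])
  refine ⟨P, P⁻¹, mul_nonsing_inv _ hPu, nonsing_inv_mul _ hPu, ?_⟩
  have key : lastCol u * P = P * single i₀ (Fin.last m) (1 : ℂ) := by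
    ext i j
    have h1 : (lastCol u * P) i j = u i * P (Fin.last m) j := by
      rw [Matrix.mul_apply, Finset.sum_eq_single (Fin.last m)]
      · simp [lastCol]
      · intro b _ hb; simp [lastCol, hb]
      · simp
    rw [h1]
    by_cases hj : j = Fin.last m
    · subst hj
      rw [mul_single_apply_same]
      simp [hP, hne.symm]
    · rw [mul_single_apply_of_ne (hbj := hj)]
      by_cases hj' : j = i₀
      · subst hj'; simp [hP, hu]
      · simp [hP, hj', Ne.symm hj]
  rw [← key, mul_nonsing_inv_cancel_right _ _ hPu]

end Companion

/-! ### Factoring out zeros of rows and columns -/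

section RowFactor
variable {ι κ : Type*} [Fintype ι] [DecidableEq ι]

/-- Each row vanishing at `a` is divisible by `z - a`, so the determinant of a square `F` vanishes
there to order at least `T.card`. -/
theorem HolOn.exists_diagonal_mul {F : ℂ → Matrix ι κ ℂ} (hF : HolOn F (Metric.ball 0 1)) {a : ℂ}
    (ha : ‖a‖ < 1) (T : Finset ι) (hrow : ∀ i ∈ T, ∀ j, F a i j = 0) :
    ∃ H : ℂ → Matrix ι κ ℂ, HolOn H (Metric.ball 0 1) ∧
      ∀ z, F z = diagonal (fun i => if i ∈ T then z - a else 1) * H z := by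
  refine ⟨fun z => Matrix.of fun i j => if i ∈ T then dslope (fun w => F w i j) a z else F z i j,
    fun i j => ?_, fun z => ?_⟩
  · by_cases hi : i ∈ T
    · simp only [of_apply, hi, if_true]
      exact (Complex.differentiableOn_dslope
        (Metric.isOpen_ball.mem_nhds (by simpa using ha))).2 (hF i j)
    · simp only [of_apply, hi, if_false]
      exact hF i j
  · ext i j
    rw [diagonal_mul]
    change F z i j = (if i ∈ T then z - a else 1) *
      (if i ∈ T then dslope (fun w => F w i j) a z else F z i j)
    by_cases hi : i ∈ T
    · have := sub_smul_dslope (fun w => F w i j) a z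
      simp only [hrow i hi j, sub_zero] at this
      simp only [hi, if_true]
      exact this.symm
    · simp [hi]

theorem HolOn.exists_mul_diagonal {F : ℂ → Matrix κ ι ℂ} (hF : HolOn F (Metric.ball 0 1)) {a : ℂ}
    (ha : ‖a‖ < 1) (T : Finset ι) (hcol : ∀ j ∈ T, ∀ i, F a i j = 0) :
    ∃ H : ℂ → Matrix κ ι ℂ, HolOn H (Metric.ball 0 1) ∧
      ∀ z, F z = H z * diagonal (fun j => if j ∈ T then z - a else 1) := by
  obtain ⟨H, h1, h2⟩ := HolOn.exists_diagonal_mul (F := fun z => (F z)ᵀ)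
    (fun i j => hF j i) ha T (fun i hi j => hcol i hi j)
  refine ⟨fun z => (H z)ᵀ, fun i j => h1 j i, fun z => ?_⟩
  rw [← transpose_transpose (F z), h2 z, transpose_mul, diagonal_transpose]

theorem det_diagonal_ite (T : Finset ι) (c : ℂ) :
    (diagonal fun i => if i ∈ T then c else 1).det = c ^ T.card := by
  rw [det_diagonal, Finset.prod_ite_mem, Finset.univ_inter, Finset.prod_const]

theorem norm_le_of_sphere {f : ℂ → ℂ} (hf : DifferentiableOn ℂ f (Metric.ball 0 1)) {r C : ℝ}
    (hr : 0 < r) (hr1 : r < 1) (h : ∀ z : ℂ, ‖z‖ = r → ‖f z‖ ≤ C) {z : ℂ} (hz : ‖z‖ ≤ r) :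
    ‖f z‖ ≤ C := by
  have hsub : Metric.closedBall (0 : ℂ) r ⊆ Metric.ball 0 1 := Metric.closedBall_subset_ball hr1
  refine Complex.norm_le_of_forall_mem_frontier_norm_le (U := Metric.ball 0 r) Metric.isBounded_ball
    ?_ (fun z hz => h z ?_) (by rw [closure_ball _ hr.ne']; simpa using hz)
  · exact (hf.mono (by rw [closure_ball _ hr.ne']; exact hsub)).diffContOnCl
  · rw [frontier_ball _ hr.ne'] at hz
    simpa using hz

end RowFactor

/-! ### Lower bounds on the time needed to reach diagonal matrices -/

section LowerBounds
variable {m : ℕ}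

/-- All but one row of b - φ vanish at `α`, so det(b - φ) = (z - α)^m g. At 0 the determinant is
b^(m+1). On |z| = 1/2 each of its m + 1 factors is at most 2 and |z - α| ≥ 1/4, which bounds g. -/
theorem norm_pow_le_of_reach_diagonal {A : Matrix (Fin (m + 1)) (Fin (m + 1)) ℂ}
    (hA : A.charpoly = X ^ (m + 1)) {d : Fin (m + 1) → ℂ} (hd : ∀ i, i ≠ Fin.last m → d i = 1)
    {b α : ℂ} (hb : ‖b‖ ≤ 1) (hα : ‖α‖ ≤ 1 / 4) (h : Reach A (b • diagonal d) α) :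
    ‖b‖ ^ (m + 1) ≤ ‖α‖ ^ m * (2 ^ (m + 1) * 4 ^ m) := by
  obtain ⟨hα1, φ, h1, h2, h3, h4⟩ := h
  obtain ⟨H, hH, hfac⟩ := HolOn.exists_diagonal_mul
    (F := fun z => b • (1 : Matrix (Fin (m + 1)) (Fin (m + 1)) ℂ) - φ z)
    ((holOn_const _ _).sub h1) hα1 (Finset.univ.erase (Fin.last m)) (by
      intro i hi j
      simp only [h4, Matrix.sub_apply, Matrix.smul_apply, smul_eq_mul]
      by_cases hij : i = j
      · subst hij
        simp [hd i (Finset.ne_of_mem_erase hi)]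
      · simp [hij])
  have hdet : ∀ z, (b • (1 : Matrix (Fin (m + 1)) (Fin (m + 1)) ℂ) - φ z).det =
      (z - α) ^ m * (H z).det := by
    intro z
    rw [hfac z, det_mul, det_diagonal_ite, Finset.card_erase_of_mem (Finset.mem_univ _),
      Finset.card_univ, Fintype.card_fin, Nat.add_sub_cancel]
  have hg : ‖(H 0).det‖ ≤ 2 ^ (m + 1) * 4 ^ m := by
    refine norm_le_of_sphere (r := 1 / 2) hH.det (by norm_num) (by norm_num) (fun z hz => ?_) (by simp)
    have hzα : (1 / 4 : ℝ) ≤ ‖z - α‖ := by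
      have := norm_sub_norm_le z α
      linarith
    obtain ⟨e, he⟩ := exists_charpoly_eq_prod (φ z)
    have hf : ‖(b • (1 : Matrix (Fin (m + 1)) (Fin (m + 1)) ℂ) - φ z).det‖ ≤ 2 ^ (m + 1) := by
      have := det_smul_one_sub_smul he b 1
      rw [one_smul] at this
      rw [this, norm_prod]
      refine (Finset.prod_le_prod (fun _ _ => norm_nonneg _) (g := fun _ => (2 : ℝ))
        fun i _ => ?_).trans_eq (by simp)
      have := h2 z (by rw [hz]; norm_num) _ (isRoot_of_charpoly_eq_prod he i)
      calc ‖b - 1 * e i‖ ≤ ‖b‖ + ‖1 * e i‖ := norm_sub_le _ _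
        _ ≤ 2 := by rw [one_mul]; linarith
    rw [hdet, norm_mul, norm_pow] at hf
    have h5 : (1 / 4 : ℝ) ^ m * ‖(H z).det‖ ≤ 2 ^ (m + 1) :=
      (mul_le_mul_of_nonneg_right (pow_le_pow_left₀ (by norm_num) hzα m) (norm_nonneg _)).trans hf
    rw [one_div, inv_pow, inv_mul_le_iff₀ (by positivity)] at h5
    rwa [mul_comm]
  have h0 := hdet 0
  obtain ⟨e, he⟩ := exists_charpoly_eq_prod A
  have h6 : (b • (1 : Matrix (Fin (m + 1)) (Fin (m + 1)) ℂ) - φ 0).det = b ^ (m + 1) := by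
    have := det_smul_one_sub_smul (B := A) (d := fun _ => 0) (by simp [hA]) b 1
    rw [one_smul] at this
    rw [h3, this]; simp
  rw [h6] at h0
  rw [← norm_pow, h0, norm_mul, norm_pow, zero_sub, norm_neg]
  exact mul_le_mul_of_nonneg_left hg (by positivity)

/-- A zero count in the spirit of Rouché. For `α` too small, det((b/α)z - φ(z)) is close to a
polynomial of degree m + 1 on |z| = 1/2, yet it vanishes m times at `α` and twice at 0, once too
often. -/
theorem lt_norm_of_reach_diagonal {A : Matrix (Fin (m + 1)) (Fin (m + 1)) ℂ}
    {j₁ j₂ : Fin (m + 1)} (hj : j₁ ≠ j₂) (hj₁ : ∀ i, A i j₁ = 0) (hj₂ : ∀ i, A i j₂ = 0)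
    {d : Fin (m + 1) → ℂ} (hd : ∀ i, i ≠ Fin.last m → d i = 1)
    {b α : ℂ} (hb : ‖b‖ ≤ 1) (hb0 : b ≠ 0) (h : Reach A (b • diagonal d) α) :
    ‖b‖ / (16 * (m + 1)) < ‖α‖ := by
  by_contra! hle
  obtain ⟨hα1, φ, h1, h2, h3, h4⟩ := h
  have hm0 : (0 : ℝ) < m + 1 := by positivity
  have hα0 : α ≠ 0 := by
    rintro rfl
    have hAD : A = b • diagonal d := h3.symm.trans h4
    obtain ⟨j, hjl, hjA⟩ : ∃ j, j ≠ Fin.last m ∧ ∀ i, A i j = 0 := by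
      by_cases h : j₁ = Fin.last m
      · exact ⟨j₂, fun h' => hj (h.trans h'.symm), hj₂⟩
      · exact ⟨j₁, h, hj₁⟩
    have := hjA j
    rw [hAD] at this
    simp [hd j hjl, hb0] at this
  have hαpos := norm_pos_iff.2 hα0
  have hbpos := norm_pos_iff.2 hb0
  have hα16 : ‖α‖ ≤ 1 / (16 * (m + 1)) := hle.trans (by gcongr)
  have hα16' : ‖α‖ ≤ 1 / 16 := hα16.trans (by
    apply one_div_le_one_div_of_le <;> [norm_num; (have : (0:ℝ) ≤ m := by positivity
                                                   linarith)])
  -- The scalar βz is 0 at 0 and `b` at `α`, so the zero columns of `A` and the zero rows at the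
  -- endpoint contribute to one determinant.
  set β := b / α with hβ
  have hβ0 : β ≠ 0 := div_ne_zero hb0 hα0
  have hβn : 16 * (m + 1 : ℝ) ≤ ‖β‖ := by
    rw [hβ, norm_div, le_div_iff₀ hαpos]
    rw [le_div_iff₀ (by positivity)] at hle
    linarith
  have hβα : β * α = b := div_mul_cancel₀ _ hα0
  obtain ⟨H, hH, hfac⟩ := HolOn.exists_diagonal_mul
    (F := fun z => (β * z) • (1 : Matrix (Fin (m + 1)) (Fin (m + 1)) ℂ) - φ z)
    ((HolOn.smul (by fun_prop) (holOn_const _ _)).sub h1) hα1 (Finset.univ.erase (Fin.last m)) (by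
      intro i hi j
      simp only [h4, hβα, Matrix.sub_apply, Matrix.smul_apply, smul_eq_mul]
      by_cases hij : i = j
      · subst hij
        simp [hd i (Finset.ne_of_mem_erase hi)]
      · simp [hij])
  have hcol : ∀ j, (∀ i, A i j = 0) → ∀ i, H 0 i j = 0 := by
    intro j hjA i
    have := congrFun (congrFun (hfac 0) i) j
    rw [diagonal_mul] at this
    simp only [mul_zero, zero_smul, zero_sub, h3, Matrix.neg_apply, hjA i, neg_zero] at this
    refine (mul_eq_zero.1 this.symm).resolve_left ?_
    split_ifs
    · exact neg_ne_zero.2 hα0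
    · exact one_ne_zero
  obtain ⟨G, hG, hfac'⟩ := HolOn.exists_mul_diagonal hH (a := 0) (by simp) {j₁, j₂} (by
    intro j hjm
    simp only [Finset.mem_insert, Finset.mem_singleton] at hjm
    rcases hjm with rfl | rfl
    · exact hcol _ hj₁
    · exact hcol _ hj₂)
  have hdet : ∀ z, ((β * z) • (1 : Matrix (Fin (m + 1)) (Fin (m + 1)) ℂ) - φ z).det =
      (z - α) ^ m * ((G z).det * z ^ 2) := by
    intro z
    rw [hfac z, det_mul, det_diagonal_ite, Finset.card_erase_of_mem (Finset.mem_univ _),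
      Finset.card_univ, Fintype.card_fin, Nat.add_sub_cancel, hfac' z, det_mul, det_diagonal_ite,
      Finset.card_pair hj, sub_zero]
  have hexp : Real.exp (2 / 7) < 2 := by
    refine (Real.exp_lt_exp.2 ?_).trans_eq (Real.exp_log two_pos)
    have := Real.log_two_gt_d9
    linarith
  have hk : DifferentiableOn ℂ (fun z => z * (G z).det / β ^ (m + 1) - 1) (Metric.ball 0 1) :=
    ((differentiableOn_id.mul hG.det).div_const _).sub_const _
  -- The function is -1 at 0, so a bound below 1 on the circle |z| = 1/2 is absurd. Each of the m +
  -- 1 factors differs from 1 by at most (1 / (8(m+1))) / (7/16), and these add up to 2/7.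
  have key : ‖0 * (G 0).det / β ^ (m + 1) - 1‖ ≤ Real.exp (2 / 7) - 1 := by
    refine norm_le_of_sphere (r := 1 / 2) hk (by norm_num) (by norm_num)
      (fun z hz => ?_) (by simp)
    have hz0 : z ≠ 0 := by rintro rfl; norm_num at hz
    have hzα : (7 / 16 : ℝ) ≤ ‖z - α‖ := by
      have := norm_sub_norm_le z α
      linarith
    have hzα0 : z - α ≠ 0 := by rw [← norm_pos_iff]; linarith
    obtain ⟨e, he⟩ := exists_charpoly_eq_prod (φ z)
    set w : Fin (m + 1) → ℂ := fun i => if i = Fin.last m then 0 else α with hw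
    have hzw : ∀ i, (7 / 16 : ℝ) ≤ ‖z - w i‖ := by
      intro i
      simp only [hw]
      split_ifs
      · rw [sub_zero, hz]; norm_num
      · exact hzα
    have hwprod : ∏ i, (z - w i) = (z - α) ^ m * z := by
      rw [Fin.prod_univ_castSucc]
      simp [hw, Fin.castSucc_ne_last]
    have hprod : z * (G z).det / β ^ (m + 1) = ∏ i, (1 + (w i - e i / β) / (z - w i)) := by
      have h5 := det_smul_one_sub_smul he (β * z) 1
      rw [one_smul, hdet] at h5
      have h6 : ∀ i, 1 + (w i - e i / β) / (z - w i) = (β * z - 1 * e i) / β / (z - w i) := by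
        intro i
        have : z - w i ≠ 0 := by rw [← norm_pos_iff]; linarith [hzw i]
        field_simp
        ring
      simp only [h6]
      rw [Finset.prod_div_distrib, Finset.prod_div_distrib, ← h5, hwprod, Finset.prod_const,
        Finset.card_univ, Fintype.card_fin]
      field_simp
    rw [hprod]
    refine (Finset.norm_prod_one_add_sub_one_le _ _).trans ?_
    refine sub_le_sub_right (Real.exp_le_exp.2 ?_) _
    refine (Finset.sum_le_card_nsmul _ _ (2 / 7 / ((m : ℝ) + 1)) fun i _ => ?_).trans_eq ?_
    · have h7 : ‖w i‖ ≤ 1 / (16 * (m + 1)) := by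
        simp only [hw]
        split_ifs
        · rw [norm_zero]; positivity
        · exact hα16
      have h8 : ‖e i / β‖ ≤ 1 / (16 * (m + 1)) := by
        rw [norm_div]
        have := h2 z (by rw [hz]; norm_num) _ (isRoot_of_charpoly_eq_prod he i)
        gcongr
      rw [norm_div, div_le_iff₀ (by linarith [hzw i])]
      calc ‖w i - e i / β‖ ≤ 1 / (16 * (m + 1)) + 1 / (16 * (m + 1)) :=
            (norm_sub_le _ _).trans (add_le_add h7 h8)
        _ = 2 / 7 / (m + 1) * (7 / 16) := by field_simp; norm_num
        _ ≤ _ := mul_le_mul_of_nonneg_left (hzw i) (by positivity)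
    · rw [Finset.card_univ, Fintype.card_fin, nsmul_eq_mul]
      push_cast
      field_simp
  simp only [zero_mul, zero_div, zero_sub, norm_neg, norm_one] at key
  linarith

end LowerBounds

/-! ### Nilpotents of non-maximal index have a kernel of dimension at least two -/

section Kernel

theorem finrank_range_le_add {V : Type*} [AddCommGroup V] [Module ℂ V] [FiniteDimensional ℂ V]
    (f g : V →ₗ[ℂ] V) : Module.finrank ℂ (LinearMap.range g) ≤
      Module.finrank ℂ (LinearMap.range (f ∘ₗ g)) + Module.finrank ℂ (LinearMap.ker f) := by
  have h := LinearMap.finrank_range_add_finrank_ker (f.domRestrict (LinearMap.range g))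
  rw [LinearMap.range_domRestrict, ← LinearMap.range_comp] at h
  rw [← h]
  refine Nat.add_le_add_left ?_ _
  let i : LinearMap.ker (f.domRestrict (LinearMap.range g)) →ₗ[ℂ] LinearMap.ker f :=
    LinearMap.codRestrict _ ((LinearMap.range g).subtype ∘ₗ Submodule.subtype _) fun x => x.2
  refine LinearMap.finrank_le_finrank_of_injective (f := i) fun x y hxy => ?_
  have := congrArg Subtype.val hxy
  exact Subtype.ext (Subtype.ext this)

/-- Each application of `f` lowers the rank by at most the dimension of its kernel, so with a kernel
of dimension at most one `m` steps cannot reach 0. -/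
theorem one_lt_finrank_ker {V : Type*} [AddCommGroup V] [Module ℂ V] [FiniteDimensional ℂ V]
    {f : V →ₗ[ℂ] V} {m : ℕ} (hf : f ^ m = 0) (hm : m < Module.finrank ℂ V) :
    1 < Module.finrank ℂ (LinearMap.ker f) := by
  by_contra! hle
  have h : ∀ k, Module.finrank ℂ V ≤ Module.finrank ℂ (LinearMap.range (f ^ k)) + k := by
    intro k
    induction k with
    | zero => rw [pow_zero, Module.End.one_eq_id, LinearMap.range_id, finrank_top, add_zero]
    | succ k ih =>
      have := finrank_range_le_add f (f ^ k)
      rw [← Module.End.mul_eq_comp, ← pow_succ'] at this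
      omega
  have := h m
  rw [hf, LinearMap.range_zero, finrank_bot] at this
  omega

theorem exists_sim_cols_zero {m : ℕ} {A : Matrix (Fin (m + 1)) (Fin (m + 1)) ℂ} (hA : A ^ m = 0)
    {j₁ j₂ : Fin (m + 1)} (hj : j₁ ≠ j₂) :
    ∃ A' : Matrix (Fin (m + 1)) (Fin (m + 1)) ℂ, Sim A A' ∧ (∀ i, A' i j₁ = 0) ∧
      ∀ i, A' i j₂ = 0 := by
  have hker : 1 < Module.finrank ℂ (LinearMap.ker (toLin' A)) :=
    one_lt_finrank_ker (by rw [← toLin'_pow, hA, map_zero]) (by simp)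
  obtain ⟨x, hx⟩ := Module.finrank_pos_iff_exists_ne_zero.1 (zero_lt_one.trans hker)
  obtain ⟨y, hy⟩ := exists_linearIndependent_pair_of_one_lt_finrank hker hx
  have hli : LinearIndependent ℂ ![(x : Fin (m + 1) → ℂ), y] := by
    rw [LinearIndependent.pair_iff] at hy ⊢
    intro s t hst
    exact hy s t (Subtype.ext hst)
  have hx0 : A *ᵥ (x : Fin (m + 1) → ℂ) = 0 := x.2
  have hy0 : A *ᵥ (y : Fin (m + 1) → ℂ) = 0 := y.2
  obtain ⟨J, _, _, X', A₂, hsim⟩ := exists_sim_fromBlocks (A := A) hli (P := 0)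
    (fun k => by fin_cases k <;> simp [hx0, hy0])
  obtain ⟨e, he0, he1⟩ := exists_equiv_of_card_eq hsim.card_eq.symm hj
  refine ⟨(fromBlocks 0 X' 0 A₂).submatrix e.symm e.symm, hsim.trans (Sim.submatrix _ _), ?_, ?_⟩
  · intro i
    rw [submatrix_apply, ← he0, e.symm_apply_apply]
    rcases e.symm i with k | k <;> simp
  · intro i
    rw [submatrix_apply, ← he1, e.symm_apply_apply]
    rcases e.symm i with k | k <;> simp

end Kernel

/-! ### Spectra of trace-zero companion matrices -/

section CompanionSpectrum
variable {m : ℕ} {a : Fin (m + 1) → ℂ}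

theorem specLT_lastColCompanion (ha : a (Fin.last m) = 0) {c : ℂ} {r : ℝ} (hr : 0 < r)
    (hr1 : r ≤ 1) (hc : ‖c‖ * (∑ i, ‖a i‖) < r ^ (m + 1)) :
    SpecLT r (lastColCompanion (c • a)) := by
  intro x hx
  by_contra! hle
  have h := norm_root_lastColCompanion ha hx
  rcases le_total ‖x‖ 1 with h1 | h1
  · rw [max_eq_left (pow_le_one₀ (norm_nonneg _) h1), mul_one] at h
    exact absurd (pow_le_pow_left₀ hr.le hle (m + 1)) (not_le.2 (h.trans_lt hc))
  · rw [max_eq_right (one_le_pow₀ h1)] at h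
    have h2 : ‖c‖ * (∑ i, ‖a i‖) < 1 := hc.trans_le (pow_le_one₀ hr.le hr1)
    have h3 : ‖x‖ ^ (m - 1) ≤ ‖x‖ ^ (m + 1) := pow_le_pow_right₀ h1 (by omega)
    have h4 : 0 < ‖x‖ ^ (m - 1) := by positivity
    have := mul_lt_mul_of_pos_right h2 h4
    linarith

theorem specLT_lastColCompanion' (hm : 1 ≤ m) (ha : a (Fin.last m) = 0) {c : ℂ} {r : ℝ}
    (hr1 : 1 ≤ r) (hc : ‖c‖ * (∑ i, ‖a i‖) < r ^ 2) :
    SpecLT r (lastColCompanion (c • a)) := by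
  intro x hx
  by_contra! hle
  have h := norm_root_lastColCompanion ha hx
  have h1 := hr1.trans hle
  have hpow : ‖x‖ ^ (m + 1) = ‖x‖ ^ 2 * ‖x‖ ^ (m - 1) := by rw [← pow_add]; congr 1; omega
  rw [max_eq_right (one_le_pow₀ h1), hpow] at h
  have h4 : 0 < ‖x‖ ^ (m - 1) := by positivity
  have := le_of_mul_le_mul_right h h4
  exact absurd (pow_le_pow_left₀ (by linarith) hle 2) (not_le.2 (this.trans_lt hc))

theorem exists_lastColCompanion_charpoly (hm : 1 ≤ m) : ∃ (d a : Fin (m + 1) → ℂ),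
    (∀ i, i ≠ Fin.last m → d i = 1) ∧ (∀ i, ‖d i‖ < m + 1) ∧ a (Fin.last m) = 0 ∧
    (∃ i, a i ≠ 0) ∧ (lastColCompanion a).charpoly = ∏ i, (X - C (d i)) := by
  -- The last eigenvalue is -m so that the sum is zero, which gives `a (Fin.last m) = 0`.
  set d : Fin (m + 1) → ℂ := fun i => if i = Fin.last m then -m else 1 with hd
  set p : ℂ[X] := ∏ i, (X - C (d i)) with hp
  have hmon : p.Monic := monic_prod_of_monic _ _ fun i _ => monic_X_sub_C _
  have hdeg : p.natDegree = m + 1 := by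
    rw [hp, natDegree_prod_of_monic _ _ fun i _ => monic_X_sub_C _]; simp
  have hsum : ∑ i, d i = 0 := by
    rw [Fin.sum_univ_castSucc]
    simp [hd, Fin.castSucc_ne_last]
  have hchar : (lastColCompanion fun i : Fin (m + 1) => -p.coeff i).charpoly = p := by
    rw [charpoly_lastColCompanion]
    conv_rhs => rw [hmon.as_sum, hdeg, Finset.sum_range]
    simp [sub_eq_add_neg]
  refine ⟨d, fun i => -p.coeff i, fun i hi => by simp [hd, hi], fun i => ?_, ?_, ?_, hchar⟩
  · simp only [hd]
    split_ifs
    · rw [norm_neg, Complex.norm_natCast]; linarith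
    · rw [norm_one]
      have : (1 : ℝ) ≤ m := by exact_mod_cast hm
      linarith
  · have h1 := prod_X_sub_C_nextCoeff (s := Finset.univ) d
    rw [hsum, neg_zero, nextCoeff_of_natDegree_pos (by rw [← hp, hdeg]; omega), ← hp, hdeg,
      Nat.add_sub_cancel] at h1
    simp [h1]
  · by_contra! h
    have h0 : p = X ^ (m + 1) := by
      rw [← hchar, charpoly_lastColCompanion]
      simp only [h]
      simp
    have h1 : p.eval 1 = 0 := by
      rw [hp, eval_prod]
      refine Finset.prod_eq_zero (Finset.mem_univ 0) ?_
      have : (0 : Fin (m + 1)) ≠ Fin.last m := by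
        intro h; have := congrArg Fin.val h; simp at this; omega
      simp [hd, this]
    rw [h0] at h1
    simp at h1

end CompanionSpectrum

/-! ### Discontinuity at nonzero nilpotents of size at least three -/

section NilpotentCentre
variable {m : ℕ}

theorem SimLim.smul {ι κ : Type*} [Fintype ι] [Fintype κ] [DecidableEq ι] [DecidableEq κ]
    {A : Matrix ι ι ℂ} {B : Matrix κ κ ℂ} (h : SimLim A B) (c : ℂ) : SimLim (c • A) (c • B) :=
  map_mem_closure (continuous_const_smul c) h fun _ hB => Sim.smul hB c

theorem specLT_smul_diagonal {ι : Type*} [Fintype ι] [DecidableEq ι] {d : ι → ℂ} {b : ℂ} {s : ℝ}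
    (hd : ∀ i, ‖d i‖ < s) (hb : ‖b‖ * s ≤ 1) : SpecLT 1 (b • diagonal d) := by
  refine SpecLT.smul (t := s) (fun x hx => ?_) one_pos hb
  obtain ⟨i, rfl⟩ := exists_eq_of_isRoot (charpoly_diagonal d) hx
  exact hd i

theorem pow_succ_eq_zero_of_charpoly {A : Matrix (Fin (m + 1)) (Fin (m + 1)) ℂ}
    (hA : A.charpoly = X ^ (m + 1)) : A ^ (m + 1) = 0 := by
  simpa using pow_card_eq_zero (A := A) (by simpa using hA)

/-- Here `A` is conjugate to `b` times a full Jordan block, and the disc turns on the last column of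
the companion matrix linearly. -/
theorem not_continuousOn_lempert_of_pow_ne_zero (hm : 2 ≤ m)
    {A : Matrix (Fin (m + 1)) (Fin (m + 1)) ℂ} (hA : A.charpoly = X ^ (m + 1)) (hA0 : A ^ m ≠ 0) :
    ¬ ContinuousOn (fun B => lempertFunction (spectralBall (m + 1)) A B)
      (spectralBall (m + 1)) := by
  intro hcont
  obtain ⟨d, a, hd1, hdm, ha, -, hch⟩ := exists_lastColCompanion_charpoly (m := m) (by omega)
  set K := ∑ i, ‖a i‖ with hK
  have hK0 : 0 ≤ K := Finset.sum_nonneg fun i _ => norm_nonneg _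
  have hm0 : (0 : ℝ) < m + 1 := by positivity
  obtain ⟨t, ht0, ht1, htK, htm⟩ : ∃ t : ℝ, 0 < t ∧ t ≤ 1 ∧ K * t < 1 / 64 ∧ t * (m + 1) ≤ 1 := by
    refine ⟨min (1 / (64 * (K + 1))) (1 / (m + 1)), by positivity, ?_, ?_, ?_⟩
    · refine (min_le_right _ _).trans ((div_le_one hm0).2 ?_)
      have : (0 : ℝ) ≤ m := by positivity
      linarith
    · refine (mul_le_mul_of_nonneg_left (min_le_left _ _) hK0).trans_lt ?_
      rw [mul_one_div, div_lt_div_iff₀ (by positivity) (by norm_num)]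
      linarith
    · refine (mul_le_mul_of_nonneg_right (min_le_right _ _) hm0.le).trans_eq ?_
      field_simp
  -- With |b| = t^m and |α| of order t^(m+1), both sides of `norm_pow_le_of_reach_diagonal` have
  -- order t^(m(m+1)); the factor 1/64 makes the inequality fail.
  set b : ℂ := ((t ^ m : ℝ) : ℂ) with hb
  set α : ℂ := ((1 / 64 * t ^ (m + 1) : ℝ) : ℂ) with hαdef
  have hbn : ‖b‖ = t ^ m := by
    rw [hb, Complex.norm_real, Real.norm_eq_abs, abs_of_pos (by positivity)]
  have hαn : ‖α‖ = 1 / 64 * t ^ (m + 1) := by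
    rw [hαdef, Complex.norm_real, Real.norm_eq_abs, abs_of_pos (by positivity)]
  have hb0 : b ≠ 0 := by rw [← norm_pos_iff, hbn]; positivity
  have hα0 : α ≠ 0 := by rw [← norm_pos_iff, hαn]; positivity
  have hα1 : ‖α‖ ≤ 1 / 64 := by
    rw [hαn]; exact mul_le_of_le_one_right (by norm_num) (pow_le_one₀ ht0.le ht1)
  have hb1 : ‖b‖ ≤ 1 := by rw [hbn]; exact pow_le_one₀ ht0.le ht1
  have hbt : ‖b‖ ≤ t := by
    rw [hbn]; exact (pow_le_pow_of_le_one ht0.le ht1 (by omega : 1 ≤ m)).trans_eq (pow_one t)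
  have hspec : ∀ z : ℂ, ‖z‖ ≤ 1 → SpecLT 1 (b • lastColCompanion ((z / α) • a)) := by
    intro z hz
    refine SpecLT.smul (t := 1 / t ^ m) (specLT_lastColCompanion' (by omega) ha
      (one_le_one_div (by positivity) (pow_le_one₀ ht0.le ht1)) ?_) one_pos
      (by rw [hbn, mul_one_div_cancel (by positivity)])
    rw [norm_div, hαn]
    calc ‖z‖ / (1 / 64 * t ^ (m + 1)) * K ≤ 1 / (1 / 64 * t ^ (m + 1)) * K := by gcongr
      _ < 1 / t ^ (m + 2) := by
        rw [div_mul_eq_mul_div, div_lt_div_iff₀ (by positivity) (by positivity), pow_succ t (m + 1)]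
        have : 0 < t ^ (m + 1) := by positivity
        nlinarith
      -- This needs m + 2 ≤ 2m, that is m ≥ 2; it fails for 2 × 2 matrices.
      _ ≤ 1 / t ^ (m * 2) := one_div_le_one_div_of_le (by positivity)
        (pow_le_pow_of_le_one ht0.le ht1 (by omega))
      _ = (1 / t ^ m) ^ 2 := by rw [_root_.one_div_pow, ← pow_mul]
  have hApow := pow_succ_eq_zero_of_charpoly hA
  have hsim : Sim A (b • lastColCompanion (m := m) 0) := by
    have h1 := (sim_lastColCompanion_zero (A := b⁻¹ • A) (by rw [_root_.smul_pow, hApow, smul_zero])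
      (by rw [_root_.smul_pow]; exact smul_ne_zero (pow_ne_zero _ (inv_ne_zero hb0)) hA0)).smul b
    rwa [smul_smul, mul_inv_cancel₀ hb0, one_smul] at h1
  have hreach : Reach A (b • lastColCompanion a) α := by
    refine Reach.sim_left (A := b • lastColCompanion 0) ⟨by linarith,
      fun z => b • lastColCompanion ((z / α) • a), ?_, fun z hz => hspec z hz.le, ?_, ?_⟩ hα0 hsim.symm
    · simp only [lastColCompanion_smul]
      exact HolOn.smul (by fun_prop) ((holOn_const _ _).add (HolOn.smul (by fun_prop) (holOn_const _ _)))
    · simp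
    · simp only [div_self hα0, one_smul]
  have hD : SpecLT 1 (b • diagonal d) := specLT_smul_diagonal hdm
    ((mul_le_mul_of_nonneg_right hbt hm0.le).trans htm)
  have hle := lempert_le_of_simLim hcont hD hα0 hreach ((simLim_diagonal rfl hch).smul b)
  have hlt : lempertFunction (spectralBall (m + 1)) A (b • diagonal d) < 2 * ‖α‖ := by
    have := norm_pos_iff.2 hα0
    linarith
  obtain ⟨α', hα', hα'lt⟩ := exists_reach_of_lempert_lt (exists_reach_of_nilpotent hA hD) hlt
  have h := norm_pow_le_of_reach_diagonal hA hd1 hb1 (by linarith) hα'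
  have h2 : ‖α'‖ ^ m ≤ (1 / 32 * t ^ (m + 1)) ^ m :=
    pow_le_pow_left₀ (norm_nonneg _) (by rw [hαn] at hα'lt; linarith) m
  have h3 : (t ^ m) ^ (m + 1) ≤ (1 / 32 * t ^ (m + 1)) ^ m * (2 ^ (m + 1) * 4 ^ m) := by
    rw [← hbn]; exact h.trans (mul_le_mul_of_nonneg_right h2 (by positivity))
  have h4 : (1 / 32 * t ^ (m + 1)) ^ m * (2 ^ (m + 1) * 4 ^ m) =
      (t ^ m) ^ (m + 1) * (2 * (1 / 4) ^ m) := by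
    rw [mul_pow, ← pow_mul, ← pow_mul, mul_comm (m + 1) m, show (1 / 32 : ℝ) = 1 / 4 * (1 / 2) * (1 / 4) by norm_num,
      mul_pow, mul_pow, pow_succ 2 m]
    have : (1 / 2 : ℝ) ^ m * 2 ^ m = 1 := by rw [← mul_pow]; norm_num
    have h' : (1 / 4 : ℝ) ^ m * 4 ^ m = 1 := by rw [← mul_pow]; norm_num
    linear_combination ((1 / 4 : ℝ) ^ m * t ^ (m * (m + 1)) * 2 * (1 / 4) ^ m * 4 ^ m) * this +
      ((1 / 4 : ℝ) ^ m * t ^ (m * (m + 1)) * 2) * h'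
  have h5 : (1 / 4 : ℝ) ^ m ≤ (1 / 4) ^ 1 := pow_le_pow_of_le_one (by norm_num) (by norm_num) (by omega)
  have h6 : 0 < (t ^ m) ^ (m + 1) := by positivity
  rw [h4] at h3
  nlinarith

/-- The disc starts at a rank-one square-zero matrix, to which every nonzero nilpotent degenerates,
and turns on the Jordan block instead. The kernel of `A` has dimension at least two, so
`lt_norm_of_reach_diagonal` applies to a conjugate of `A`. -/
theorem not_continuousOn_lempert_of_pow_eq_zero (hm : 1 ≤ m)
    {A : Matrix (Fin (m + 1)) (Fin (m + 1)) ℂ} (hA : A.charpoly = X ^ (m + 1)) (hA0 : A ≠ 0)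
    (hAm : A ^ m = 0) :
    ¬ ContinuousOn (fun B => lempertFunction (spectralBall (m + 1)) A B)
      (spectralBall (m + 1)) := by
  intro hcont
  obtain ⟨d, a, hd1, hdm, ha, ⟨i₀, hi₀⟩, hch⟩ := exists_lastColCompanion_charpoly hm
  set K := ∑ i, ‖a i‖ with hK
  have hK0 : 0 ≤ K := Finset.sum_nonneg fun i _ => norm_nonneg _
  have hm0 : (0 : ℝ) < m + 1 := by positivity
  have hm1 : (1 : ℝ) ≤ m + 1 := by linarith [(Nat.cast_nonneg m : (0 : ℝ) ≤ m)]
  -- Half the constant of the lower bound, so that the disc, of time ηb, beats it.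
  set η : ℝ := 1 / (32 * (m + 1)) with hη
  have hη0 : 0 < η := by positivity
  have hη1 : η < 1 := by rw [hη, div_lt_one (by positivity)]; linarith
  obtain ⟨b, hb0, hbK, hbm⟩ : ∃ b : ℝ, 0 < b ∧ b * K < η ^ m ∧ b * (m + 1) ≤ 1 := by
    refine ⟨min (η ^ m / (K + 1)) (1 / (m + 1)), by positivity, ?_, ?_⟩
    · refine (mul_le_mul_of_nonneg_right (min_le_left _ _) hK0).trans_lt ?_
      rw [div_mul_eq_mul_div, div_lt_iff₀ (by positivity)]
      have : 0 < η ^ m := by positivity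
      nlinarith
    · refine (mul_le_mul_of_nonneg_right (min_le_right _ _) hm0.le).trans_eq ?_
      field_simp
  have hb1 : b ≤ 1 := by nlinarith
  set α : ℂ := ((η * b : ℝ) : ℂ) with hαdef
  have hαn : ‖α‖ = η * b := by
    rw [hαdef, Complex.norm_real, Real.norm_eq_abs, abs_of_pos (by positivity)]
  have hbn : ‖(b : ℂ)‖ = b := by rw [Complex.norm_real, Real.norm_eq_abs, abs_of_pos hb0]
  have hbc : (b : ℂ) ≠ 0 := by exact_mod_cast hb0.ne'
  have hα0 : α ≠ 0 := by rw [← norm_pos_iff, hαn]; positivity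
  have hα1 : ‖α‖ < 1 := by rw [hαn]; nlinarith
  set M : ℂ → Matrix (Fin (m + 1)) (Fin (m + 1)) ℂ :=
    fun z => (b : ℂ) • ((z / α) • lastColCompanion 0 + lastCol a) with hM
  have hMhol : HolOn M Set.univ := HolOn.smul (by fun_prop)
    ((HolOn.smul (by fun_prop) (holOn_const _ _)).add (holOn_const _ _))
  have hspec : ∀ z : ℂ, ‖z‖ ≤ 1 → SpecLT 1 (M z) := by
    intro z hz
    refine specLT_of_circle (R := 2) (hMhol.mono (Set.subset_univ _)) one_pos one_lt_two one_pos
      (fun z hz => ?_) hz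
    have hz0 : z ≠ 0 := by rintro rfl; norm_num at hz
    -- On the unit circle M is a large multiple, of modulus 1/η, of a companion matrix whose
    -- eigenvalues are smaller than η. The interior follows from the maximum principle.
    have hMz : M z = (b * z / α) • lastColCompanion ((α / z) • a) := by
      rw [hM, lastColCompanion_smul]
      simp only [smul_add, smul_smul]
      congr 2
      · ring
      · field_simp
    rw [hMz]
    refine SpecLT.smul (t := η) (specLT_lastColCompanion ha hη0 hη1.le ?_) one_pos ?_
    · rw [norm_div, hz, div_one, hαn, pow_succ, mul_assoc, mul_comm η]
      exact mul_lt_mul_of_pos_right hbK hη0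
    · rw [norm_div, norm_mul, hbn, hz, hαn]
      apply le_of_eq
      field_simp
  have hM0 : M 0 = lastCol ((b : ℂ) • a) := by
    simp only [hM, zero_div, zero_smul, zero_add]
    ext i j
    simp only [lastCol, Matrix.smul_apply, of_apply, Pi.smul_apply, smul_eq_mul]
    split_ifs <;> simp
  have hMα : M α = (b : ℂ) • lastColCompanion a := by
    have := lastColCompanion_smul 1 a
    rw [one_smul, one_smul] at this
    simp only [hM, div_self hα0, one_smul, this]
  have hne : i₀ ≠ Fin.last m := by rintro rfl; exact hi₀ ha
  have hlim : SimLim A (M 0) := by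
    rw [hM0]
    exact (simLim_single (by simpa using hA) hA0 hne).trans_sim
      (sim_lastCol (by simp [ha]) (by simp [hi₀, hbc])).symm
  have hreach : Reach A ((b : ℂ) • lastColCompanion a) α := by
    rw [← hMα]
    exact SimLim.reach_left hα0 hlim (eventually_reach hMhol hspec hα1 hα0)
  have hD : SpecLT 1 ((b : ℂ) • diagonal d) := specLT_smul_diagonal hdm (by rwa [hbn])
  have hle := lempert_le_of_simLim hcont hD hα0 hreach ((simLim_diagonal rfl hch).smul b)
  obtain ⟨A', hAA', hj₁, hj₂⟩ := exists_sim_cols_zero (m := m) hAm (j₁ := 0) (j₂ := Fin.last m) (by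
    intro h; have := congrArg Fin.val h; simp at this; omega)
  have hge : b / (16 * (m + 1)) ≤ lempertFunction (spectralBall (m + 1)) A ((b : ℂ) • diagonal d) := by
    refine le_lempert (exists_reach_of_nilpotent hA hD) fun β hβ => ?_
    by_contra! hlt
    have hc0 : 0 < b / (16 * (m + 1)) := by positivity
    have hc1 : b / (16 * (m + 1)) < 1 := by rw [div_lt_one (by positivity)]; linarith
    have hcn : ‖((b / (16 * (m + 1)) : ℝ) : ℂ)‖ = b / (16 * (m + 1)) := by
      rw [Complex.norm_real, Real.norm_eq_abs, abs_of_pos hc0]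
    -- The time is enlarged to exactly the bound: it is then nonzero, as conjugating the start
    -- requires, and the strict inequality becomes x < x.
    have h := lt_norm_of_reach_diagonal (m := m) (by
      intro h; have := congrArg Fin.val h; simp at this; omega) hj₁ hj₂ hd1 (by rwa [hbn]) hbc
      ((hβ.enlarge (hlt.le.trans_eq hcn.symm) (hcn.trans_lt hc1)).sim_left
        (by exact_mod_cast hc0.ne') hAA')
    rw [hbn, hcn] at h
    exact lt_irrefl _ h
  rw [hαn, hη] at hle
  have : b / (16 * (m + 1)) ≤ 1 / (32 * (m + 1)) * b := hge.trans hle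
  rw [div_le_iff₀ (by positivity)] at this
  field_simp at this
  linarith

theorem not_continuousOn_lempert_of_nilpotent {n : ℕ} (hn : 3 ≤ n) {A : Matrix (Fin n) (Fin n) ℂ}
    (hA : A.charpoly = X ^ n) (hA0 : A ≠ 0) :
    ¬ ContinuousOn (fun B => lempertFunction (spectralBall n) A B) (spectralBall n) := by
  obtain ⟨m, rfl⟩ : ∃ m, n = m + 1 := ⟨n - 1, by omega⟩
  by_cases h : A ^ m = 0
  · exact not_continuousOn_lempert_of_pow_eq_zero (by omega) hA hA0 h
  · exact not_continuousOn_lempert_of_pow_ne_zero (by omega) hA h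

end NilpotentCentre

/-! ### Non-scalar 2 × 2 matrices are cyclic -/

section Cyclic

theorem exists_linearIndependent_mulVec {n : ℕ} {A : Matrix (Fin n) (Fin n) ℂ}
    (hA : ¬ IsScalarMatrix A) : ∃ v, LinearIndependent ℂ ![v, A *ᵥ v] := by
  by_contra! h
  obtain ⟨c, hc⟩ := LinearMap.exists_eq_smul_id_of_forall_notLinearIndependent (f := toLin' A)
    fun v hv => h v (by simpa using hv)
  refine hA ⟨c, toLin'.injective ?_⟩
  rw [hc, map_smul, toLin'_one]
  rfl

variable {A B : Matrix (Fin 2) (Fin 2) ℂ}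

theorem mul_self_fin_two (B : Matrix (Fin 2) (Fin 2) ℂ) : B * B = B.trace • B - B.det • 1 := by
  have h := aeval_self_charpoly B
  rw [charpoly_fin_two] at h
  simp only [map_add, map_sub, map_mul, map_pow, aeval_X, aeval_C,
    Algebra.algebraMap_eq_smul_one, smul_mul_assoc, one_mul] at h
  rw [← sq, ← sub_eq_zero, ← h]
  abel

theorem sim_companion_fin_two (hB : ¬ IsScalarMatrix B) :
    Sim B !![0, -B.det; 1, B.trace] := by
  obtain ⟨v, hv⟩ := exists_linearIndependent_mulVec hB
  obtain ⟨J, _, _, X', A₂, hsim⟩ := exists_sim_fromBlocks (A := B) hv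
    (P := !![0, -B.det; 1, B.trace]) (fun k => by
      fin_cases k
      · simp [Fin.sum_univ_two]
      · rw [Fin.sum_univ_two]
        change B *ᵥ (B *ᵥ v) = -B.det • v + B.trace • (B *ᵥ v)
        rw [mulVec_mulVec, mul_self_fin_two B, sub_mulVec, smul_mulVec, smul_mulVec, one_mulVec,
          neg_smul, neg_add_eq_sub])
  have hcard := hsim.card_eq
  rw [Fintype.card_sum, Fintype.card_fin] at hcard
  have : IsEmpty J := Fintype.card_eq_zero_iff.1 (by omega)
  exact hsim.trans (Sim.submatrix (fromBlocks !![0, -B.det; 1, B.trace] X' 0 A₂)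
    (Equiv.sumEmpty (Fin 2) J).symm)

theorem trace_eq_add_of_charpoly_eq_prod {d : Fin 2 → ℂ} (hd : B.charpoly = ∏ i, (X - C (d i))) :
    B.trace = d 0 + d 1 := by
  have h0 := congrArg (eval 0) hd
  have h1 := congrArg (eval 1) hd
  rw [charpoly_fin_two] at h0 h1
  simp only [Fin.prod_univ_two, eval_add, eval_sub, eval_mul, eval_pow, eval_X, eval_C] at h0 h1
  linear_combination h0 - h1

theorem not_isScalarMatrix_of_nilpotent (hA : A.charpoly = X ^ 2) (hA0 : A ≠ 0) :
    ¬ IsScalarMatrix A := by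
  rintro ⟨c, rfl⟩
  have h := isRoot_charpoly_iff_exists_mulVec.2
    (⟨1, one_ne_zero, by rw [smul_mulVec, one_mulVec]⟩ :
      ∃ v : Fin 2 → ℂ, v ≠ 0 ∧ (c • (1 : Matrix (Fin 2) (Fin 2) ℂ)) *ᵥ v = c • v)
  rw [hA, IsRoot, eval_pow, eval_X] at h
  exact hA0 (by rw [pow_eq_zero_iff two_ne_zero |>.1 h, zero_smul])

theorem trace_det_of_nilpotent (hA : A.charpoly = X ^ 2) : A.trace = 0 ∧ A.det = 0 := by
  have h0 := congrArg (eval 0) hA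
  have h1 := congrArg (eval 1) hA
  rw [charpoly_fin_two] at h0 h1
  simp only [eval_add, eval_sub, eval_mul, eval_pow, eval_X, eval_C] at h0 h1
  exact ⟨by linear_combination h0 - h1, by linear_combination h0⟩

end Cyclic

/-! ### Continuity at nonzero nilpotent 2 × 2 matrices -/

section TwoByTwo
variable {A B : Matrix (Fin 2) (Fin 2) ℂ}

/-- The square of the disc starts at 0, so the Schwarz lemma bounds its spectrum by `‖z‖`. The
resulting room to perturb is the same for all discs. -/
theorem specLE_sqrt_of_holOn {φ : ℂ → Matrix (Fin 2) (Fin 2) ℂ} (hφ : HolOn φ (Metric.ball 0 1))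
    (hs : ∀ z, ‖z‖ < 1 → SpecLT 1 (φ z)) (h0 : φ 0 * φ 0 = 0) {z : ℂ} (hz : ‖z‖ < 1) :
    SpecLE (Real.sqrt ‖z‖) (φ z) := by
  have hreach : Reach 0 (φ z ^ 2) z := by
    refine ⟨hz, fun w => φ w ^ 2, ?_, fun w hw x hx => ?_, by simp only [sq, h0], rfl⟩
    · simp only [sq]; exact hφ.mul hφ
    · rw [← mem_spectrum_iff_isRoot_charpoly, spectrum.map_pow_of_pos _ two_pos] at hx
      obtain ⟨y, hy, rfl⟩ := hx
      have := hs w hw y (mem_spectrum_iff_isRoot_charpoly.1 hy)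
      rw [norm_pow]
      exact pow_lt_one₀ (norm_nonneg _) this two_ne_zero
  intro x hx
  refine Real.le_sqrt_of_sq_le ?_
  rw [← norm_pow]
  refine hreach.specLE_of_left_zero _ ?_
  rw [← mem_spectrum_iff_isRoot_charpoly, spectrum.map_pow_of_pos _ two_pos]
  exact ⟨x, mem_spectrum_iff_isRoot_charpoly.2 hx, rfl⟩

/-- For |x| ≥ 1 the characteristic polynomial of `B` is at least ((1 - q)|x|)², while the
perturbation changes it by at most 2ε|x|. -/
theorem specLT_companion_of_norm_le {q ε : ℝ} (hB : SpecLE q B) (hq : q < 1) (hq0 : 0 ≤ q)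
    (hε : 2 * ε < (1 - q) ^ 2) {s p : ℂ} (hs : ‖s - B.trace‖ ≤ ε) (hp : ‖p - B.det‖ ≤ ε) :
    SpecLT 1 !![0, -p; 1, s] := by
  intro x hx
  by_contra! hle
  have h1 := le_norm_eval_charpoly hB (hq.le.trans hle)
  rw [Fintype.card_fin] at h1
  rw [IsRoot, charpoly_fin_two] at hx
  simp only [trace_fin_two, det_fin_two, eval_add, eval_sub, eval_mul, eval_pow, eval_X, eval_C,
    of_apply, cons_val_zero, cons_val_one, cons_val', cons_val_fin_one] at hx
  have h2 : B.charpoly.eval x = (s - B.trace) * x - (p - B.det) := by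
    rw [charpoly_fin_two]
    simp only [eval_add, eval_sub, eval_mul, eval_pow, eval_X, eval_C]
    linear_combination hx
  have hε0 : 0 ≤ ε := (norm_nonneg _).trans hs
  have h3 : ‖B.charpoly.eval x‖ ≤ ε * ‖x‖ + ε := by
    rw [h2]
    refine (norm_sub_le _ _).trans (add_le_add ?_ hp)
    rw [norm_mul]
    exact mul_le_mul_of_nonneg_right hs (norm_nonneg _)
  have h4 : (1 - q) * ‖x‖ ≤ ‖x‖ - q := by nlinarith
  have h5 : ((1 - q) * ‖x‖) ^ 2 ≤ (‖x‖ - q) ^ 2 :=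
    pow_le_pow_left₀ (mul_nonneg (by linarith) (norm_nonneg _)) h4 2
  nlinarith [mul_nonneg hε0 (sub_nonneg.2 hle), mul_lt_mul_of_pos_right hε (by linarith : 0 < ‖x‖),
    mul_nonneg (mul_nonneg (sq_nonneg (1 - q)) (norm_nonneg x)) (sub_nonneg.2 hle)]

/-- Shrink the disc to radius `ρ`, add linear terms to its trace and determinant so that they match
`B'` at the end, and lift to companion matrices. The ends are conjugate to `A` and `B'`, both
non-scalar; `B` itself may be scalar. -/
theorem Reach.perturb {B' : Matrix (Fin 2) (Fin 2) ℂ} {α : ℂ} {ρ δ : ℝ} (h : Reach A B α)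
    (hA : A.charpoly = X ^ 2) (hA0 : A ≠ 0) (hB' : ¬ IsScalarMatrix B') (hα0 : α ≠ 0)
    (hρ : ‖α‖ < ρ) (hρ1 : ρ < 1) (hδ : 2 * (ρ / ‖α‖ * δ) < (1 - Real.sqrt ρ) ^ 2)
    (htr : ‖B'.trace - B.trace‖ ≤ δ) (hdet : ‖B'.det - B.det‖ ≤ δ) :
    Reach A B' (α / ρ) := by
  obtain ⟨hα1, φ, h1, h2, h3, h4⟩ := h
  have hρ0 : 0 < ρ := (norm_nonneg α).trans_lt hρ
  have hρc : (ρ : ℂ) ≠ 0 := by exact_mod_cast hρ0.ne'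
  have hρn : ‖(ρ : ℂ)‖ = ρ := by rw [Complex.norm_real, Real.norm_eq_abs, abs_of_pos hρ0]
  obtain ⟨hAt, hAd⟩ := trace_det_of_nilpotent hA
  have hAA : A * A = 0 := by rw [mul_self_fin_two, hAt, hAd, zero_smul, zero_smul, sub_zero]
  have hmaps : Set.MapsTo (fun z : ℂ => ρ * z) (Metric.ball 0 1) (Metric.ball 0 1) := by
    intro z hz
    rw [mem_ball_zero_iff] at hz ⊢
    rw [norm_mul, hρn]
    nlinarith [norm_nonneg z]
  have h1' : HolOn (fun z => φ (ρ * z)) (Metric.ball 0 1) := h1.comp (by fun_prop) hmaps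
  set s : ℂ → ℂ := fun z => (φ (ρ * z)).trace + ρ * z / α * (B'.trace - B.trace) with hs
  set p : ℂ → ℂ := fun z => (φ (ρ * z)).det + ρ * z / α * (B'.det - B.det) with hp
  have hsd : DifferentiableOn ℂ s (Metric.ball 0 1) := by
    simp only [hs, trace_fin_two]
    exact ((h1' 0 0).add (h1' 1 1)).add (by fun_prop)
  have hpd : DifferentiableOn ℂ p (Metric.ball 0 1) := h1'.det.add (by fun_prop)
  have hα' : (ρ : ℂ) * (α / ρ) = α := mul_div_cancel₀ _ hρc
  have hreach : Reach !![0, -A.det; 1, A.trace] !![0, -B'.det; 1, B'.trace] (α / ρ) := by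
    refine ⟨?_, fun z => !![0, -p z; 1, s z], ?_, fun z hz => ?_, ?_, ?_⟩
    · rw [norm_div, hρn, div_lt_one hρ0]; exact hρ
    · intro i j
      fin_cases i <;> fin_cases j
      · exact differentiableOn_const _
      · exact hpd.neg
      · exact differentiableOn_const _
      · exact hsd
    · have hz' : ‖(ρ : ℂ) * z‖ ≤ ρ := by
        rw [norm_mul, hρn]; exact mul_le_of_le_one_right hρ0.le hz.le
      have hspec : SpecLE (Real.sqrt ρ) (φ (ρ * z)) := fun x hx =>
        (specLE_sqrt_of_holOn h1 h2 (by rw [h3, hAA]) (hz'.trans_lt hρ1) x hx).trans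
          (Real.sqrt_le_sqrt hz')
      have hcoef : ‖(ρ : ℂ) * z / α‖ ≤ ρ / ‖α‖ := by rw [norm_div]; gcongr
      refine specLT_companion_of_norm_le hspec ?_ (Real.sqrt_nonneg _) hδ ?_ ?_
      · rw [Real.sqrt_lt' one_pos]; simpa using hρ1
      · simp only [hs, add_sub_cancel_left, norm_mul (_ / _)]
        gcongr
      · simp only [hp, add_sub_cancel_left, norm_mul (_ / _)]
        gcongr
    · simp [hs, hp, h3]
    · simp only [hs, hp, hα', h4, div_self hα0, one_mul, add_sub_cancel]
  have hne : α / ρ ≠ 0 := div_ne_zero hα0 hρc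
  exact (hreach.sim_left hne (sim_companion_fin_two (not_isScalarMatrix_of_nilpotent hA hA0)).symm).sim_right
    hne (sim_companion_fin_two hB').symm

/-- Schwarz lemma for the trace, which maps the disc into the closed disc of radius 2. -/
theorem Reach.norm_trace_le {α : ℂ} (h : Reach A B α) (hA : A.trace = 0) :
    ‖B.trace‖ / 2 ≤ ‖α‖ := by
  obtain ⟨hα1, φ, h1, h2, h3, rfl⟩ := h
  have hd : DifferentiableOn ℂ (fun z => (φ z).trace) (Metric.ball 0 1) := by
    simp only [trace_fin_two]
    exact (h1 0 0).add (h1 1 1)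
  have := Complex.dist_le_div_mul_dist_of_mapsTo_ball (R₂ := 2) hd (fun z hz => by
    rw [h3, hA, mem_closedBall_zero_iff]
    obtain ⟨d, hd⟩ := exists_charpoly_eq_prod (φ z)
    rw [trace_eq_add_of_charpoly_eq_prod hd]
    have hz' := h2 z (by simpa using hz)
    have h5 := hz' _ (isRoot_of_charpoly_eq_prod hd 0)
    have h6 := hz' _ (isRoot_of_charpoly_eq_prod hd 1)
    linarith [norm_add_le (d 0) (d 1)]) (z := α) (by simpa using hα1)
  rw [h3, hA, dist_zero_right, dist_zero_right] at this
  linarith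

theorem continuousOn_lempert_of_nilpotent (hA : A.charpoly = X ^ 2) (hA0 : A ≠ 0) :
    ContinuousOn (fun B => lempertFunction (spectralBall 2) A B) (spectralBall 2) := by
  intro B₀ hB₀
  have hB₀' := mem_spectralBall_iff.1 hB₀
  have hctr : Continuous fun B : Matrix (Fin 2) (Fin 2) ℂ => B.trace := continuous_id.matrix_trace
  have hcdet : Continuous fun B : Matrix (Fin 2) (Fin 2) ℂ => B.det := continuous_id.matrix_det
  have hne : ∀ B ∈ spectralBall 2, ∃ α, Reach A B α := fun B hB =>
    exists_reach_of_nilpotent hA (mem_spectralBall_iff.1 hB)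
  have hnear : ∀ δ : ℝ, 0 < δ → ∀ᶠ B in 𝓝 B₀, ‖B.trace - B₀.trace‖ ≤ δ ∧ ‖B.det - B₀.det‖ ≤ δ := by
    intro δ hδ
    have h1 := hctr.continuousAt.eventually (Metric.closedBall_mem_nhds B₀.trace hδ)
    have h2 := hcdet.continuousAt.eventually (Metric.closedBall_mem_nhds B₀.det hδ)
    filter_upwards [h1, h2] with B h3 h4
    exact ⟨by rwa [← dist_eq_norm], by rwa [← dist_eq_norm]⟩
  -- The tolerance depends only on the time `r` and the radius `ρ`, not on the disc or its endpoint.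
  have hdelta : ∀ ρ r : ℝ, 0 < r → ρ < 1 → r < ρ →
      ∃ δ : ℝ, 0 < δ ∧ 2 * (ρ / r * δ) < (1 - Real.sqrt ρ) ^ 2 := by
    intro ρ r hr hρ hrρ
    have hρ0 := hr.trans hrρ
    have h1 : Real.sqrt ρ < 1 := by rw [Real.sqrt_lt' one_pos]; simpa using hρ
    have h2 : 0 < (1 - Real.sqrt ρ) ^ 2 := pow_pos (by linarith) 2
    refine ⟨(1 - Real.sqrt ρ) ^ 2 / (4 * (ρ / r)), by positivity, ?_⟩
    have h3 : 0 < ρ / r := by positivity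
    have h4 : ρ / r * ((1 - Real.sqrt ρ) ^ 2 / (4 * (ρ / r))) = (1 - Real.sqrt ρ) ^ 2 / 4 := by
      field_simp
    rw [h4]
    linarith
  by_cases hsc : IsScalarMatrix B₀
  · obtain ⟨c, rfl⟩ := hsc
    have htr : ‖(c • (1 : Matrix (Fin 2) (Fin 2) ℂ)).trace‖ / 2 = ‖c‖ := by
      rw [trace_smul, trace_one, smul_eq_mul, norm_mul]; simp
    have hspec : ∀ t, ‖c‖ < t → SpecLT t (c • (1 : Matrix (Fin 2) (Fin 2) ℂ)) := by
      intro t ht x hx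
      obtain ⟨v, hv, hx⟩ := isRoot_charpoly_iff_exists_mulVec.1 hx
      rw [smul_mulVec, one_mulVec] at hx
      rwa [← smul_left_injective ℂ hv hx]
    have hc1 : ‖c‖ < 1 := hB₀' c (isRoot_charpoly_iff_exists_mulVec.2
      ⟨1, one_ne_zero, by rw [smul_mulVec, one_mulVec]⟩)
    -- At a scalar matrix the upper bound by the spectral radius and the lower bound by half the
    -- trace both equal `‖c‖`.
    have hup : ∀ t, ‖c‖ < t → ∀ᶠ B in 𝓝 (c • (1 : Matrix (Fin 2) (Fin 2) ℂ)),
        lempertFunction (spectralBall 2) A B < t := by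
      intro t ht
      obtain ⟨r, hcr, hr⟩ := exists_between (lt_min ht hc1)
      have hr0 : 0 < r := (norm_nonneg c).trans_lt hcr
      have hrn : ‖(r : ℂ)‖ = r := by rw [Complex.norm_real, Real.norm_eq_abs, abs_of_pos hr0]
      filter_upwards [(isOpen_specLT r).mem_nhds (hspec r hcr)] with B hB
      have := (reach_of_nilpotent hA (B := B) (α := (r : ℂ)) (by exact_mod_cast hr0.ne')
        (by rw [hrn]; exact hr.trans_le (min_le_right _ _)) (by rwa [hrn])).lempert_le
      rw [hrn] at this
      exact this.trans_lt (hr.trans_le (min_le_left _ _))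
    have hlow : ∀ B ∈ spectralBall 2, ‖B.trace‖ / 2 ≤ lempertFunction (spectralBall 2) A B :=
      fun B hB => le_lempert (hne B hB) fun α hα => hα.norm_trace_le (trace_det_of_nilpotent hA).1
    refine tendsto_order.2 ⟨fun a ha => ?_, fun b hb => ?_⟩
    · have hac : a < ‖c‖ := by
        by_contra! hca
        obtain ⟨t, hat, ht⟩ := exists_between ha
        exact absurd (hup t (hca.trans_lt hat)).self_of_nhds (not_lt.2 ht.le)
      rw [← htr] at hac
      have hev := (hctr.norm.div_const 2).continuousAt.eventually (lt_mem_nhds hac)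
      filter_upwards [hev.filter_mono nhdsWithin_le_nhds, self_mem_nhdsWithin] with B h1 h2
      exact h1.trans_le (hlow B h2)
    · refine (hup b ?_).filter_mono nhdsWithin_le_nhds
      rw [← htr]
      exact (hlow _ hB₀).trans_lt hb
  · refine tendsto_order.2 ⟨fun a ha => ?_, fun b hb => ?_⟩
    · set l₀ := lempertFunction (spectralBall 2) A B₀ with hl₀
      change a < l₀ at ha
      have hl1 : l₀ ≤ 1 := by
        obtain ⟨α, hα⟩ := hne B₀ hB₀
        exact hα.lempert_le.trans hα.1.le
      rcases lt_or_ge a 0 with h0 | h0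
      · exact Eventually.of_forall fun B => h0.trans_le (lempert_nonneg _ _)
      obtain ⟨r, har, hr⟩ := exists_between ha
      have hr0 : 0 < r := h0.trans_lt har
      have hl0 : 0 < l₀ := hr0.trans hr
      -- A disc reaching a nearby `B` by time `r` is perturbed to reach `B₀` at time r/ρ; choosing ρ
      -- > r/l₀ makes this less than l₀.
      obtain ⟨ρ, hrρ, hρ1⟩ := exists_between ((div_lt_one hl0).2 hr)
      rw [div_lt_iff₀ hl0] at hrρ
      have hρ0 : 0 < ρ := by
        by_contra! h
        nlinarith
      have hrρ' : r < ρ := by nlinarith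
      have hrn : ‖(r : ℂ)‖ = r := by rw [Complex.norm_real, Real.norm_eq_abs, abs_of_pos hr0]
      obtain ⟨δ, hδ0, hδ⟩ := hdelta ρ r hr0 hρ1 hrρ'
      filter_upwards [(hnear δ hδ0).filter_mono nhdsWithin_le_nhds, self_mem_nhdsWithin]
        with B hB hBs
      by_contra! hle
      obtain ⟨α, hα, hαr⟩ := exists_reach_of_lempert_lt (hne B hBs) (hle.trans_lt har)
      have h1 : Reach A B (r : ℂ) := hα.enlarge (by rw [hrn]; exact hαr.le) (by rw [hrn]; linarith)
      have h2 := (h1.perturb hA hA0 hsc (by exact_mod_cast hr0.ne') (by rwa [hrn]) hρ1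
        (by rwa [hrn]) (by rw [norm_sub_rev]; exact hB.1)
        (by rw [norm_sub_rev]; exact hB.2)).lempert_le
      rw [norm_div, hrn, Complex.norm_real, Real.norm_eq_abs, abs_of_pos hρ0, le_div_iff₀ hρ0,
        mul_comm] at h2
      exact absurd hrρ (not_lt.2 h2)
    · obtain ⟨α, hα, hαb⟩ := exists_reach_of_lempert_lt (hne B₀ hB₀) hb
      obtain ⟨r, hαr, hr⟩ := exists_between (lt_min hαb hα.1)
      have hr0 : 0 < r := (norm_nonneg α).trans_lt hαr
      have hb0 : 0 < b := hr0.trans (hr.trans_le (min_le_left _ _))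
      have hr1 : r < 1 := hr.trans_le (min_le_right _ _)
      have hrn : ‖(r : ℂ)‖ = r := by rw [Complex.norm_real, Real.norm_eq_abs, abs_of_pos hr0]
      have h1 : Reach A B₀ (r : ℂ) := hα.enlarge (by rw [hrn]; exact hαr.le) (by rwa [hrn])
      -- Conversely a disc to `B₀` is perturbed to reach nearby non-scalar `B` at time r/ρ < b.
      obtain ⟨ρ, hρ, hρ1⟩ := exists_between
        (max_lt hr1 ((div_lt_one hb0).2 (hr.trans_le (min_le_left _ _))))
      have hrρ : r < ρ := (le_max_left _ _).trans_lt hρ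
      have hρ0 : 0 < ρ := hr0.trans hrρ
      have hrb : r / b < ρ := (le_max_right _ _).trans_lt hρ
      obtain ⟨δ, hδ0, hδ⟩ := hdelta ρ r hr0 hρ1 hrρ
      have hns : ∀ᶠ B in 𝓝 B₀, ¬ IsScalarMatrix B := by
        have hcl : IsClosed {B : Matrix (Fin 2) (Fin 2) ℂ | IsScalarMatrix B} := by
          have : {B : Matrix (Fin 2) (Fin 2) ℂ | IsScalarMatrix B} =
              {B | B = B 0 0 • (1 : Matrix (Fin 2) (Fin 2) ℂ)} := by
            ext B
            constructor
            · rintro ⟨c, rfl⟩; simp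
            · intro h; exact ⟨_, h⟩
          rw [this]
          exact isClosed_eq continuous_id ((continuous_id.matrix_elem 0 0).smul continuous_const)
        exact hcl.isOpen_compl.mem_nhds hsc
      filter_upwards [(hnear δ hδ0).filter_mono nhdsWithin_le_nhds,
        hns.filter_mono nhdsWithin_le_nhds] with B hB hBs
      have h2 := (h1.perturb hA hA0 hBs (by exact_mod_cast hr0.ne') (by rwa [hrn]) hρ1
        (by rwa [hrn]) hB.1 hB.2).lempert_le
      rw [norm_div, hrn, Complex.norm_real, Real.norm_eq_abs, abs_of_pos hρ0] at h2
      refine h2.trans_lt ?_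
      rw [div_lt_iff₀ hb0] at hrb
      rw [div_lt_iff₀ hρ0]
      linarith

end TwoByTwo

/-! ### Normalisation to a nilpotent centre, and the theorem -/

section Main
variable {n : ℕ}

theorem isCyclicMatrix_fin_two {A : Matrix (Fin 2) (Fin 2) ℂ} (hA : ¬ IsScalarMatrix A) :
    IsCyclicMatrix A := by
  obtain ⟨v, hv⟩ := exists_linearIndependent_mulVec hA
  refine ⟨v, ?_⟩
  have h : (fun k : Fin 2 => (A ^ (k : ℕ)).mulVec v) = ![v, A *ᵥ v] := by
    funext k
    fin_cases k <;> simp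
  rw [h]
  exact hv.span_eq_top_of_card_eq_finrank' (by simp)

theorem roots_eq_replicate {A : Matrix (Fin n) (Fin n) ℂ} {μ : ℂ}
    (h : ∀ x ∈ A.charpoly.roots, x = μ) : A.charpoly.roots = Multiset.replicate n μ := by
  refine Multiset.eq_replicate.2 ⟨?_, h⟩
  rw [← (IsAlgClosed.splits A.charpoly).natDegree_eq_card_roots, charpoly_natDegree_eq_dim,
    Fintype.card_fin]

theorem charpoly_matAut_eq_X_pow {A : Matrix (Fin n) (Fin n) ℂ} {μ : ℂ} (hμ : ‖μ‖ < 1)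
    (hA : SpecLT 1 A) (h : ∀ x ∈ A.charpoly.roots, x = μ) : (matAut μ A).charpoly = X ^ n := by
  obtain ⟨d, hd⟩ := exists_charpoly_eq_prod A
  rw [charpoly_matAut hμ hA hd]
  have hdμ : ∀ i, d i = μ := fun i =>
    h _ ((mem_roots A.charpoly_monic.ne_zero).2 (isRoot_of_charpoly_eq_prod hd i))
  simp [hdμ, discAut]

theorem matAut_ne_zero {A : Matrix (Fin n) (Fin n) ℂ} {μ : ℂ} (hμ : ‖μ‖ < 1)
    (hA : SpecLT 1 A) (h : ¬ IsScalarMatrix A) : matAut μ A ≠ 0 := by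
  intro h0
  have h1 := matAut_neg_matAut hμ hA
  have h2 := matAut_smul_one (ι := Fin n) (a := -μ) (c := 0) (by simpa using hμ) (by simp)
  rw [zero_smul, ← h0, h1] at h2
  exact h ⟨_, h2⟩

theorem isScalarMatrix_of_subsingleton [Subsingleton (Fin n)] (A : Matrix (Fin n) (Fin n) ℂ) :
    IsScalarMatrix A := by
  rcases isEmpty_or_nonempty (Fin n) with _ | ⟨⟨i⟩⟩
  · exact ⟨0, Subsingleton.elim _ _⟩
  · refine ⟨A i i, ?_⟩
    ext j k
    rw [Subsingleton.elim j i, Subsingleton.elim k i]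
    simp

end Main

theorem mainTheorem9 (n : ℕ) (A : Matrix (Fin n) (Fin n) ℂ) (hA : A ∈ spectralBall n) :
    ContinuousOn (fun B => lempertFunction (spectralBall n) A B) (spectralBall n) ↔
      IsScalarMatrix A ∨
        (n = 2 ∧ IsCyclicMatrix A ∧ ∃ μ : ℂ, A.charpoly.roots = {μ, μ}) := by
  have hA' := mem_spectralBall_iff.1 hA
  have hroot : ∀ {x}, x ∈ A.charpoly.roots → ‖x‖ < 1 := fun hx =>
    hA' _ ((mem_roots A.charpoly_monic.ne_zero).1 hx)
  constructor
  · intro hcont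
    by_contra! hcon
    obtain ⟨hs, hcon⟩ := hcon
    have hn : 2 ≤ n := by
      by_contra! h
      have : Subsingleton (Fin n) := Fin.subsingleton_iff_le_one.2 (by omega)
      exact hs (isScalarMatrix_of_subsingleton A)
    obtain ⟨d, hd⟩ := exists_charpoly_eq_prod A
    set μ := d ⟨0, by omega⟩
    have hμmem : μ ∈ A.charpoly.roots :=
      (mem_roots A.charpoly_monic.ne_zero).2 (isRoot_of_charpoly_eq_prod hd _)
    have hμ := hroot hμmem
    have hall : ∀ x ∈ A.charpoly.roots, x = μ := by
      intro x hx
      by_contra hne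
      exact not_continuousOn_lempert_of_ne hA' hx hμmem hne hcont
    rcases hn.eq_or_lt with rfl | hn
    · exact hcon rfl (isCyclicMatrix_fin_two hs) μ (roots_eq_replicate hall)
    · exact not_continuousOn_lempert_of_nilpotent hn (charpoly_matAut_eq_X_pow hμ hA' hall)
        (matAut_ne_zero hμ hA' hs) (continuousOn_lempert_matAut hμ hA' hcont)
  · rintro (hs | ⟨rfl, -, μ, hμ⟩)
    · exact continuousOn_lempert_of_isScalarMatrix hA hs
    by_cases hs : IsScalarMatrix A
    · exact continuousOn_lempert_of_isScalarMatrix hA hs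
    have hμ1 : ‖μ‖ < 1 := hroot (by rw [hμ]; simp)
    have hall : ∀ x ∈ A.charpoly.roots, x = μ := by
      intro x hx
      rw [hμ] at hx
      simpa using hx
    have h := continuousOn_lempert_matAut (a := -μ) (by simpa using hμ1) (hA'.matAut hμ1)
      (continuousOn_lempert_of_nilpotent (charpoly_matAut_eq_X_pow hμ1 hA' hall)
        (matAut_ne_zero hμ1 hA' hs))
    rwa [matAut_neg_matAut hμ1 hA'] at h
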